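/- **Conventions.** A $*$-representation of a $C^\star$-algebra $B$ is a $*$-homomorphism $\pi\colon B\to\mathcal B(\mathcal H)$, $\mathcal H$ a Hilbert space; it is irreducible if $\pi\ne 0$ and the only closed $\pi(B)$-invariant subspaces are $0$ and $\mathcal H$. $B$ is CCR if $\pi(B)\subseteq\mathcal K(\mathcal H)$ for every irreducible $\pi$, and GCR if $\pi(B)\supseteq\mathcal K(\mathcal H)$ for every irreducible $\pi$. An $m$-convex Fréchet algebra is an algebra that is a Fréchet space for a sequence of seminorms with $\|ab\|_n\le C_n\|a\|_n\|b\|_n$. Let $A$ be a unital algebra that is, through a continuous injective unital homomorphism with dense range, a subalgebra of a unital $C^\star$-algebra $B$. $A$ is spectral invariant in $B$ if every $a\in A$ that is invertible in $B$ is invertible in $A$. A Banach $A$-module $E\neq 0$ with jointly continuous action is topologically irreducible if its only closed $A$-invariant subspaces are $0$ and $E$. For $\xi\in E$ the algebraically cyclic submodule $F=A\xi\ni\xi$ carries the quotient topology from $A$ (via $a\mapsto a\xi$); $F$ is contained in a $*$-representation $\pi$ of $B$ on $\mathcal H$ if there is a continuous injective linear map $T\colon F\to\mathcal H$ with $T(a\eta)=\pi(a)T(\eta)$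 for all $a\in A$, $\eta\in F$. For a (possibly non-unital) subalgebra $A_0\subseteq A$ lying in a $C^\star$-algebra $B_0$, containment of $F$ in a $*$-representation of $B_0$ means the same with $a\in A_0$. **(1)** Let $M=\mathbb Z\cup\{\infty\}$ be the one-point compactification of $\mathbb Z$, with $\mathbb Z$ acting by $\alpha_n(z)=z+n$ for $z\in\mathbb Z$ and $\alpha_n(\infty)=\infty$. Let $B=C^\star(\mathbb Z,M)$ be the $C^\star$-crossed product of $C(M)$ by the induced action $(\alpha_nf)(x)=f(\alpha_{-n}(x))$, and let $A=\mathcal S(\mathbb Z,C(M))$ be the set of $F\colon\mathbb Z\to C(M)$ with $\|F\|_k=\sum_n(1+|n|)^k\|F(n)\|_\infty<\infty$ for all $k\in\mathbb N$, topologized by these seminorms, with the twisted convolution $(F*G)(n)=\sum_kF(k)\,\alpha_k(G(n-k))$. Then $B$ is GCR but not CCR, and $A$ is a dense $m$-convex Fréchet subalgebra of $B$ that is spectral invariant in $B$. Let $E=C_0(\mathbb Z)$, with $(F\psi)(z)=\sum_nF(n)(z)\,\psi(z-n)$. Then $E$ is a topologically irreducible Banach $A$-module with jointly continuous action. There are $\xi\in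 E$ with $\xi\notin\ell^2(\mathbb Z)$, and for every such $\xi$ the submodule $F=A\xi$ contains $\xi$ and is contained in no $*$-representation of $B$ on a Hilbert space. **(2)** Let $\mathcal K=\mathcal K(\ell^2(\mathbb N))$ be the algebra of compact operators, and let $\mathcal K^\infty$ be the algebra of matrices $[a_{nm}]$ with $\|a\|_{p,q}=\sum_{n,m}|a_{nm}|n^pm^q<\infty$ for all $p,q\in\mathbb N$, topologized by these seminorms, with matrix multiplication, acting on $\ell^2(\mathbb N)$ by matrices. Let $\tilde{\mathcal K}^\infty\subseteq\tilde{\mathcal K}$ be the unitizations. Then $\tilde{\mathcal K}$ is GCR but not CCR, and $\tilde{\mathcal K}^\infty$ is a dense $m$-convex Fréchet subalgebra of $\tilde{\mathcal K}$ that is spectral invariant in $\tilde{\mathcal K}$. Let $E=\ell^2(\mathbb N,\tfrac1{1+n^2})$ be the space of sequences with $\sum_n|\xi(n)|^2\frac1{1+n^2}<\infty$, with its Hilbert space norm, on which $\mathcal K^\infty$ acts by $(a\xi)(n)=\sum_ma_{nm}\xi(m)$ and the unit of $\tilde{\mathcal K}^\infty$ as the identity. Then $E$ is a topologically irreducible Banach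 $\tilde{\mathcal K}^\infty$-module with jointly continuous action. The constant sequence $1$ lies in $E$ but not in $\ell^2(\mathbb N)$, and for every $\xi\in E$ with $\xi\notin\ell^2(\mathbb N)$ (in particular for $\xi=1$) the submodule $F=\tilde{\mathcal K}^\infty\xi$ contains $\xi$ and is contained in no $*$-representation of $\tilde{\mathcal K}$ on a Hilbert space, nor (as a $\mathcal K^\infty$-module) in any $*$-representation of $\mathcal K$. -/

import Mathlib

open scoped ENNReal ZeroAtInfty

noncomputable section

/-! ## General notions -/

section General

/-- A `*`-representation `π` of the C⋆-algebra `B` on `H` is (topologically) irreducible if it is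
nonzero and has no closed invariant subspaces besides `0` and `H`. -/
def IsIrreducibleStarRep {B : Type*} [NonUnitalCStarAlgebra B] {H : Type*} [NormedAddCommGroup H]
    [InnerProductSpace ℂ H] [CompleteSpace H] (π : B →⋆ₙₐ[ℂ] (H →L[ℂ] H)) : Prop :=
  (∃ b, π b ≠ 0) ∧
    ∀ S : Submodule ℂ H, IsClosed (S : Set H) → (∀ b, ∀ x ∈ S, π b x ∈ S) → S = ⊥ ∨ S = ⊤

/-- CCR (liminal): every irreducible `*`-representation is by compact operators. -/
def IsCCR.{u} (B : Type u) [NonUnitalCStarAlgebra B] : Prop :=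
  ∀ (H : Type u) [NormedAddCommGroup H] [InnerProductSpace ℂ H] [CompleteSpace H]
    (π : B →⋆ₙₐ[ℂ] (H →L[ℂ] H)), IsIrreducibleStarRep π → ∀ b, IsCompactOperator (π b)

/-- GCR (postliminal): the image of every irreducible `*`-representation contains all compact
operators. -/
def IsGCR.{u} (B : Type u) [NonUnitalCStarAlgebra B] : Prop :=
  ∀ (H : Type u) [NormedAddCommGroup H] [InnerProductSpace ℂ H] [CompleteSpace H]
    (π : B →⋆ₙₐ[ℂ] (H →L[ℂ] H)), IsIrreducibleStarRep π →
      ∀ T : H →L[ℂ] H, IsCompactOperator T → ∃ b, π b = T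

/-- `A` is an `m`-convex Fréchet algebra: its topology is given by a sequence of submultiplicative
(up to constants) seminorms, is Hausdorff, and every Cauchy sequence converges. -/
def IsMConvexFrechetAlgebra (A : Type*) [Ring A] [Algebra ℂ A] [TopologicalSpace A] : Prop :=
  ∃ p : SeminormFamily ℂ A ℕ, WithSeminorms p ∧
    (∀ n, ∃ C : ℝ, 0 < C ∧ ∀ a b, p n (a * b) ≤ C * p n a * p n b) ∧
    (∀ a, (∀ n, p n a = 0) → a = 0) ∧
    ∀ s : ℕ → A, (∀ n, ∀ ε > 0, ∃ N, ∀ i ≥ N, ∀ j ≥ N, p n (s i - s j) < ε) →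
      ∃ a, Filter.Tendsto s Filter.atTop (nhds a)

/-- `A` is, via the homomorphism `i`, a dense unital `m`-convex Fréchet subalgebra of `B` with
continuous inclusion. -/
structure IsDenseFrechetSubalgebra {A B : Type*} [Ring A] [Algebra ℂ A] [TopologicalSpace A]
    [CStarAlgebra B] (i : A →ₐ[ℂ] B) : Prop where
  frechet : IsMConvexFrechetAlgebra A
  injective : Function.Injective i
  continuous : Continuous i
  dense : DenseRange i

/-- Spectral invariance of the unital subalgebra `i : A → B`: an element of `A` is invertible in
`A` if and only if it is invertible in `B`. -/
def IsSpectralInvariant {A B : Type*} [Ring A] [Algebra ℂ A] [CStarAlgebra B]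
    (i : A →ₐ[ℂ] B) : Prop :=
  ∀ a, IsUnit a ↔ IsUnit (i a)

variable {A : Type*} [Ring A] [Algebra ℂ A]
  {E : Type*} [NormedAddCommGroup E] [NormedSpace ℂ E]

/-- The `A`-module structure `ρ` on the Banach space `E` is an irreducible `A`-module: a jointly
continuous, topologically irreducible (nonzero) Fréchet module. -/
structure IsIrreducibleModule [TopologicalSpace A] [CompleteSpace E]
    (ρ : A →ₐ[ℂ] Module.End ℂ E) : Prop where
  continuous : Continuous fun x : A × E => ρ x.1 x.2
  nontrivial : Nontrivial E
  irreducible : ∀ S : Submodule ℂ E, IsClosed (S : Set E) →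
    (∀ a, ∀ x ∈ S, ρ a x ∈ S) → S = ⊥ ∨ S = ⊤

variable (E) in
/-- Bounded operators, regarded as linear endomorphisms. -/
def opToEnd : (E →L[ℂ] E) →ₐ[ℂ] Module.End ℂ E where
  toFun T := T
  map_one' := rfl
  map_mul' _ _ := rfl
  map_zero' := rfl
  map_add' _ _ := rfl
  commutes' _ := rfl

/-- The subspace `A ξ` of `E`. -/
def cyclicSubmodule (ρ : A →ₐ[ℂ] Module.End ℂ E) (ξ : E) : Submodule ℂ E :=
  LinearMap.range (ρ.toLinearMap.flip ξ)

lemma mem_cyclicSubmodule (ρ : A →ₐ[ℂ] Module.End ℂ E) (ξ : E) (a : A) :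
    ρ a ξ ∈ cyclicSubmodule ρ ξ := ⟨a, rfl⟩

/-- The algebraically cyclic module `F = A ξ` as a type of its own; it does not carry the subspace
topology of `E` but the quotient topology from `A`. -/
def Cyclic (ρ : A →ₐ[ℂ] Module.End ℂ E) (ξ : E) : Type _ := cyclicSubmodule ρ ξ

namespace Cyclic

variable (ρ : A →ₐ[ℂ] Module.End ℂ E) (ξ : E)

instance : AddCommGroup (Cyclic ρ ξ) := inferInstanceAs (AddCommGroup (cyclicSubmodule ρ ξ))

instance : Module ℂ (Cyclic ρ ξ) := inferInstanceAs (Module ℂ (cyclicSubmodule ρ ξ))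

/-- The quotient map `a ↦ a ξ` from `A` onto `A ξ`. -/
def mk : A →ₗ[ℂ] Cyclic ρ ξ := (ρ.toLinearMap.flip ξ).rangeRestrict

/-- The inclusion of `A ξ` into `E`. -/
def val : Cyclic ρ ξ →ₗ[ℂ] E := (cyclicSubmodule ρ ξ).subtype

instance [TopologicalSpace A] : TopologicalSpace (Cyclic ρ ξ) :=
  TopologicalSpace.coinduced (mk ρ ξ) inferInstance

/-- The action of `A` on the submodule `A ξ`. -/
def action : A →ₐ[ℂ] Module.End ℂ (Cyclic ρ ξ) where
  toFun a := (ρ a).restrict (p := cyclicSubmodule ρ ξ) (q := cyclicSubmodule ρ ξ) (by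
    rintro _ ⟨b, rfl⟩
    exact ⟨a * b, by simp [LinearMap.flip_apply]⟩)
  map_one' := LinearMap.ext fun x => Subtype.ext <|
    show ρ 1 (val ρ ξ x) = val ρ ξ x by simp
  map_mul' a b := LinearMap.ext fun x => Subtype.ext <|
    show ρ (a * b) (val ρ ξ x) = ρ a (ρ b (val ρ ξ x)) by simp
  map_zero' := LinearMap.ext fun x => Subtype.ext <|
    show ρ 0 (val ρ ξ x) = 0 by simp
  map_add' a b := LinearMap.ext fun x => Subtype.ext <|
    show ρ (a + b) (val ρ ξ x) = ρ a (val ρ ξ x) + ρ b (val ρ ξ x) by simp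
  commutes' c := LinearMap.ext fun x => Subtype.ext <|
    show ρ (algebraMap ℂ A c) (val ρ ξ x) = c • val ρ ξ x by simp

lemma val_action (a : A) (x : Cyclic ρ ξ) : val ρ ξ (action ρ ξ a x) = ρ a (val ρ ξ x) := rfl

lemma val_mk (a : A) : val ρ ξ (mk ρ ξ a) = ρ a ξ := rfl

end Cyclic

/-- The `A₀`-module `F` (with structure map `σ`) is contained in the `*`-representation `π` of `B`,
where `i : A₀ → B` is the inclusion: there is a continuous injective linear map `F → H` that
intertwines the actions of `A₀`. -/
def IsContainedIn {A₀ B F H : Type*} [NonUnitalRing A₀] [Module ℂ A₀] [NonUnitalCStarAlgebra B]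
    [AddCommGroup F] [Module ℂ F] [TopologicalSpace F]
    [NormedAddCommGroup H] [InnerProductSpace ℂ H] [CompleteSpace H]
    (σ : A₀ →ₙₐ[ℂ] Module.End ℂ F) (i : A₀ →ₙₐ[ℂ] B) (π : B →⋆ₙₐ[ℂ] (H →L[ℂ] H)) : Prop :=
  ∃ T : F →ₗ[ℂ] H, Function.Injective T ∧ Continuous T ∧
    ∀ (a : A₀) (x : F), T (σ a x) = π (i a) (T x)

end General

/-! ## The crossed product of the translation action of `ℤ` on its one-point compactification -/

section CrossedProduct

/-- The one-point compactification `M` of the integers. -/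
abbrev ZInfty : Type := OnePoint ℤ

/-- The action of `n` on `M`: `z ↦ z + n` for `z` in `ℤ`, `∞ ↦ ∞`. -/
def shiftM (n : ℤ) : ZInfty ≃ₜ ZInfty := (Homeomorph.addRight n).onePointCongr

lemma shiftM_coe (n z : ℤ) : shiftM n (z : ZInfty) = ((z + n : ℤ) : ZInfty) := rfl

lemma shiftM_infty (n : ℤ) : shiftM n OnePoint.infty = OnePoint.infty := rfl

lemma shiftM_zero (x : ZInfty) : shiftM 0 x = x := by
  induction x using OnePoint.rec with
  | infty => rfl
  | coe z => simp [shiftM_coe]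

lemma shiftM_shiftM (m n : ℤ) (x : ZInfty) :
    shiftM m (shiftM n x) = shiftM (m + n) x := by
  induction x using OnePoint.rec with
  | infty => rfl
  | coe z => rw [shiftM_coe, shiftM_coe, shiftM_coe, add_assoc, add_comm n m]

/-- The induced action of `ℤ` on `C(M)`: `(α_n f)(x) = f(x - n)`. -/
def alpha (n : ℤ) : C(ZInfty, ℂ) →⋆ₐ[ℂ] C(ZInfty, ℂ) :=
  ContinuousMap.compStarAlgHom' ℂ ℂ (shiftM (-n) : C(ZInfty, ZInfty))

@[simp] lemma alpha_apply (n : ℤ) (f : C(ZInfty, ℂ)) (x : ZInfty) :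
    alpha n f x = f (shiftM (-n) x) := rfl

@[simp] lemma alpha_zero (f : C(ZInfty, ℂ)) : alpha 0 f = f := by
  ext x; simp [shiftM_zero]

lemma alpha_alpha (m n : ℤ) (f : C(ZInfty, ℂ)) : alpha m (alpha n f) = alpha (m + n) f := by
  ext x; simp only [alpha_apply, shiftM_shiftM, neg_add_rev]

lemma norm_alpha (n : ℤ) (f : C(ZInfty, ℂ)) : ‖alpha n f‖ = ‖f‖ := by
  have h : ∀ (n : ℤ) (f : C(ZInfty, ℂ)), ‖alpha n f‖ ≤ ‖f‖ := fun n f =>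
    (ContinuousMap.norm_le _ (norm_nonneg _)).2 fun x => f.norm_coe_le_norm _
  refine le_antisymm (h n f) ?_
  have := h (-n) (alpha n f)
  rwa [alpha_alpha, neg_add_cancel, alpha_zero] at this

lemma alpha_tsum {ι : Type*} (n : ℤ) (f : ι → C(ZInfty, ℂ)) (hf : Summable fun i => ‖f i‖) :
    alpha n (∑' i, f i) = ∑' i, alpha n (f i) :=
  let L : C(ZInfty, ℂ) →L[ℂ] C(ZInfty, ℂ) :=
    LinearMap.mkContinuous (alpha n).toAlgHom.toLinearMap 1
      (fun f => by rw [one_mul]; exact (norm_alpha n f).le)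
  L.map_tsum hf.of_norm

/-! ### The Schwartz algebra `S(ℤ, C(M))` -/

/-- The weight `1 + |n|`. -/
def wt (n : ℤ) : ℝ := 1 + |(n : ℝ)|

lemma one_le_wt (n : ℤ) : 1 ≤ wt n := by unfold wt; linarith [abs_nonneg (n : ℝ)]

lemma wt_pos (n : ℤ) : 0 < wt n := lt_of_lt_of_le one_pos (one_le_wt n)

lemma wt_add_le (m n : ℤ) : wt (m + n) ≤ wt m * wt n := by
  unfold wt
  push_cast
  nlinarith [abs_add_le (m : ℝ) n, abs_nonneg (m : ℝ), abs_nonneg (n : ℝ)]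

/-- Rapidly decreasing functions `F : ℤ → C(M)`:
`∑ (1 + |n|) ^ k ‖F n‖ < ∞` for all `k`. -/
def schwartzSubmodule : Submodule ℂ (ℤ → C(ZInfty, ℂ)) where
  carrier := {F | ∀ k : ℕ, Summable fun n => wt n ^ k * ‖F n‖}
  zero_mem' k := by simp
  add_mem' {F G} hF hG k := by
    refine Summable.of_nonneg_of_le (fun n => by have := wt_pos n; positivity) (fun n => ?_)
      ((hF k).add (hG k))
    rw [← mul_add]
    exact mul_le_mul_of_nonneg_left (norm_add_le _ _) (pow_nonneg (wt_pos n).le _)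
  smul_mem' c F hF k := by
    refine ((hF k).mul_left ‖c‖).congr fun n => ?_
    rw [Pi.smul_apply, norm_smul]; ring

/-- The space `S(ℤ, C(M))`. -/
def SchwartzZ : Type := schwartzSubmodule

namespace SchwartzZ

instance : AddCommGroup SchwartzZ := inferInstanceAs (AddCommGroup schwartzSubmodule)

instance : Module ℂ SchwartzZ := inferInstanceAs (Module ℂ schwartzSubmodule)

/-- The underlying function of an element of `S(ℤ, C(M))`. -/
def val : SchwartzZ →ₗ[ℂ] (ℤ → C(ZInfty, ℂ)) := schwartzSubmodule.subtype

instance : CoeFun SchwartzZ fun _ => ℤ → C(ZInfty, ℂ) := ⟨val⟩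

/-- The element of `S(ℤ, C(M))` given by a rapidly decreasing function. -/
def mk (F : ℤ → C(ZInfty, ℂ)) (hF : ∀ k : ℕ, Summable fun n => wt n ^ k * ‖F n‖) : SchwartzZ :=
  (⟨F, hF⟩ : schwartzSubmodule)

lemma mk_apply (F : ℤ → C(ZInfty, ℂ)) (hF) (n : ℤ) : mk F hF n = F n := rfl

@[ext] lemma ext {F G : SchwartzZ} (h : ∀ n, F n = G n) : F = G := Subtype.ext (funext h)

lemma add_apply (F G : SchwartzZ) (n : ℤ) : (F + G) n = F n + G n := rfl

lemma zero_apply (n : ℤ) : (0 : SchwartzZ) n = 0 := rfl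

lemma smul_apply (c : ℂ) (F : SchwartzZ) (n : ℤ) : (c • F) n = c • F n := rfl

lemma summable (F : SchwartzZ) (k : ℕ) : Summable fun n => wt n ^ k * ‖F n‖ := F.2 k

lemma summable_norm (F : SchwartzZ) : Summable fun n => ‖F n‖ := by simpa using F.summable 0

/-- The seminorm `‖F‖_k = ∑ (1 + |n|) ^ k ‖F n‖`. -/
def seminorm (k : ℕ) : Seminorm ℂ SchwartzZ :=
  Seminorm.of (fun F => ∑' n, wt n ^ k * ‖F n‖)
    (fun F G => by
      rw [← (F.summable k).tsum_add (G.summable k)]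
      refine ((F + G).summable k).tsum_le_tsum (fun n => ?_) ((F.summable k).add (G.summable k))
      rw [← mul_add]
      exact mul_le_mul_of_nonneg_left (norm_add_le _ _) (pow_nonneg (wt_pos n).le _))
    (fun c F => by
      rw [← tsum_mul_left]
      refine tsum_congr fun n => ?_
      rw [smul_apply, norm_smul]; ring)

instance : TopologicalSpace SchwartzZ :=
  (SeminormFamily.moduleFilterBasis (𝕜 := ℂ) seminorm).topology

lemma summable_prod (F G : SchwartzZ) (k : ℕ) :
    Summable fun p : ℤ × ℤ => wt p.2 ^ k * (‖F p.1‖ * ‖G (p.2 - p.1)‖) := by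
  have h := (F.summable k).mul_of_nonneg (G.summable k)
    (fun n => mul_nonneg (pow_nonneg (wt_pos n).le _) (norm_nonneg _))
    (fun n => mul_nonneg (pow_nonneg (wt_pos n).le _) (norm_nonneg _))
  let e : ℤ × ℤ ≃ ℤ × ℤ :=
    ⟨fun p => (p.1, p.2 - p.1), fun p => (p.1, p.1 + p.2), fun p => by simp, fun p => by simp⟩
  refine Summable.of_nonneg_of_le
    (fun p => mul_nonneg (pow_nonneg (wt_pos _).le _) (by positivity)) (fun p => ?_)
    ((e.summable_iff).2 h)
  have : wt p.2 ^ k ≤ wt p.1 ^ k * wt (p.2 - p.1) ^ k := by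
    rw [← mul_pow]
    refine pow_le_pow_left₀ (wt_pos _).le ?_ _
    simpa using wt_add_le p.1 (p.2 - p.1)
  calc _ ≤ (wt p.1 ^ k * wt (p.2 - p.1) ^ k) * (‖F p.1‖ * ‖G (p.2 - p.1)‖) :=
        mul_le_mul_of_nonneg_right this (by positivity)
    _ = _ := by simp only [e, Function.comp, Equiv.coe_fn_mk]; ring

lemma norm_term_le (F G : SchwartzZ) (k n : ℤ) :
    ‖F k * alpha k (G (n - k))‖ ≤ ‖F k‖ * ‖G (n - k)‖ :=
  (norm_mul_le _ _).trans_eq (by rw [norm_alpha])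

lemma summable_conv (F G : SchwartzZ) (n : ℤ) :
    Summable fun k => ‖F k * alpha k (G (n - k))‖ := by
  have h := ((Equiv.prodComm ℤ ℤ).summable_iff.2 (summable_prod F G 0)).prod_factor n
  refine Summable.of_nonneg_of_le (fun _ => norm_nonneg _) (fun k => norm_term_le F G k n) ?_
  simpa using h

/-- The twisted convolution `(F * G)(n) = ∑ₖ F(k) α_k(G(n - k))`. -/
def conv (F G : SchwartzZ) : SchwartzZ :=
  mk (fun n => ∑' k, F k * alpha k (G (n - k))) (fun j => by
    have h := ((Equiv.prodComm ℤ ℤ).summable_iff.2 (summable_prod F G j)).prod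
    refine Summable.of_nonneg_of_le
      (fun n => mul_nonneg (pow_nonneg (wt_pos _).le _) (norm_nonneg _)) (fun n => ?_) h
    have h0 : Summable fun k => ‖F k‖ * ‖G (n - k)‖ := by
      simpa using ((Equiv.prodComm ℤ ℤ).summable_iff.2 (summable_prod F G 0)).prod_factor n
    simp only [Function.comp, Equiv.prodComm_apply, Prod.swap]
    rw [tsum_mul_left]
    refine mul_le_mul_of_nonneg_left ?_ (pow_nonneg (wt_pos _).le _)
    exact (norm_tsum_le_tsum_norm (summable_conv F G n)).trans
      ((summable_conv F G n).tsum_le_tsum (fun k => norm_term_le F G k n) h0))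

instance : Mul SchwartzZ := ⟨conv⟩

lemma mul_apply (F G : SchwartzZ) (n : ℤ) :
    (F * G) n = ∑' k, F k * alpha k (G (n - k)) := rfl

lemma summable_single (j : ℤ) (f : C(ZInfty, ℂ)) (k : ℕ) :
    Summable fun n => wt n ^ k * ‖(Pi.single j f : ℤ → C(ZInfty, ℂ)) n‖ :=
  summable_of_ne_finset_zero (s := {j}) (fun n hn => by
    rw [Finset.mem_singleton] at hn
    simp [Pi.single_eq_of_ne hn])

/-- The element `f δ_j` of `S(ℤ, C(M))`. -/
def single (j : ℤ) (f : C(ZInfty, ℂ)) : SchwartzZ := mk (Pi.single j f) (summable_single j f)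

lemma single_apply (j : ℤ) (f : C(ZInfty, ℂ)) (n : ℤ) :
    single j f n = (Pi.single j f : ℤ → C(ZInfty, ℂ)) n := rfl

instance : One SchwartzZ := ⟨single 0 1⟩

lemma one_apply (n : ℤ) : (1 : SchwartzZ) n = (Pi.single 0 1 : ℤ → C(ZInfty, ℂ)) n := rfl

lemma conv_assoc (F G H : SchwartzZ) : F * G * H = F * (G * H) := by
  ext1 n
  have hs : Summable fun p : ℤ × ℤ =>
      F p.1 * alpha p.1 (G p.2) * alpha (p.1 + p.2) (H (n - p.1 - p.2)) := by
    obtain ⟨C, hC⟩ : ∃ C, ∀ m, ‖H m‖ ≤ C :=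
      ⟨∑' m, ‖H m‖, fun m => H.summable_norm.le_tsum m fun _ _ => norm_nonneg _⟩
    refine Summable.of_norm_bounded (g := fun p : ℤ × ℤ => ‖F p.1‖ * ‖G p.2‖ * C)
      ((F.summable_norm.mul_of_nonneg G.summable_norm (fun _ => norm_nonneg _)
        (fun _ => norm_nonneg _)).mul_right C) (fun p => ?_)
    refine (norm_mul_le _ _).trans ?_
    rw [norm_alpha]
    refine mul_le_mul ((norm_mul_le _ _).trans_eq (by rw [norm_alpha])) (hC _) (norm_nonneg _)
      (by positivity)
  let e : ℤ × ℤ ≃ ℤ × ℤ :=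
    ⟨fun p => (p.2, p.1 - p.2), fun p => (p.1 + p.2, p.1), fun p => by simp, fun p => by simp⟩
  have hs' := e.summable_iff.2 hs
  calc (F * G * H) n
      = ∑' k, ∑' j, F j * alpha j (G (k - j)) * alpha k (H (n - k)) := by
        rw [mul_apply]
        refine tsum_congr fun k => ?_
        rw [mul_apply, (summable_conv F G k).of_norm.tsum_mul_right]
    _ = ∑' p : ℤ × ℤ, F p.1 * alpha p.1 (G p.2) * alpha (p.1 + p.2) (H (n - p.1 - p.2)) := by
        rw [← e.tsum_eq]
        refine Eq.trans ?_ (hs'.tsum_prod).symm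
        refine tsum_congr fun k => tsum_congr fun j => ?_
        simp [e]
    _ = (F * (G * H)) n := by
        rw [mul_apply, hs.tsum_prod]
        refine tsum_congr fun j => ?_
        rw [mul_apply, alpha_tsum _ _ (summable_conv G H (n - j)),
          ← Summable.tsum_mul_left]
        · refine tsum_congr fun i => ?_
          rw [map_mul, alpha_alpha, mul_assoc]
        · refine (Summable.of_norm ?_)
          simpa only [norm_alpha] using summable_conv G H (n - j)

instance : Ring SchwartzZ where
  __ := (inferInstance : AddCommGroup SchwartzZ)
  left_distrib F G H := by
    ext1 n
    rw [add_apply, mul_apply, mul_apply, mul_apply,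
      ← (summable_conv F G n).of_norm.tsum_add (summable_conv F H n).of_norm]
    exact tsum_congr fun k => by rw [add_apply, map_add, mul_add]
  right_distrib F G H := by
    ext1 n
    rw [add_apply, mul_apply, mul_apply, mul_apply,
      ← (summable_conv F H n).of_norm.tsum_add (summable_conv G H n).of_norm]
    exact tsum_congr fun k => by rw [add_apply, add_mul]
  zero_mul F := by
    ext1 n
    rw [mul_apply]
    simp [zero_apply]
  mul_zero F := by
    ext1 n
    rw [mul_apply]
    simp [zero_apply]
  mul_assoc := conv_assoc
  one_mul F := by
    ext1 n
    rw [mul_apply, tsum_eq_single 0 (fun k hk => by simp [one_apply, Pi.single_eq_of_ne hk])]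
    simp [one_apply]
  mul_one F := by
    ext1 n
    rw [mul_apply, tsum_eq_single n (fun k hk => by
      rw [one_apply, Pi.single_eq_of_ne (sub_ne_zero.2 hk.symm), map_zero, mul_zero])]
    simp [one_apply]

instance : Algebra ℂ SchwartzZ := Algebra.ofModule
  (fun c F G => by
    ext1 n
    rw [smul_apply, mul_apply, mul_apply, ← (summable_conv F G n).of_norm.tsum_const_smul]
    exact tsum_congr fun k => by rw [smul_apply, smul_mul_assoc])
  (fun c F G => by
    ext1 n
    rw [smul_apply, mul_apply, mul_apply, ← (summable_conv F G n).of_norm.tsum_const_smul]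
    exact tsum_congr fun k => by rw [smul_apply, map_smul, mul_smul_comm])

end SchwartzZ

/-! ### Integrated forms -/

/-- A covariant pair in a Banach algebra `D`: a contractive homomorphism of `C(M)` and a contractive
representation of `ℤ` with `u_n φ(f) = φ(α_n f) u_n`. -/
structure CovariantPair (D : Type*) [NormedRing D] [NormedAlgebra ℂ D] where
  φ : C(ZInfty, ℂ) →ₐ[ℂ] D
  u : Multiplicative ℤ →* D
  norm_φ : ∀ f, ‖φ f‖ ≤ ‖f‖
  norm_u : ∀ n, ‖u n‖ ≤ 1
  covariant : ∀ (n : ℤ) f, u (.ofAdd n) * φ f = φ (alpha n f) * u (.ofAdd n)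

namespace CovariantPair

variable {D : Type*} [NormedRing D] [NormedAlgebra ℂ D] (P : CovariantPair D)

lemma norm_term_le (F : SchwartzZ) (n : ℤ) : ‖P.φ (F n) * P.u (.ofAdd n)‖ ≤ ‖F n‖ :=
  (norm_mul_le _ _).trans <| by
    simpa using mul_le_mul (P.norm_φ (F n)) (P.norm_u (.ofAdd n)) (norm_nonneg _) (norm_nonneg _)

lemma summable_term (F : SchwartzZ) : Summable fun n => ‖P.φ (F n) * P.u (.ofAdd n)‖ :=
  Summable.of_nonneg_of_le (fun _ => norm_nonneg _) (P.norm_term_le F) F.summable_norm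

lemma φ_tsum (f : ℤ → C(ZInfty, ℂ)) (hf : Summable fun i => ‖f i‖) :
    P.φ (∑' i, f i) = ∑' i, P.φ (f i) :=
  let L : C(ZInfty, ℂ) →L[ℂ] D :=
    LinearMap.mkContinuous P.φ.toLinearMap 1
      (fun f => by rw [one_mul]; exact P.norm_φ f)
  L.map_tsum hf.of_norm

lemma integrated_mul [CompleteSpace D] (F G : SchwartzZ) :
    ∑' n, P.φ ((F * G) n) * P.u (.ofAdd n)
      = (∑' n, P.φ (F n) * P.u (.ofAdd n)) * ∑' n, P.φ (G n) * P.u (.ofAdd n) := by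
  rw [tsum_mul_tsum_of_summable_norm (P.summable_term F) (P.summable_term G)]
  have hs : Summable fun p : ℤ × ℤ =>
      P.φ (F p.1) * P.u (.ofAdd p.1) * (P.φ (G p.2) * P.u (.ofAdd p.2)) :=
    summable_mul_of_summable_norm (f := fun n => P.φ (F n) * P.u (.ofAdd n))
      (g := fun n => P.φ (G n) * P.u (.ofAdd n)) (P.summable_term F) (P.summable_term G)
  let e : ℤ × ℤ ≃ ℤ × ℤ :=
    ⟨fun p => (p.2, p.1 - p.2), fun p => (p.1 + p.2, p.1), fun p => by simp,
      fun p => by simp⟩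
  rw [← e.tsum_eq]
  refine Eq.trans ?_ ((e.summable_iff.2 hs).tsum_prod).symm
  refine tsum_congr fun n => ?_
  have h1 : Summable fun k => ‖P.φ (F k * alpha k (G (n - k)))‖ :=
    Summable.of_nonneg_of_le (fun _ => norm_nonneg _) (fun k => P.norm_φ _)
      (SchwartzZ.summable_conv F G n)
  rw [SchwartzZ.mul_apply, P.φ_tsum _ (SchwartzZ.summable_conv F G n),
    ← h1.of_norm.tsum_mul_right]
  refine tsum_congr fun k => ?_
  simp only [e, Equiv.coe_fn_mk, Function.comp]
  rw [map_mul, mul_assoc, mul_assoc, ← mul_assoc (P.u _), P.covariant, mul_assoc (P.φ _),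
    ← map_mul P.u, ← ofAdd_add, add_sub_cancel]

/-- The integrated form `F ↦ ∑ₙ φ(F(n)) u_n`. -/
def integrated [CompleteSpace D] : SchwartzZ →ₐ[ℂ] D :=
  AlgHom.ofLinearMap
    { toFun := fun F => ∑' n, P.φ (F n) * P.u (.ofAdd n)
      map_add' := fun F G => by
        rw [← (P.summable_term F).of_norm.tsum_add (P.summable_term G).of_norm]
        exact tsum_congr fun n => by rw [SchwartzZ.add_apply, map_add, add_mul]
      map_smul' := fun c F => by
        rw [RingHom.id_apply, ← (P.summable_term F).of_norm.tsum_const_smul]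
        exact tsum_congr fun n => by rw [SchwartzZ.smul_apply, map_smul, smul_mul_assoc] }
    (by
      change ∑' n, P.φ ((1 : SchwartzZ) n) * P.u (.ofAdd n) = 1
      rw [tsum_eq_single 0 (fun k hk => by
        rw [SchwartzZ.one_apply, Pi.single_eq_of_ne hk, map_zero, zero_mul])]
      rw [SchwartzZ.one_apply, Pi.single_eq_same, map_one, one_mul, ofAdd_zero, map_one])
    P.integrated_mul

lemma integrated_apply [CompleteSpace D] (F : SchwartzZ) :
    P.integrated F = ∑' n, P.φ (F n) * P.u (.ofAdd n) := rfl

end CovariantPair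

/-! ### The full crossed product -/

/-- A covariant representation of the dynamical system on a nonzero Hilbert space `H`: a unital
`*`-representation `π` of `C(M)` and a unitary representation `U` of `ℤ` with
`U_n π(f) U_n^* = π(α_n f)`. -/
structure CovariantRep where
  H : Type
  [normed : NormedAddCommGroup H]
  [inner : InnerProductSpace ℂ H]
  [complete : CompleteSpace H]
  [nontrivial : Nontrivial H]
  π : C(ZInfty, ℂ) →⋆ₐ[ℂ] (H →L[ℂ] H)
  U : Multiplicative ℤ →* unitary (H →L[ℂ] H)
  covariant : ∀ (n : ℤ) f,
    (U (.ofAdd n) : H →L[ℂ] H) * π f * star (U (.ofAdd n) : H →L[ℂ] H) = π (alpha n f)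

attribute [instance] CovariantRep.normed CovariantRep.inner CovariantRep.complete
  CovariantRep.nontrivial

/-- The bounded operators on the Hilbert space of a covariant representation. -/
abbrev CovariantRep.Op (i : CovariantRep) : Type := i.H →L[ℂ] i.H

/-- The `ℓ^∞`-product of the algebras of bounded operators of all covariant representations. -/
abbrev AllReps : Type 1 := lp CovariantRep.Op ∞

instance : CStarAlgebra AllReps where

namespace AllReps

@[ext] lemma ext' {x y : AllReps} (h : ∀ i, x i = y i) : x = y := lp.ext (funext h)

/-- The universal `*`-representation of `C(M)`. -/
def π : C(ZInfty, ℂ) →⋆ₐ[ℂ] AllReps where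
  toFun f := ⟨fun i => i.π f, memℓp_infty ⟨‖f‖, by
    rintro _ ⟨i, rfl⟩
    exact NonUnitalStarAlgHom.norm_apply_le i.π f⟩⟩
  map_one' := by ext1 i; exact map_one i.π
  map_mul' f g := by ext1 i; exact map_mul i.π f g
  map_zero' := by ext1 i; exact map_zero i.π
  map_add' f g := by ext1 i; exact map_add i.π f g
  commutes' c := by ext1 i; exact AlgHomClass.commutes i.π c
  map_star' f := by ext1 i; exact map_star i.π f

/-- The universal unitary representation of `ℤ`. -/
def U : Multiplicative ℤ →* AllReps where
  toFun n := ⟨fun i => (i.U n : i.Op), memℓp_infty ⟨1, by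
    rintro _ ⟨i, rfl⟩
    exact CStarRing.norm_of_mem_unitary (i.U n).2 |>.le⟩⟩
  map_one' := by ext1 i; exact congrArg Subtype.val (map_one i.U)
  map_mul' m n := by ext1 i; exact congrArg Subtype.val (map_mul i.U m n)

lemma π_apply (f : C(ZInfty, ℂ)) (i : CovariantRep) : π f i = i.π f := rfl

lemma U_apply (n : Multiplicative ℤ) (i : CovariantRep) : U n i = (i.U n : i.Op) := rfl

lemma norm_U_le (n : Multiplicative ℤ) : ‖U n‖ ≤ 1 :=
  lp.norm_le_of_forall_le zero_le_one fun i =>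
    (CStarRing.norm_of_mem_unitary (i.U n).2).le

lemma covariant (n : ℤ) (f : C(ZInfty, ℂ)) :
    U (.ofAdd n) * π f = π (alpha n f) * U (.ofAdd n) := by
  ext1 i
  change (i.U (.ofAdd n) : i.Op) * i.π f = i.π (alpha n f) * (i.U (.ofAdd n) : i.Op)
  rw [← i.covariant n f, mul_assoc _ (star _), Unitary.coe_star_mul_self, mul_one]

end AllReps

/-- The `*`-algebra generated by the universal covariant representation, norm closed. -/
def crossedSubalgebra : StarSubalgebra ℂ AllReps :=
  (StarAlgebra.adjoin ℂ (Set.range AllReps.π ∪ Set.range AllReps.U)).topologicalClosure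

/-- The crossed product C⋆-algebra `C⋆(ℤ, M)`: the closed `*`-algebra generated by the universal
covariant representation of `(C(M), ℤ)`. Equivalently, it is the completion of the convolution
algebra in the norm `‖F‖ = sup ‖∑ π(F n) U_n‖`, the supremum being over all covariant
representations. -/
def CrossedProduct : Type 1 := crossedSubalgebra

namespace CrossedProduct

instance : CStarAlgebra CrossedProduct :=
  StarSubalgebra.cstarAlgebra crossedSubalgebra
    (h_closed := StarSubalgebra.isClosed_topologicalClosure _)

/-- The inclusion of the crossed product into the product over all covariant representations. -/
def val : CrossedProduct →⋆ₐ[ℂ] AllReps := crossedSubalgebra.subtype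

lemma mem_of_π (f : C(ZInfty, ℂ)) : AllReps.π f ∈ crossedSubalgebra :=
  StarSubalgebra.le_topologicalClosure _ (StarAlgebra.subset_adjoin ℂ _ (.inl ⟨f, rfl⟩))

lemma mem_of_U (n : Multiplicative ℤ) : AllReps.U n ∈ crossedSubalgebra :=
  StarSubalgebra.le_topologicalClosure _ (StarAlgebra.subset_adjoin ℂ _ (.inr ⟨n, rfl⟩))

/-- The canonical covariant pair in the crossed product. -/
def pair : CovariantPair CrossedProduct where
  φ := (AllReps.π.codRestrict crossedSubalgebra mem_of_π).toAlgHom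
  u := AllReps.U.codRestrict crossedSubalgebra mem_of_U
  norm_φ f := NonUnitalStarAlgHom.norm_apply_le AllReps.π f
  norm_u n := AllReps.norm_U_le n
  covariant n f := Subtype.ext (AllReps.covariant n f)

end CrossedProduct

/-- The inclusion of `S(ℤ, C(M))` into `C⋆(ℤ, M)`: `F ↦ ∑ₙ F(n) u_n`. -/
def schwartzInclusion : SchwartzZ →ₐ[ℂ] CrossedProduct := CrossedProduct.pair.integrated

/-! ### The module `C₀(ℤ)` -/

namespace CZero


/-- Multiplication of a function in `C₀(ℤ)` by (the restriction to `ℤ` of) `f ∈ C(M)`. -/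
def mulFun (f : C(ZInfty, ℂ)) (ψ : C₀(ℤ, ℂ)) : C₀(ℤ, ℂ) where
  toFun z := f z * ψ z
  continuous_toFun := continuous_of_discreteTopology
  zero_at_infty' := by
    refine squeeze_zero_norm (a := fun z => ‖f‖ * ‖ψ z‖) (fun z => ?_) ?_
    · rw [norm_mul]
      exact mul_le_mul_of_nonneg_right (f.norm_coe_le_norm _) (norm_nonneg _)
    · simpa using (ψ.zero_at_infty'.norm).const_mul ‖f‖

/-- Translation `ψ ↦ ψ(· - n)` on `C₀(ℤ)`. -/
def shiftFun (n : ℤ) (ψ : C₀(ℤ, ℂ)) : C₀(ℤ, ℂ) where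
  toFun z := ψ (z - n)
  continuous_toFun := continuous_of_discreteTopology
  zero_at_infty' := ψ.zero_at_infty'.comp
    (Homeomorph.subRight n).isClosedEmbedding.tendsto_cocompact

lemma norm_le_iff {ψ : C₀(ℤ, ℂ)} {C : ℝ} (hC : 0 ≤ C) : ‖ψ‖ ≤ C ↔ ∀ z, ‖ψ z‖ ≤ C :=
  BoundedContinuousFunction.norm_le (f := ψ.toBCF) hC

lemma norm_apply_le (ψ : C₀(ℤ, ℂ)) (z : ℤ) : ‖ψ z‖ ≤ ‖ψ‖ := (norm_le_iff (norm_nonneg _)).1 le_rfl z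

/-- `mulFun` as a bounded operator. -/
def mulOp (f : C(ZInfty, ℂ)) : C₀(ℤ, ℂ) →L[ℂ] C₀(ℤ, ℂ) :=
  LinearMap.mkContinuous
    { toFun := mulFun f
      map_add' := fun ψ χ => by ext z; exact mul_add _ _ _
      map_smul' := fun c ψ => by ext z; exact mul_left_comm _ _ _ } ‖f‖
    (fun ψ => (norm_le_iff (by positivity)).2 fun z => (norm_mul_le _ _).trans
      (mul_le_mul (f.norm_coe_le_norm _) (norm_apply_le ψ z) (norm_nonneg _) (norm_nonneg _)))

/-- `shiftFun` as a bounded operator. -/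
def shiftOp (n : ℤ) : C₀(ℤ, ℂ) →L[ℂ] C₀(ℤ, ℂ) :=
  LinearMap.mkContinuous
    { toFun := shiftFun n
      map_add' := fun ψ χ => by ext z; rfl
      map_smul' := fun c ψ => by ext z; rfl } 1
    (fun ψ => (norm_le_iff (by positivity)).2 fun z => by
      rw [one_mul]; exact norm_apply_le ψ (z - n))

lemma mulOp_apply (f : C(ZInfty, ℂ)) (ψ : C₀(ℤ, ℂ)) (z : ℤ) : mulOp f ψ z = f z * ψ z := rfl

lemma shiftOp_apply (n : ℤ) (ψ : C₀(ℤ, ℂ)) (z : ℤ) : shiftOp n ψ z = ψ (z - n) := rfl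

lemma norm_mulOp_le (f : C(ZInfty, ℂ)) : ‖mulOp f‖ ≤ ‖f‖ :=
  ContinuousLinearMap.opNorm_le_bound _ (norm_nonneg _) fun ψ =>
    (norm_le_iff (by positivity)).2 fun z => (norm_mul_le _ _).trans
      (mul_le_mul (f.norm_coe_le_norm _) (norm_apply_le ψ z) (norm_nonneg _) (norm_nonneg _))

lemma norm_shiftOp_le (n : ℤ) : ‖shiftOp n‖ ≤ 1 :=
  ContinuousLinearMap.opNorm_le_bound _ zero_le_one fun ψ =>
    (norm_le_iff (by positivity)).2 fun z => by
      rw [one_mul]; exact norm_apply_le ψ (z - n)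

/-- Multiplication by `C(M)` and translation, as a covariant pair. -/
def pair : CovariantPair (C₀(ℤ, ℂ) →L[ℂ] C₀(ℤ, ℂ)) where
  φ :=
    { toFun := mulOp
      map_one' := by ext ψ z; exact one_mul _
      map_mul' := fun f g => by ext ψ z; exact mul_assoc _ _ _
      map_zero' := by ext ψ z; exact zero_mul _
      map_add' := fun f g => by ext ψ z; exact add_mul _ _ _
      commutes' := fun c => by ext ψ z; rfl }
  u :=
    { toFun := fun n => shiftOp n.toAdd
      map_one' := by ext ψ z; simp [shiftOp_apply]
      map_mul' := fun m n => by
        ext ψ z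
        change ψ (z - (m * n).toAdd) = ψ (z - m.toAdd - n.toAdd)
        rw [toAdd_mul, sub_sub] }
  norm_φ f := norm_mulOp_le f
  norm_u n := norm_shiftOp_le n.toAdd
  covariant n f := by
    ext ψ z
    change f ((z - n : ℤ) : ZInfty) * ψ (z - n) = f ((z + -n : ℤ) : ZInfty) * ψ (z - n)
    rw [sub_eq_add_neg]

/-- The `S(ℤ, C(M))`-module `C₀(ℤ)`, with action `(F ψ)(z) = ∑ₙ F(n)(z) ψ(z - n)`. -/
def rep : SchwartzZ →ₐ[ℂ] Module.End ℂ C₀(ℤ, ℂ) :=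
  (opToEnd C₀(ℤ, ℂ)).comp pair.integrated

lemma rep_apply (F : SchwartzZ) (ψ : C₀(ℤ, ℂ)) (z : ℤ) :
    rep F ψ z = ∑' n, F n z * ψ (z - n) := by
  let ev : C₀(ℤ, ℂ) →L[ℂ] ℂ :=
    LinearMap.mkContinuous
      { toFun := fun χ => χ z, map_add' := fun _ _ => rfl, map_smul' := fun _ _ => rfl } 1
      (fun χ => by rw [one_mul]; exact norm_apply_le χ z)
  exact (ev.comp (ContinuousLinearMap.apply ℂ C₀(ℤ, ℂ) ψ)).map_tsum (pair.summable_term F).of_norm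

end CZero

end CrossedProduct

/-! ## Compact operators on `ℓ²(ℕ)` and rapidly decreasing matrices -/

section Compact

/-- The Hilbert space `ℓ²(ℕ)`. -/
abbrev Ell2 : Type := lp (fun _ : ℕ => ℂ) 2

lemma IsCompactOperator.adjoint_of_hilbert {H : Type*} [NormedAddCommGroup H]
    [InnerProductSpace ℂ H] [CompleteSpace H] {T : H →L[ℂ] H} (hT : IsCompactOperator T) :
    IsCompactOperator (star T : H →L[ℂ] H) := by
  have h1 : IsCompactOperator (T * star T : H →L[ℂ] H) := hT.comp_clm (star T)
  have h2 := (isCompactOperator_iff_isCompact_closure_image_ball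
    (T * star T : H →L[ℂ] H).toLinearMap one_pos).1 h1
  refine (isCompactOperator_iff_isCompact_closure_image_ball (star T : H →L[ℂ] H).toLinearMap
    one_pos).2 ?_
  refine TotallyBounded.isCompact_of_isClosed (TotallyBounded.closure ?_) isClosed_closure
  rw [Metric.totallyBounded_iff]
  intro ε hε
  obtain ⟨t, ht, htf, hsub⟩ := Set.exists_subset_image_finite_and.1
    (Metric.finite_approx_of_totallyBounded ((h2.totallyBounded).subset subset_closure)
      (ε ^ 2 / 2) (by positivity))
  refine ⟨(star T : H →L[ℂ] H) '' t, htf.image _, ?_⟩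
  rintro _ ⟨x, hx, rfl⟩
  obtain ⟨_, ⟨y, hy, rfl⟩, hxy⟩ := Set.mem_iUnion₂.1 (hsub ⟨x, hx, rfl⟩)
  refine Set.mem_iUnion₂.2 ⟨_, ⟨y, hy, rfl⟩, ?_⟩
  have hx1 : ‖x‖ < 1 := by simpa using hx
  have hy1 : ‖y‖ < 1 := by simpa using ht hy
  rw [Metric.mem_ball, dist_eq_norm] at hxy ⊢
  change ‖T (star T x) - T (star T y)‖ < ε ^ 2 / 2 at hxy
  change ‖star T x - star T y‖ < ε
  rw [← map_sub, ← map_sub] at hxy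
  rw [← map_sub]
  have h3 : ‖star T (x - y)‖ ^ 2 ≤ ‖T (star T (x - y))‖ * ‖x - y‖ := by
    rw [← inner_self_eq_norm_sq (𝕜 := ℂ)]
    conv_lhs => rw [ContinuousLinearMap.star_eq_adjoint, ContinuousLinearMap.adjoint_inner_right]
    exact (RCLike.re_le_norm _).trans (norm_inner_le_norm _ _)
  have h4 : ‖x - y‖ ≤ 2 := (norm_sub_le _ _).trans (by linarith)
  have h5 : ‖T (star T (x - y))‖ * ‖x - y‖ < ε ^ 2 := by
    have := mul_le_mul_of_nonneg_left h4 (norm_nonneg (T (star T (x - y))))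
    linarith
  exact lt_of_pow_lt_pow_left₀ 2 hε.le (h3.trans_lt h5)

/-- The C⋆-algebra `K` of compact operators on `ℓ²(ℕ)`, as a subalgebra of the bounded operators. -/
def compactSubalgebra : NonUnitalStarSubalgebra ℂ (Ell2 →L[ℂ] Ell2) where
  carrier := {T | IsCompactOperator T}
  zero_mem' := isCompactOperator_zero
  add_mem' hS hT := hS.add hT
  smul_mem' c _ hT := hT.smul c
  mul_mem' {_ T} hS _ := hS.comp_clm T
  star_mem' hT := hT.adjoint_of_hilbert

lemma isClosed_compactSubalgebra : IsClosed (compactSubalgebra : Set (Ell2 →L[ℂ] Ell2)) :=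
  isClosed_setOfPred_isCompactOperator

/-- The C⋆-algebra `K` of compact operators on `ℓ²(ℕ)`. -/
def CompactOps : Type := compactSubalgebra

instance : NonUnitalCStarAlgebra CompactOps :=
  NonUnitalStarSubalgebra.nonUnitalCStarAlgebra compactSubalgebra
    (h_closed := isClosed_compactSubalgebra)

/-! ### The algebra `K^∞` -/

/-- Matrices with `∑ |a n m| n^p m^q < ∞` for all `p, q`. -/
def rapidSubmodule : Submodule ℂ (ℕ → ℕ → ℂ) where
  carrier := {a | ∀ p q : ℕ, Summable fun x : ℕ × ℕ => ‖a x.1 x.2‖ * (x.1 : ℝ) ^ p * (x.2 : ℝ) ^ q}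
  zero_mem' p q := by simp
  add_mem' {a b} ha hb p q := by
    refine Summable.of_nonneg_of_le (fun x => by positivity) (fun x => ?_)
      ((ha p q).add (hb p q))
    rw [← add_mul, ← add_mul]
    gcongr
    exact norm_add_le _ _
  smul_mem' c a ha p q := by
    refine ((ha p q).mul_left ‖c‖).congr fun x => ?_
    simp only [Pi.smul_apply, norm_smul]; ring

/-- The space `K^∞` of rapidly decreasing matrices. -/
def KInf : Type := rapidSubmodule

namespace KInf

instance : AddCommGroup KInf := inferInstanceAs (AddCommGroup rapidSubmodule)

instance : Module ℂ KInf := inferInstanceAs (Module ℂ rapidSubmodule)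

/-- The underlying matrix. -/
def val : KInf →ₗ[ℂ] (ℕ → ℕ → ℂ) := rapidSubmodule.subtype

instance : CoeFun KInf fun _ => ℕ → ℕ → ℂ := ⟨val⟩

/-- The element of `K^∞` given by a rapidly decreasing matrix. -/
def mk (a : ℕ → ℕ → ℂ)
    (ha : ∀ p q : ℕ, Summable fun x : ℕ × ℕ => ‖a x.1 x.2‖ * (x.1 : ℝ) ^ p * (x.2 : ℝ) ^ q) :
    KInf :=
  (⟨a, ha⟩ : rapidSubmodule)

@[ext] lemma ext {a b : KInf} (h : ∀ n m, a n m = b n m) : a = b :=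
  Subtype.ext (funext fun n => funext (h n))

lemma add_apply (a b : KInf) (n m : ℕ) : (a + b) n m = a n m + b n m := rfl

lemma zero_apply (n m : ℕ) : (0 : KInf) n m = 0 := rfl

lemma smul_apply (c : ℂ) (a : KInf) (n m : ℕ) : (c • a) n m = c * a n m := rfl

lemma summable (a : KInf) (p q : ℕ) :
    Summable fun x : ℕ × ℕ => ‖a x.1 x.2‖ * (x.1 : ℝ) ^ p * (x.2 : ℝ) ^ q := a.2 p q

lemma summable_norm (a : KInf) : Summable fun x : ℕ × ℕ => ‖a x.1 x.2‖ := by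
  simpa using a.summable 0 0

/-- The seminorm `‖a‖_{p,q} = ∑ |a n m| n^p m^q`. -/
def seminorm (pq : ℕ × ℕ) : Seminorm ℂ KInf :=
  Seminorm.of (fun a => ∑' x : ℕ × ℕ, ‖a x.1 x.2‖ * (x.1 : ℝ) ^ pq.1 * (x.2 : ℝ) ^ pq.2)
    (fun a b => by
      rw [← (a.summable _ _).tsum_add (b.summable _ _)]
      refine ((a + b).summable _ _).tsum_le_tsum (fun x => ?_)
        ((a.summable _ _).add (b.summable _ _))
      rw [← add_mul, ← add_mul]
      gcongr
      exact norm_add_le _ _)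
    (fun c a => by
      rw [← tsum_mul_left]
      refine tsum_congr fun x => ?_
      rw [smul_apply, norm_mul]; ring)

instance : TopologicalSpace KInf :=
  (SeminormFamily.moduleFilterBasis (𝕜 := ℂ) seminorm).topology

lemma exists_bound (a : KInf) : ∃ C, ∀ n m, ‖a n m‖ ≤ C :=
  ⟨∑' x : ℕ × ℕ, ‖a x.1 x.2‖, fun n m =>
    a.summable_norm.le_tsum (n, m) fun _ _ => norm_nonneg _⟩

lemma summable_row (a : KInf) (n : ℕ) : Summable fun m => ‖a n m‖ := a.summable_norm.prod_factor n

lemma summable_conv (a b : KInf) (n m : ℕ) : Summable fun k => ‖a n k * b k m‖ := by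
  obtain ⟨C, hC⟩ := b.exists_bound
  refine Summable.of_nonneg_of_le (fun _ => norm_nonneg _) (fun k => ?_)
    ((a.summable_row n).mul_right C)
  rw [norm_mul]
  exact mul_le_mul_of_nonneg_left (hC _ _) (norm_nonneg _)

/-- `|a n k| |b k m| n^p m^q` is summable over all `n, m, k`. -/
lemma summable_triple (a b : KInf) (p q : ℕ) : Summable fun x : (ℕ × ℕ) × ℕ =>
    ‖a x.1.1 x.2 * b x.2 x.1.2‖ * (x.1.1 : ℝ) ^ p * (x.1.2 : ℝ) ^ q := by
  have h := (a.summable p 0).mul_of_nonneg (b.summable 0 q)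
    (fun _ => by positivity) (fun _ => by positivity)
  have hinj : Function.Injective
      (fun x : (ℕ × ℕ) × ℕ => (((x.1.1, x.2), (x.2, x.1.2)) : (ℕ × ℕ) × (ℕ × ℕ))) := by
    rintro ⟨⟨a, b⟩, c⟩ ⟨⟨a', b'⟩, c'⟩ h
    simp only [Prod.mk.injEq] at h
    obtain ⟨⟨rfl, rfl⟩, -, rfl⟩ := h
    rfl
  refine (h.comp_injective hinj).congr fun x => ?_
  simp only [Function.comp, pow_zero, mul_one, norm_mul]; ring

/-- Matrix multiplication. -/
def mulAux (a b : KInf) : KInf :=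
  mk (fun n m => ∑' k, a n k * b k m) (fun p q => by
    refine Summable.of_nonneg_of_le (fun x => by positivity) (fun x => ?_)
      (summable_triple a b p q).prod
    simp only
    rw [tsum_mul_right, tsum_mul_right]
    gcongr
    exact norm_tsum_le_tsum_norm (summable_conv a b x.1 x.2))

instance : Mul KInf := ⟨mulAux⟩

lemma mul_apply (a b : KInf) (n m : ℕ) : (a * b) n m = ∑' k, a n k * b k m := rfl

lemma mul_assoc' (a b c : KInf) : a * b * c = a * (b * c) := by
  ext n m
  have hs : Summable fun x : ℕ × ℕ => a n x.1 * b x.1 x.2 * c x.2 m := by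
    obtain ⟨A, hA⟩ := a.exists_bound
    obtain ⟨C, hC⟩ := c.exists_bound
    refine Summable.of_norm_bounded ((b.summable_norm.mul_left A).mul_right C) (fun x => ?_)
    rw [norm_mul, norm_mul]
    have := (norm_nonneg _).trans (hA 0 0)
    gcongr
    exacts [hA _ _, hC _ _]
  calc (a * b * c) n m = ∑' l, ∑' k, a n k * b k l * c l m := by
        rw [mul_apply]
        refine tsum_congr fun l => ?_
        rw [mul_apply, (summable_conv a b n l).of_norm.tsum_mul_right]
    _ = ∑' k, ∑' l, a n k * b k l * c l m := 
        Summable.tsum_comm (f := fun k l => a n k * b k l * c l m) hs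
    _ = (a * (b * c)) n m := by
        rw [mul_apply]
        refine tsum_congr fun k => ?_
        rw [mul_apply, ← (summable_conv b c k m).of_norm.tsum_mul_left]
        exact tsum_congr fun l => mul_assoc _ _ _

instance : NonUnitalRing KInf where
  __ := (inferInstance : AddCommGroup KInf)
  left_distrib a b c := by
    ext n m
    rw [add_apply, mul_apply, mul_apply, mul_apply,
      ← (summable_conv a b n m).of_norm.tsum_add (summable_conv a c n m).of_norm]
    exact tsum_congr fun k => by rw [add_apply, mul_add]
  right_distrib a b c := by
    ext n m
    rw [add_apply, mul_apply, mul_apply, mul_apply,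
      ← (summable_conv a c n m).of_norm.tsum_add (summable_conv b c n m).of_norm]
    exact tsum_congr fun k => by rw [add_apply, add_mul]
  zero_mul a := by ext n m; rw [mul_apply]; simp [zero_apply]
  mul_zero a := by ext n m; rw [mul_apply]; simp [zero_apply]
  mul_assoc := mul_assoc'

instance : IsScalarTower ℂ KInf KInf where
  smul_assoc c a b := by
    ext n m
    rw [smul_eq_mul, smul_eq_mul, smul_apply, mul_apply, mul_apply,
      ← (summable_conv a b n m).of_norm.tsum_mul_left]
    exact tsum_congr fun k => by rw [smul_apply, mul_assoc]

instance : SMulCommClass ℂ KInf KInf where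
  smul_comm c a b := by
    ext n m
    rw [smul_eq_mul, smul_eq_mul, smul_apply, mul_apply, mul_apply,
      ← (summable_conv a b n m).of_norm.tsum_mul_left]
    exact tsum_congr fun k => by rw [smul_apply, mul_left_comm]

end KInf

/-- The unitization of `K^∞` carries the product topology of `ℂ × K^∞`. -/
instance : TopologicalSpace (Unitization ℂ KInf) :=
  TopologicalSpace.induced (fun x => (x.fst, x.snd)) inferInstance

/-! ### Matrices acting on sequence spaces -/

/-- A Banach space with a biorthogonal system `(e n, f n)` with `‖e n‖ ≤ 1` and `‖f n‖ ≤ 1 + n`. -/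
structure CoordSystem (X : Type*) [NormedAddCommGroup X] [NormedSpace ℂ X] where
  e : ℕ → X
  f : ℕ → (X →L[ℂ] ℂ)
  norm_e : ∀ n, ‖e n‖ ≤ 1
  norm_f : ∀ n, ‖f n‖ ≤ 1 + n
  biorth : ∀ n m, f n (e m) = if n = m then 1 else 0

namespace CoordSystem

variable {X : Type*} [NormedAddCommGroup X] [NormedSpace ℂ X] (S : CoordSystem X)

/-- The matrix unit `ξ ↦ f_m(ξ) e_n`. -/
def unit (n m : ℕ) : X →L[ℂ] X := (S.f m).smulRight (S.e n)

lemma unit_apply (n m : ℕ) (x : X) : S.unit n m x = S.f m x • S.e n := rfl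

lemma unit_mul (n m k l : ℕ) :
    S.unit n m * S.unit k l = if m = k then S.unit n l else 0 := by
  ext x
  change S.f m (S.f l x • S.e k) • S.e n = _
  rw [map_smul, S.biorth]
  split_ifs <;> simp [unit_apply]

lemma norm_unit_le (n m : ℕ) : ‖S.unit n m‖ ≤ 1 + m := by
  rw [unit, ContinuousLinearMap.norm_smulRight_apply]
  calc _ ≤ (1 + m : ℝ) * 1 := mul_le_mul (S.norm_f m) (S.norm_e n) (norm_nonneg _) (by positivity)
    _ = _ := mul_one _

lemma summable_term (a : KInf) : Summable fun x : ℕ × ℕ => ‖a x.1 x.2 • S.unit x.1 x.2‖ := by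
  refine Summable.of_nonneg_of_le (fun _ => norm_nonneg _) (fun x => ?_)
    ((a.summable 0 0).add (a.summable 0 1))
  rw [norm_smul]
  calc _ ≤ ‖a x.1 x.2‖ * (1 + x.2) :=
        mul_le_mul_of_nonneg_left (S.norm_unit_le _ _) (norm_nonneg _)
    _ = _ := by ring

lemma isCompactOperator_unit (n m : ℕ) : IsCompactOperator (S.unit n m) :=
  (isCompactOperator_of_locallyCompactSpace_dom (S.f m)).clm_comp
    ((ContinuousLinearMap.id ℂ ℂ).smulRight (S.e n))

variable [CompleteSpace X]

lemma toOp_mul (a b : KInf) :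
    ∑' x : ℕ × ℕ, (a * b) x.1 x.2 • S.unit x.1 x.2 =
      (∑' x : ℕ × ℕ, a x.1 x.2 • S.unit x.1 x.2) * ∑' x : ℕ × ℕ, b x.1 x.2 • S.unit x.1 x.2 := by
  rw [tsum_mul_tsum_of_summable_norm (S.summable_term a) (S.summable_term b)]
  let j : (ℕ × ℕ) × ℕ → (ℕ × ℕ) × (ℕ × ℕ) := fun x => ((x.1.1, x.2), (x.2, x.1.2))
  have hinj : Function.Injective j := by
    rintro ⟨⟨a, b⟩, c⟩ ⟨⟨a', b'⟩, c'⟩ h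
    simp only [j, Prod.mk.injEq] at h
    obtain ⟨⟨rfl, rfl⟩, -, rfl⟩ := h
    rfl
  have hs := summable_mul_of_summable_norm (f := fun x : ℕ × ℕ => a x.1 x.2 • S.unit x.1 x.2)
    (g := fun x : ℕ × ℕ => b x.1 x.2 • S.unit x.1 x.2) (S.summable_term a) (S.summable_term b)
  have h0 : Function.support (fun x : (ℕ × ℕ) × (ℕ × ℕ) =>
      a x.1.1 x.1.2 • S.unit x.1.1 x.1.2 * b x.2.1 x.2.2 • S.unit x.2.1 x.2.2) ⊆ Set.range j := by
    rintro ⟨⟨n, m⟩, k, l⟩ hx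
    by_cases h : m = k
    · subst h; exact ⟨((n, l), m), rfl⟩
    · refine (hx ?_).elim
      simp only [smul_mul_smul_comm, unit_mul, if_neg h, smul_zero]
  rw [← hinj.tsum_eq h0]
  refine Eq.trans ?_ ((hs.comp_injective hinj).tsum_prod).symm
  refine tsum_congr fun x => ?_
  rw [KInf.mul_apply, ← Summable.tsum_smul_const (KInf.summable_conv a b _ _).of_norm]
  refine tsum_congr fun k => ?_
  change _ = a x.1 k • S.unit x.1 k * b k x.2 • S.unit k x.2
  rw [smul_mul_smul_comm, unit_mul, if_pos rfl]

/-- The operator `∑ a n m • E n m` given by a rapidly decreasing matrix. -/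
def toOp : KInf →ₙₐ[ℂ] (X →L[ℂ] X) where
  toFun a := ∑' x : ℕ × ℕ, a x.1 x.2 • S.unit x.1 x.2
  map_smul' c a := by
    rw [MonoidHom.id_apply, ← (S.summable_term a).of_norm.tsum_const_smul]
    exact tsum_congr fun x => by rw [KInf.smul_apply, mul_smul]
  map_zero' := by simp [KInf.zero_apply]
  map_add' a b := by
    rw [← (S.summable_term a).of_norm.tsum_add (S.summable_term b).of_norm]
    exact tsum_congr fun x => by rw [KInf.add_apply, add_smul]
  map_mul' := S.toOp_mul

lemma toOp_eq (a : KInf) : S.toOp a = ∑' x : ℕ × ℕ, a x.1 x.2 • S.unit x.1 x.2 := rfl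

/-- The coordinates of `a ξ` are `∑ₘ a n m ξ m`. -/
lemma f_toOp (a : KInf) (ξ : X) (n : ℕ) : S.f n (S.toOp a ξ) = ∑' m, a n m * S.f m ξ := by
  let L := (S.f n).comp (ContinuousLinearMap.apply ℂ X ξ)
  have hL : ∀ x : ℕ × ℕ, L (a x.1 x.2 • S.unit x.1 x.2)
      = if n = x.1 then a x.1 x.2 * S.f x.2 ξ else 0 := fun x => by
    change S.f n (a x.1 x.2 • S.f x.2 ξ • S.e x.1) = _
    rw [map_smul, map_smul, S.biorth]
    split_ifs <;> simp
  have hs := (S.summable_term a).of_norm.map L L.continuous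
  have h1 : S.f n (S.toOp a ξ) = ∑' x : ℕ × ℕ, L (a x.1 x.2 • S.unit x.1 x.2) :=
    L.map_tsum (S.summable_term a).of_norm
  rw [h1]
  refine (Summable.tsum_prod hs).trans ?_
  rw [tsum_eq_single n]
  · exact tsum_congr fun m => by rw [Function.comp, hL, if_pos rfl]
  · intro k hk
    exact (tsum_congr fun c => (hL (k, c)).trans (if_neg hk.symm)).trans tsum_zero

lemma isCompactOperator_toOp (a : KInf) : IsCompactOperator (S.toOp a) := by
  have hc : IsClosed ((compactOperator (RingHom.id ℂ) X X : Submodule ℂ (X →L[ℂ] X)) :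
      Set (X →L[ℂ] X)) := isClosed_setOfPred_isCompactOperator
  refine hc.mem_of_tendsto (S.summable_term a).of_norm.hasSum (Filter.Eventually.of_forall ?_)
  exact fun s => Submodule.sum_mem _ fun x _ => Submodule.smul_mem _ _ (S.isCompactOperator_unit _ _)

end CoordSystem

/-! ### `K^∞` inside the compact operators, and the unitizations -/

/-- The standard coordinates of `ℓ²(ℕ)`. -/
def ell2Coord : CoordSystem Ell2 where
  e n := lp.single 2 n 1
  f n := LinearMap.mkContinuous
    { toFun := fun ξ => ξ n, map_add' := fun _ _ => rfl, map_smul' := fun _ _ => rfl } 1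
    (fun ξ => by rw [one_mul]; exact lp.norm_apply_le_norm two_ne_zero ξ n)
  norm_e n := by simp
  norm_f n := (LinearMap.mkContinuous_norm_le _ zero_le_one _).trans (by simp)
  biorth n m := by
    change lp.single (E := fun _ : ℕ => ℂ) 2 m 1 n = _
    rw [lp.single_apply, Pi.single_apply]

/-- The inclusion `K^∞ → K`; the matrix `a` acts on `ℓ²(ℕ)` by `(a ξ)(n) = ∑ₘ a n m ξ m`. -/
def kInfInclusion : KInf →ₙₐ[ℂ] CompactOps :=
  NonUnitalAlgHom.codRestrict ell2Coord.toOp compactSubalgebra.toNonUnitalSubalgebra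
    ell2Coord.isCompactOperator_toOp

lemma kInfInclusion_apply (a : KInf) (ξ : Ell2) (n : ℕ) :
    (show Ell2 →L[ℂ] Ell2 from Subtype.val (kInfInclusion a)) ξ n = ∑' m, a n m * ξ m :=
  ell2Coord.f_toOp a ξ n

/-- The inclusion of the unitization of `K^∞` into the unitization of `K`. -/
def unitizedInclusion : Unitization ℂ KInf →ₐ[ℂ] Unitization ℂ CompactOps :=
  Unitization.lift ((Unitization.inrNonUnitalAlgHom ℂ CompactOps).comp kInfInclusion)

/-! ### The module `ℓ²(ℕ, 1/(1 + n²))` -/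

/-- Sequences with `∑ |ξ n|² / (1 + n²) < ∞`. -/
def weightedSubmodule : Submodule ℂ (ℕ → ℂ) where
  carrier := {ξ | Summable fun n : ℕ => ‖ξ n‖ ^ 2 * (1 / (1 + (n : ℝ) ^ 2))}
  zero_mem' := by simp
  add_mem' {ξ η} hξ hη := by
    refine Summable.of_nonneg_of_le (fun n => by positivity) (fun n => ?_)
      ((hξ.mul_left 2).add (hη.mul_left 2))
    rw [← mul_assoc, ← mul_assoc, ← add_mul]
    refine mul_le_mul_of_nonneg_right ?_ (by positivity)
    have h := norm_add_le (ξ n) (η n)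
    have h2 : ‖(ξ + η) n‖ ^ 2 ≤ (‖ξ n‖ + ‖η n‖) ^ 2 := by gcongr; exact h
    nlinarith [sq_nonneg (‖ξ n‖ - ‖η n‖)]
  smul_mem' c ξ hξ := by
    refine (hξ.mul_left (‖c‖ ^ 2)).congr fun n => ?_
    rw [Pi.smul_apply, norm_smul]; ring

/-- The space `ℓ²(ℕ, 1/(1 + n²))`. -/
def WeightedEll2 : Type := weightedSubmodule

namespace WeightedEll2

instance : AddCommGroup WeightedEll2 := inferInstanceAs (AddCommGroup weightedSubmodule)

instance : Module ℂ WeightedEll2 := inferInstanceAs (Module ℂ weightedSubmodule)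

/-- The underlying sequence. -/
def val : WeightedEll2 →ₗ[ℂ] (ℕ → ℂ) := weightedSubmodule.subtype

instance : CoeFun WeightedEll2 fun _ => ℕ → ℂ := ⟨val⟩

/-- The element of `ℓ²(ℕ, 1/(1 + n²))` given by a sequence. -/
def mk (ξ : ℕ → ℂ) (h : Summable fun n : ℕ => ‖ξ n‖ ^ 2 * (1 / (1 + (n : ℝ) ^ 2))) :
    WeightedEll2 :=
  (⟨ξ, h⟩ : weightedSubmodule)

lemma mk_apply (ξ : ℕ → ℂ) (h) (n : ℕ) : mk ξ h n = ξ n := rfl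

@[ext] lemma ext {ξ η : WeightedEll2} (h : ∀ n, ξ n = η n) : ξ = η := Subtype.ext (funext h)

/-- The factor `√(1 + n²)`. -/
def root (n : ℕ) : ℝ := √(1 + (n : ℝ) ^ 2)

lemma root_pos (n : ℕ) : 0 < root n := Real.sqrt_pos.2 (by positivity)

lemma root_ne (n : ℕ) : (root n : ℂ) ≠ 0 := by exact_mod_cast (root_pos n).ne'

lemma root_sq (n : ℕ) : root n ^ 2 = 1 + (n : ℝ) ^ 2 := Real.sq_sqrt (by positivity)

lemma term_eq (z : ℂ) (n : ℕ) : ‖z / (root n : ℂ)‖ ^ 2 = ‖z‖ ^ 2 * (1 / (1 + (n : ℝ) ^ 2)) := by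
  rw [norm_div, div_pow, Complex.norm_real, Real.norm_of_nonneg (root_pos n).le, root_sq,
    mul_one_div]

/-- The identification `ξ ↦ ξ / √(1 + n²)` with `ℓ²(ℕ)`. -/
def toEll2 : WeightedEll2 ≃ₗ[ℂ] Ell2 where
  toFun ξ := ⟨fun n => ξ n / (root n : ℂ), memℓp_gen (by
    refine (Subtype.property (p := (· ∈ weightedSubmodule)) ξ : Summable _).congr fun n => ?_
    change ‖val ξ n‖ ^ 2 * (1 / (1 + (n : ℝ) ^ 2)) = _
    rw [← term_eq (ξ n) n]
    simp)⟩
  map_add' ξ η := by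
    ext n
    exact add_div (ξ n) (η n) _
  map_smul' c ξ := by
    ext n
    exact mul_div_assoc c (ξ n) _
  invFun x := mk (fun n => x n * (root n : ℂ)) (by
    have h := (memℓp_gen_iff (by norm_num)).1 (lp.memℓp x)
    refine h.congr fun n => ?_
    rw [← term_eq, mul_div_cancel_right₀ _ (root_ne n)]
    simp)
  left_inv ξ := by
    ext n
    exact div_mul_cancel₀ (ξ n) (root_ne n)
  right_inv x := by
    ext n
    exact mul_div_cancel_right₀ (x n) (root_ne n)

instance : NormedAddCommGroup WeightedEll2 :=
  NormedAddCommGroup.induced WeightedEll2 Ell2 toEll2 toEll2.injective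

lemma norm_eq (ξ : WeightedEll2) : ‖ξ‖ = ‖toEll2 ξ‖ := rfl

/-- The norm is `‖ξ‖² = ∑ |ξ n|² / (1 + n²)`. -/
lemma norm_sq_eq (ξ : WeightedEll2) : ‖ξ‖ ^ 2 = ∑' n : ℕ, ‖ξ n‖ ^ 2 * (1 / (1 + (n : ℝ) ^ 2)) := by
  have h := lp.norm_rpow_eq_tsum (p := 2) (by norm_num) (toEll2 ξ)
  rw [norm_eq]
  refine Eq.trans (by simp) (h.trans (tsum_congr fun n => ?_))
  rw [← term_eq]
  simp [toEll2]

instance : NormedSpace ℂ WeightedEll2 where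
  norm_smul_le c ξ := by rw [norm_eq, map_smul, norm_smul, norm_eq]

/-- `toEll2` as an isometry. -/
def toEll2Isometry : WeightedEll2 ≃ₗᵢ[ℂ] Ell2 := ⟨toEll2, fun _ => rfl⟩

instance : CompleteSpace WeightedEll2 :=
  (completeSpace_congr (e := toEll2Isometry.toEquiv)
    toEll2Isometry.isometry.isUniformEmbedding).2 inferInstance

lemma norm_apply_le (ξ : WeightedEll2) (n : ℕ) : ‖ξ n‖ ≤ (1 + n) * ‖ξ‖ := by
  have h1 : ‖ξ n / (root n : ℂ)‖ ≤ ‖ξ‖ := lp.norm_apply_le_norm two_ne_zero (toEll2 ξ) n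
  rw [norm_div, Complex.norm_real, Real.norm_of_nonneg (root_pos n).le,
    div_le_iff₀ (root_pos n)] at h1
  have h2 : root n ≤ 1 + n := Real.sqrt_le_iff.2 ⟨by positivity, by nlinarith [n.cast_nonneg (α := ℝ)]⟩
  calc _ ≤ ‖ξ‖ * root n := h1
    _ ≤ ‖ξ‖ * (1 + n) := mul_le_mul_of_nonneg_left h2 (norm_nonneg _)
    _ = _ := mul_comm _ _

/-- The coordinates of `ℓ²(ℕ, 1/(1 + n²))`. -/
def coord : CoordSystem WeightedEll2 where
  e n := mk (Pi.single n 1) (summable_of_ne_finset_zero (s := {n}) (fun m hm => by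
    rw [Finset.mem_singleton] at hm
    simp [Pi.single_eq_of_ne hm]))
  f n := LinearMap.mkContinuous
    { toFun := fun ξ => ξ n, map_add' := fun _ _ => rfl, map_smul' := fun _ _ => rfl } (1 + n)
    (fun ξ => norm_apply_le ξ n)
  norm_e n := by
    rw [← abs_of_nonneg (norm_nonneg _), ← sq_le_one_iff_abs_le_one, norm_sq_eq,
      tsum_eq_single n (fun m hm => by simp [mk_apply, Pi.single_eq_of_ne hm])]
    rw [mk_apply, Pi.single_eq_same, norm_one, one_pow, one_mul]
    exact (div_le_one (by positivity)).2 (by nlinarith [sq_nonneg (n : ℝ)])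
  norm_f n := LinearMap.mkContinuous_norm_le _ (by positivity) _
  biorth n m := by
    change (Pi.single m 1 : ℕ → ℂ) n = _
    rw [Pi.single_apply]

/-- The module `ℓ²(ℕ, 1/(1 + n²))` over the unitization of `K^∞`: matrices act by
`(a ξ)(n) = ∑ₘ a n m ξ m`, and the adjoined unit acts as the identity. -/
def rep : Unitization ℂ KInf →ₐ[ℂ] Module.End ℂ WeightedEll2 :=
  (opToEnd WeightedEll2).comp (Unitization.lift coord.toOp)

lemma rep_apply (c : ℂ) (a : KInf) (ξ : WeightedEll2) (n : ℕ) :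
    rep (Unitization.inl c + Unitization.inr a) ξ n = c * ξ n + ∑' m, a n m * ξ m := by
  have h := coord.f_toOp a ξ n
  change _ = ∑' m, a n m * ξ m at h
  rw [← h, map_add]
  have h1 : rep (Unitization.inl c) = algebraMap ℂ _ c := AlgHomClass.commutes rep c
  have h2 : rep (Unitization.inr a) = opToEnd _ (coord.toOp a) := by
    simp [rep]
  rw [h1, h2]
  rfl

/-- The constant sequence `1`. -/
def one : WeightedEll2 := mk (fun _ => 1) (by
  refine Summable.of_nonneg_of_le (fun n => by positivity) (fun n => ?_)
    ((summable_nat_add_iff 1).2 (Real.summable_one_div_nat_pow.2 one_lt_two) |>.mul_left 2)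
  rw [norm_one, one_pow, one_mul, ← div_eq_mul_one_div, div_le_div_iff₀ (by positivity)
    (by positivity)]
  push_cast
  nlinarith [sq_nonneg ((n : ℝ) - 1)])

end WeightedEll2

end Compact

end

universe u

/-! Non-containment rests on one estimate. Both algebras contain elements `u_m` that act on the
module as matrix units `ξ ↦ ξ(m) δ`, with `δ` a fixed basis vector, and the finite sums of `u_m^*
u_m` are projections in the C⋆-algebra. If `T` embeds `Aξ` into a `*`-representation `π`, then
`π(u_m) Tξ = ξ(m) Tδ`. Hence `∑ |ξ(m)|² ‖Tδ‖² = ⟨Tξ, π(∑ u_m^* u_m) Tξ⟩ ≤ ‖Tξ‖²` over every finite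
set, and `Tδ ≠ 0` forces `ξ ∈ ℓ²`. This is `memℓp_two_of_starRep`, transported to cyclic modules by
`memℓp_two_of_isContainedIn_cyclic`. The matrix units also make the modules irreducible: a nonzero
closed submodule contains every basis vector (`Submodule.eq_bot_or_eq_top_of_coord`).

For GCR, each C⋆-algebra has a projection `p` with `pBp = ℂp`. If an irreducible `π` does not kill
`p`, then `π(p)` has rank one, products `π(b) π(p) π(c)^*` give rank one operators on a dense set of
vectors, and the closed range of `π` contains all compact operators. If `π(p) = 0`, then `π` kills
the ideal generated by `p`; the image is commutative, Schur's lemma makes it scalar, and the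
previous argument applies with `p = 1`. CCR fails because the representation on `ℓ²` is irreducible
and unital while the identity of an infinite-dimensional space is not compact.

Spectral invariance means that an inverse found in `B` already lies in `A`. For rapidly decreasing
matrices, the inverse `d + b` of `c + K` satisfies `b = -d²K + d³K² + d²KbK`, and `KbK` is again
rapidly decreasing (`exists_kInf_eq_mul_mul`). For the crossed product, conjugation by the phases
`exp(itz)` multiplies the matrix entry `(z, w)` by `exp(it(z - w))`. Elements of the Schwartz
algebra have smooth orbits, inversion preserves smoothness, and the derivatives at `0` bound `|z -
w|^k` times the entries of the inverse (`exists_entry_bound_of_contDiff`). The diagonals of the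
inverse extend continuously to `M` (`exists_diagonal`), so they define an element of the Schwartz
algebra. -/

noncomputable section

open scoped InnerProductSpace BoundedContinuousFunction

/-! ## Compact operators and irreducible representations -/

section OperatorTheory

variable {H : Type*} [NormedAddCommGroup H] [InnerProductSpace ℂ H] [CompleteSpace H]

open InnerProductSpace in
/-- A closed space of operators containing the rank one operators built from a total set contains
every compact operator. -/
theorem IsCompactOperator.mem_of_rankOne_mem (S : Submodule ℂ (H →L[ℂ] H))
    (hS : IsClosed (S : Set (H →L[ℂ] H))) (D : Set H)
    (hD : Dense (Submodule.span ℂ D : Set H))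
    (h : ∀ x ∈ D, ∀ y ∈ D, rankOne ℂ x y ∈ S) {T : H →L[ℂ] H} (hT : IsCompactOperator T) :
    T ∈ S := by
  have h1 : ∀ y ∈ D, ∀ x, rankOne ℂ x y ∈ S := fun y hy x => by
    have hc : IsClosed {x : H | rankOne ℂ x y ∈ S} :=
      hS.preimage (by fun_prop : Continuous fun x : H => rankOne ℂ x y)
    refine closure_minimal (fun z hz => ?_) hc (hD x)
    induction hz using Submodule.span_induction with
    | mem x hx => exact h x hx y hy
    | zero => simp
    | add a b _ _ ha hb => simpa using S.add_mem ha hb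
    | smul c a _ ha => simpa using S.smul_mem c ha
  -- The second argument enters conjugate-linearly, which accounts for the conjugated scalar in the
  -- last case.
  have h2 : ∀ x y, rankOne ℂ x y ∈ S := fun x y => by
    have hc : IsClosed {y : H | rankOne ℂ x y ∈ S} :=
      hS.preimage (by fun_prop : Continuous fun y : H => rankOne ℂ x y)
    refine closure_minimal (fun z hz => ?_) hc (hD y)
    induction hz using Submodule.span_induction with
    | mem y hy => exact h1 y hy x
    | zero => simp
    | add a b _ _ ha hb => simpa using S.add_mem ha hb
    | smul c a _ ha => simpa using S.smul_mem (starRingEnd ℂ c) ha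
  have hcpt := (isCompactOperator_iff_isCompact_closure_image_closedBall T.toLinearMap one_pos).1 hT
  refine hS.closure_subset_iff.2 subset_rfl (Metric.mem_closure_iff.2 fun ε hε => ?_)
  obtain ⟨t, htf, hsub⟩ := Metric.totallyBounded_iff.1
    (hcpt.totallyBounded.subset subset_closure) (ε / 2) (half_pos hε)
  -- The span of a finite `ε/2`-net of the image of the unit ball. For `y` in the net, `(1 - P_V) T
  -- x = (1 - P_V)(T x - y)`, so the finite rank operator `P_V T` is within `ε/2` of `T`.
  let V := Submodule.span ℂ t
  have : FiniteDimensional ℂ V := FiniteDimensional.span_of_finite ℂ htf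
  have hVS : V.starProjection * T ∈ S := by
    rw [(stdOrthonormalBasis ℂ V).starProjection_eq_sum_rankOne, Finset.sum_mul]
    refine S.sum_mem fun i _ => ?_
    rw [ContinuousLinearMap.mul_def, rankOne_comp]
    exact h2 _ _
  refine ⟨_, hVS, ?_⟩
  rw [dist_eq_norm]
  refine lt_of_le_of_lt (ContinuousLinearMap.opNorm_le_of_unit_norm (half_pos hε).le
    fun x hx => ?_) (half_lt_self hε)
  obtain ⟨y, hy, hxy⟩ := Set.mem_iUnion₂.1 (hsub ⟨x, by simp [hx], rfl⟩)
  have hP : V.starProjection y = y :=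
    Submodule.starProjection_eq_self_iff.2 (Submodule.subset_span hy)
  have hx' : (T - V.starProjection * T) x = Vᗮ.starProjection (T x - y) := by
    rw [Submodule.starProjection_orthogonal, sub_apply,
      sub_apply, map_sub V.starProjection, hP]
    simp
  rw [hx']
  refine (Vᗮ.starProjection.le_of_opNorm_le Vᗮ.starProjection_norm_le _).trans ?_
  rw [one_mul, ← dist_eq_norm]
  exact (Metric.mem_ball.1 hxy).le

/-- Homomorphisms of C⋆-algebras have closed range. -/
theorem NonUnitalStarAlgHom.isClosed_range_of_cstar {A B : Type*} [NonUnitalCStarAlgebra A]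
    [NonUnitalCStarAlgebra B] (π : A →⋆ₙₐ[ℂ] B) : IsClosed (Set.range π) := by
  -- Truncating `a` to `[-‖π a‖, ‖π a‖]` by functional calculus bounds its norm. The image is
  -- unchanged because the truncation is the identity on the quasispectrum of `π a`.
  have hsa : ∀ a : A, IsSelfAdjoint a → ∃ b, π b = π a ∧ ‖b‖ ≤ ‖π a‖ := fun a ha => by
    let f : ℝ → ℝ := fun t => max (-‖π a‖) (min t ‖π a‖)
    have hf : Continuous f := by fun_prop
    have hf0 : f 0 = 0 := by simp [f]
    have hπ : IsSelfAdjoint (π a) := ha.map π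
    refine ⟨cfcₙ f a, ?_, ?_⟩
    · rw [NonUnitalStarAlgHom.map_cfcₙ (R := ℝ) (S := ℂ) π f a hf.continuousOn hf0
        (AddMonoidHomClass.continuous_of_bound π 1 fun a => by
          simpa using NonUnitalStarAlgHom.norm_apply_le π a) ha hπ]
      conv_rhs => rw [← cfcₙ_id ℝ (π a) hπ]
      refine cfcₙ_congr fun t ht => ?_
      have : |t| ≤ ‖π a‖ := by
        simpa using NonUnitalIsometricContinuousFunctionalCalculus.norm_quasispectrum_le (𝕜 := ℝ) (π a) ht hπ
      rw [abs_le] at this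
      simp [f, this]
    · refine norm_cfcₙ_le fun t _ => ?_
      rw [Real.norm_eq_abs, abs_le]
      exact ⟨le_max_left _ _, max_le (by linarith [norm_nonneg (π a)]) (min_le_right _ _)⟩
  have hb : ∀ a : A, ∃ b, π b = π a ∧ ‖b‖ ≤ 2 * ‖π a‖ := fun a => by
    obtain ⟨b, hb, hb'⟩ := hsa (realPart a) (realPart a).2
    obtain ⟨c, hc, hc'⟩ := hsa (imaginaryPart a) (imaginaryPart a).2
    refine ⟨b + Complex.I • c, ?_, ?_⟩
    · rw [map_add, map_smul, hb, hc, ← map_smul, ← map_add, realPart_add_I_smul_imaginaryPart]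
    · have h1 : ‖π (realPart a : A)‖ ≤ ‖π a‖ := by
        rw [map_realPart]; exact realPart.norm_le (π a)
      have h2 : ‖π (imaginaryPart a : A)‖ ≤ ‖π a‖ := by
        rw [map_imaginaryPart]; exact imaginaryPart.norm_le (π a)
      refine (norm_add_le _ _).trans ?_
      rw [norm_smul, Complex.norm_I]
      linarith
  let f : NormedAddGroupHom A B := ⟨π, map_add π, 1, fun a => by
    simpa using NonUnitalStarAlgHom.norm_apply_le π a⟩
  -- Norm-controlled preimages on the range extend to its closure by summing a convergent series in
  -- the complete space `A`. The constant `2` comes from lifting real and imaginary parts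
  -- separately.
  have h := controlled_closure_of_complete (f := f) (K := f.range) (C := 2) two_pos one_pos
    (by rintro _ ⟨a, rfl⟩; exact hb a)
  refine isClosed_of_closure_subset fun y hy => ?_
  obtain ⟨a, ha, -⟩ := h y hy
  exact ⟨a, ha⟩

/-- A self-adjoint operator commuting with an irreducible representation is scalar. -/
theorem IsIrreducibleStarRep.exists_eq_smul_one_of_isSelfAdjoint {B : Type*}
    [NonUnitalCStarAlgebra B] {π : B →⋆ₙₐ[ℂ] (H →L[ℂ] H)} (hπ : IsIrreducibleStarRep π)
    {T : H →L[ℂ] H} (hT : IsSelfAdjoint T) (hc : ∀ b, Commute T (π b)) :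
    ∃ c : ℂ, T = c • (1 : H →L[ℂ] H) := by
  rcases (spectrum ℝ T).subsingleton_or_nontrivial with hs | ⟨s, hs, t, ht, hst⟩
  · obtain ⟨c, hc⟩ : ∃ c, ∀ x ∈ spectrum ℝ T, x = c := by
      rcases hs.eq_empty_or_singleton with h0 | ⟨c, hc⟩
      · exact ⟨0, by simp [h0]⟩
      · exact ⟨c, by simp [hc]⟩
    refine ⟨c, ?_⟩
    conv_lhs => rw [← cfc_id ℝ T hT]
    rw [cfc_congr (f := id) (g := fun _ => c) hc, cfc_const c T hT, Algebra.algebraMap_eq_smul_one]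
    rfl
  wlog h : s < t generalizing s t
  · exact this t ht s hs hst.symm (lt_of_le_of_ne (not_lt.1 h) hst.symm)
  -- Two points of the spectrum give functions `f, g` with `fg = 0` and both `f(T)`, `g(T)` nonzero.
  -- The kernel of `f(T)` is closed and invariant, contains the range of `g(T)`, and is not
  -- everything, which contradicts irreducibility.
  let m := (s + t) / 2
  let f : ℝ → ℝ := fun x => max (x - m) 0
  let g : ℝ → ℝ := fun x => max (m - x) 0
  have hf : Continuous f := by fun_prop
  have hg : Continuous g := by fun_prop
  have hfg : cfc f T * cfc g T = 0 := by
    rw [← cfc_mul f g T, ← cfc_zero ℝ T]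
    congr 1
    ext x
    rcases le_total x m with hx | hx <;> simp [f, g, hx]
  have hne : ∀ (k : ℝ → ℝ) (x : ℝ), Continuous k → x ∈ spectrum ℝ T → k x ≠ 0 → cfc k T ≠ 0 :=
    fun k x hk hx hkx h0 => by
      rw [← cfc_zero ℝ T] at h0
      exact hkx (eqOn_of_cfc_eq_cfc h0 hk.continuousOn continuousOn_const hT hx)
  have hfT := hne f t hf ht (by simp only [f, m]; exact (lt_max_of_lt_left (by linarith)).ne')
  have hgT := hne g s hg hs (by simp only [g, m]; exact (lt_max_of_lt_left (by linarith)).ne')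
  rcases hπ.2 (cfc f T).ker (ContinuousLinearMap.isClosed_ker _) (fun b x hx => by
    have h1 : Commute (cfc f T) (π b) := (hc b).cfc_real f
    have h2 : cfc f T (π b x) = π b (cfc f T x) := DFunLike.congr_fun h1.eq x
    rw [LinearMap.mem_ker] at hx ⊢
    exact h2.trans (by erw [hx]; exact map_zero _)) with h1 | h1
  · refine (hgT (ContinuousLinearMap.ext fun x => ?_)).elim
    have : cfc g T x ∈ (cfc f T).ker := DFunLike.congr_fun hfg x
    rw [h1] at this
    exact this
  · refine (hfT (ContinuousLinearMap.ext fun x => ?_)).elim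
    have : x ∈ (cfc f T).ker := h1 ▸ Submodule.mem_top
    exact this

/-- Schur's lemma: an irreducible representation with commutative image is by scalars. -/
theorem IsIrreducibleStarRep.exists_eq_smul_one_of_commute {B : Type*}
    [NonUnitalCStarAlgebra B] {π : B →⋆ₙₐ[ℂ] (H →L[ℂ] H)} (hπ : IsIrreducibleStarRep π)
    (hc : ∀ a b, Commute (π a) (π b)) (b : B) : ∃ c : ℂ, π b = c • (1 : H →L[ℂ] H) := by
  obtain ⟨c, h1⟩ := hπ.exists_eq_smul_one_of_isSelfAdjoint ((realPart b).2.map π) (hc _)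
  obtain ⟨d, h2⟩ := hπ.exists_eq_smul_one_of_isSelfAdjoint ((imaginaryPart b).2.map π) (hc _)
  refine ⟨c + Complex.I * d, ?_⟩
  conv_lhs => rw [← realPart_add_I_smul_imaginaryPart b, map_add, map_smul, h1, h2]
  rw [add_smul, mul_smul]

open InnerProductSpace in
/-- If `p` is a projection whose corner in an irreducible representation is nonzero and
one-dimensional, then the image of the representation contains the compact operators. -/
theorem IsIrreducibleStarRep.exists_eq_of_isCompactOperator {B : Type*}
    [NonUnitalCStarAlgebra B] {π : B →⋆ₙₐ[ℂ] (H →L[ℂ] H)} (hπ : IsIrreducibleStarRep π)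
    {p : B} (hp : IsStarProjection p) (hp0 : π p ≠ 0)
    (hcorner : ∀ b, ∃ c : ℂ, π (p * b * p) = c • π p) {T : H →L[ℂ] H}
    (hT : IsCompactOperator T) : ∃ b, π b = T := by
  obtain ⟨x, hx0, hpx⟩ : ∃ x : H, x ≠ 0 ∧ π p x = x := by
    obtain ⟨y, hy⟩ := not_forall.1 fun h => hp0 (ContinuousLinearMap.ext h)
    refine ⟨π p y, hy, ?_⟩
    change (π p * π p) y = _
    rw [← map_mul, hp.isIdempotentElem.eq]
  -- The orbit `π(B) x` contains `x = π(p) x`, so irreducibility makes it dense.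
  let W : Submodule ℂ H := LinearMap.range
    ({ toFun := fun b => π b x, map_add' := by simp, map_smul' := by simp } : B →ₗ[ℂ] H)
  have hW : W.topologicalClosure = ⊤ := by
    refine (hπ.2 _ W.isClosed_topologicalClosure fun b y hy => ?_).resolve_left fun h => hx0 ?_
    · refine map_mem_closure (π b).continuous hy ?_
      rintro _ ⟨c, rfl⟩
      exact ⟨b * c, by simp⟩
    · have : x ∈ W.topologicalClosure := W.le_topologicalClosure ⟨p, hpx⟩
      rwa [h] at this
  have hW' : Dense (W : Set H) := W.dense_iff_topologicalClosure_eq_top.2 hW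
  have hsa : ∀ y z : H, ⟪π p y, z⟫_ℂ = ⟪y, π p z⟫_ℂ := fun y z => by
    have : star (π p) = π p := by rw [← map_star, hp.isSelfAdjoint.star_eq]
    conv_lhs => rw [← this, ContinuousLinearMap.star_eq_adjoint,
      ContinuousLinearMap.adjoint_inner_left]
  -- On the dense orbit, `π(p) π(b) x = π(pbp) x = c x`, and pairing with `x = π(p) x` gives `⟨x,
  -- π(b) x⟩ = c ‖x‖²`.
  have hxx : rankOne ℂ x x = π (((‖x‖ : ℂ) ^ 2) • p) := by
    refine ContinuousLinearMap.ext fun y => ?_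
    refine congrFun (Continuous.ext_on hW' (rankOne ℂ x x).continuous (map_continuous _) ?_) y
    rintro _ ⟨b, rfl⟩
    obtain ⟨c, hc⟩ := hcorner b
    have h1 : π p (π b x) = c • x := by
      have := DFunLike.congr_fun hc x
      simpa [hpx] using this
    change ⟪x, π b x⟫_ℂ • x = π _ (π b x)
    have h2 : ⟪x, π b x⟫_ℂ = c * ‖x‖ ^ 2 := by
      conv_lhs => rw [← hpx, hsa, hpx, h1, inner_smul_right, inner_self_eq_norm_sq_to_K]
      rfl
    rw [h2, map_smul, smul_apply, h1, smul_smul, mul_comm]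
  refine hT.mem_of_rankOne_mem (LinearMap.range (π : B →ₗ[ℂ] H →L[ℂ] H))
    π.isClosed_range_of_cstar W (by rwa [Submodule.span_eq]) ?_
  rintro _ ⟨b, rfl⟩ _ ⟨c, rfl⟩
  refine ⟨b * (((‖x‖ : ℂ) ^ 2) • p) * star c, ?_⟩
  change π _ = rankOne ℂ (π b x) (π c x)
  rw [map_mul, map_mul, ← hxx, map_star, ContinuousLinearMap.star_eq_adjoint,
    ContinuousLinearMap.mul_def, ContinuousLinearMap.mul_def, comp_rankOne, rankOne_comp,
    ContinuousLinearMap.adjoint_adjoint]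

/-- If the partial sums of `∑ a_i^* a_i` are bounded by `1`, then
vectors with `π(a_i) v = c_i w` and `w ≠ 0` have square summable coefficients `c`. -/
theorem memℓp_two_of_starRep {B ι : Type*} [NonUnitalCStarAlgebra B] (π : B →⋆ₙₐ[ℂ] (H →L[ℂ] H))
    (a : ι → B) (ha : ∀ s : Finset ι, ‖∑ i ∈ s, star (a i) * a i‖ ≤ 1) {v w : H} (hw : w ≠ 0)
    (c : ι → ℂ) (h : ∀ i, π (a i) v = c i • w) : Memℓp c 2 := by
  have hb : ∀ s : Finset ι, ∑ i ∈ s, ‖c i‖ ^ 2 ≤ ‖v‖ ^ 2 / ‖w‖ ^ 2 := fun s => by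
    rw [le_div_iff₀ (by positivity), Finset.sum_mul]
    have h1 : ∀ i, ‖c i‖ ^ 2 * ‖w‖ ^ 2 = RCLike.re ⟪v, π (star (a i) * a i) v⟫_ℂ := fun i => by
      rw [map_mul, map_star, mul_apply_eq_comp, ContinuousLinearMap.star_eq_adjoint,
        ContinuousLinearMap.adjoint_inner_right, inner_self_eq_norm_sq, h, norm_smul, mul_pow]
    calc ∑ i ∈ s, ‖c i‖ ^ 2 * ‖w‖ ^ 2 = RCLike.re ⟪v, π (∑ i ∈ s, star (a i) * a i) v⟫_ℂ := by
          rw [Finset.sum_congr rfl fun i _ => h1 i, map_sum, sum_apply,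
            inner_sum, map_sum]
      _ ≤ ‖v‖ * ‖π (∑ i ∈ s, star (a i) * a i) v‖ :=
          (RCLike.re_le_norm _).trans (norm_inner_le_norm _ _)
      _ ≤ ‖v‖ * (1 * ‖v‖) := by
          gcongr
          exact ContinuousLinearMap.le_of_opNorm_le _
            ((NonUnitalStarAlgHom.norm_apply_le π _).trans (ha s)) v
      _ = ‖v‖ ^ 2 := by ring
  refine memℓp_gen ?_
  simpa using summable_of_sum_le (fun i => by positivity) hb

/-- A module containing a vector `ξ` with `a_i ξ = c_i δ`, where the partial sums of `∑ a_i^* a_i`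
are bounded by `1`, can be contained in a `*`-representation only if `c` is square summable. -/
theorem IsContainedIn.memℓp_two {A₀ B F ι : Type*} [NonUnitalRing A₀] [Module ℂ A₀]
    [NonUnitalCStarAlgebra B] [AddCommGroup F] [Module ℂ F] [TopologicalSpace F]
    {σ : A₀ →ₙₐ[ℂ] Module.End ℂ F} {j : A₀ →ₙₐ[ℂ] B} {π : B →⋆ₙₐ[ℂ] (H →L[ℂ] H)}
    (hF : IsContainedIn σ j π) (a : ι → A₀)
    (ha : ∀ s : Finset ι, ‖∑ i ∈ s, star (j (a i)) * j (a i)‖ ≤ 1) {ξ δ : F} (hδ : δ ≠ 0)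
    (c : ι → ℂ) (h : ∀ i, σ (a i) ξ = c i • δ) : Memℓp c 2 := by
  obtain ⟨T, hinj, -, hT⟩ := hF
  exact memℓp_two_of_starRep π (fun i => j (a i)) ha (v := T ξ) (w := T δ)
    (fun h0 => hδ (hinj (h0.trans (map_zero T).symm))) c fun i => by rw [← hT, h, map_smul]

end OperatorTheory

/-! ## Fréchet topologies -/

section Frechet

/-- Completeness of a space of functions defined by weighted `ℓ¹`-seminorms. -/
theorem exists_limit_of_weighted_cauchy {ι κ E : Type*} [NormedAddCommGroup E] [CompleteSpace E]
    (w : κ → ι → ℝ) (hw : ∀ k x, 0 ≤ w k x) (k₀ : κ) (hpos : ∀ x, 0 < w k₀ x) (s : ℕ → ι → E)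
    (hs : ∀ i k, Summable fun x => w k x * ‖s i x‖)
    (hc : ∀ k, ∀ ε > 0, ∃ N, ∀ i ≥ N, ∀ j ≥ N, ∑' x, w k x * ‖s i x - s j x‖ < ε) :
    ∃ f : ι → E, (∀ k, Summable fun x => w k x * ‖f x‖) ∧
      ∀ k, ∀ ε > 0, ∃ N, ∀ i ≥ N, ∑' x, w k x * ‖s i x - f x‖ < ε := by
  have hsub : ∀ i j k, Summable fun x => w k x * ‖s i x - s j x‖ := fun i j k =>
    Summable.of_nonneg_of_le (fun x => mul_nonneg (hw _ _) (norm_nonneg _))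
      (fun x => (mul_le_mul_of_nonneg_left (norm_sub_le _ _) (hw k x)).trans_eq (mul_add _ _ _))
      ((hs i k).add (hs j k))
  have hlim : ∀ x, ∃ y, Filter.Tendsto (fun i => s i x) Filter.atTop (nhds y) := fun x => by
    refine cauchySeq_tendsto_of_complete (Metric.cauchySeq_iff.2 fun ε hε => ?_)
    obtain ⟨N, hN⟩ := hc k₀ (w k₀ x * ε) (mul_pos (hpos x) hε)
    refine ⟨N, fun i hi j hj => ?_⟩
    rw [dist_eq_norm]
    refine lt_of_mul_lt_mul_left (lt_of_le_of_lt ?_ (hN i hi j hj)) (hpos x).le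
    exact (hsub i j k₀).le_tsum x fun _ _ => mul_nonneg (hw _ _) (norm_nonneg _)
  choose f hf using hlim
  -- A Fatou argument: on a finite set the pointwise limit in `j` passes through the Cauchy
  -- estimate, uniformly in the finite set.
  have hbound : ∀ k, ∀ ε > 0, ∃ N, ∀ i ≥ N, ∀ t : Finset ι,
      ∑ x ∈ t, w k x * ‖s i x - f x‖ ≤ ε := fun k ε hε => by
    obtain ⟨N, hN⟩ := hc k ε hε
    refine ⟨N, fun i hi t => ?_⟩
    have ht : Filter.Tendsto (fun j => ∑ x ∈ t, w k x * ‖s i x - s j x‖) Filter.atTop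
        (nhds (∑ x ∈ t, w k x * ‖s i x - f x‖)) :=
      tendsto_finsetSum _ fun x _ => ((tendsto_const_nhds.sub (hf x)).norm).const_mul _
    refine le_of_tendsto ht ((Filter.eventually_ge_atTop N).mono fun j hj => ?_)
    exact ((hsub i j k).sum_le_tsum t fun _ _ => mul_nonneg (hw _ _) (norm_nonneg _)).trans
      (hN i hi j hj).le
  have hsf : ∀ k i, (∀ t : Finset ι, ∑ x ∈ t, w k x * ‖s i x - f x‖ ≤ 1) →
      Summable fun x => w k x * ‖s i x - f x‖ := fun k i h =>
    summable_of_sum_le (fun x => mul_nonneg (hw _ _) (norm_nonneg _)) h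
  refine ⟨f, fun k => ?_, fun k ε hε => ?_⟩
  · obtain ⟨N, hN⟩ := hbound k 1 one_pos
    refine Summable.of_nonneg_of_le (fun x => mul_nonneg (hw _ _) (norm_nonneg _))
      (fun x => ?_) ((hsf k N (hN N le_rfl)).add (hs N k))
    rw [← mul_add]
    refine mul_le_mul_of_nonneg_left ?_ (hw k x)
    rw [norm_sub_rev]
    simpa using norm_add_le (f x - s N x) (s N x)
  · obtain ⟨N, hN⟩ := hbound k (ε / 2) (half_pos hε)
    refine ⟨N, fun i hi => lt_of_le_of_lt ?_ (half_lt_self hε)⟩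
    exact Real.tsum_le_of_sum_le (fun x => mul_nonneg (hw _ _) (norm_nonneg _)) (hN i hi)

/-! ### The algebra `S(ℤ, C(M))` -/

namespace SchwartzZ

lemma withSeminorms : WithSeminorms SchwartzZ.seminorm := ⟨rfl⟩

instance : IsTopologicalAddGroup SchwartzZ := withSeminorms.topologicalAddGroup

lemma seminorm_apply (k : ℕ) (F : SchwartzZ) : seminorm k F = ∑' n, wt n ^ k * ‖F n‖ := rfl

/-- The weight satisfies `wt n ≤ wt j * wt (n - j)` and each `alpha j` is isometric, so the change
of variables `(n, j) ↦ (j, n - j)` turns the bound into a product of two sums. -/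
lemma seminorm_mul_le (k : ℕ) (F G : SchwartzZ) :
    seminorm k (F * G) ≤ seminorm k F * seminorm k G := by
  have h := (Equiv.prodComm ℤ ℤ).summable_iff.2 (summable_prod F G k)
  have hFG := (F.summable k).mul_of_nonneg (G.summable k)
    (fun n => mul_nonneg (pow_nonneg (wt_pos n).le _) (norm_nonneg _))
    (fun n => mul_nonneg (pow_nonneg (wt_pos n).le _) (norm_nonneg _))
  let e : ℤ × ℤ ≃ ℤ × ℤ :=
    ⟨fun p => (p.2, p.1 - p.2), fun p => (p.1 + p.2, p.1), fun p => by simp, fun p => by simp⟩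
  calc seminorm k (F * G) ≤ ∑' n, ∑' j, wt n ^ k * (‖F j‖ * ‖G (n - j)‖) := by
        refine ((F * G).summable k).tsum_le_tsum (fun n => ?_) h.prod
        have h0 : Summable fun k => ‖F k‖ * ‖G (n - k)‖ := by
          simpa using ((Equiv.prodComm ℤ ℤ).summable_iff.2 (summable_prod F G 0)).prod_factor n
        rw [tsum_mul_left]
        refine mul_le_mul_of_nonneg_left ?_ (pow_nonneg (wt_pos _).le _)
        exact (norm_tsum_le_tsum_norm (summable_conv F G n)).trans
          ((summable_conv F G n).tsum_le_tsum (fun k => norm_term_le F G k n) h0)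
    _ = ∑' p : ℤ × ℤ, wt p.1 ^ k * (‖F p.2‖ * ‖G (p.1 - p.2)‖) := (h.tsum_prod).symm
    _ ≤ ∑' p : ℤ × ℤ, wt (e p).1 ^ k * ‖F (e p).1‖ * (wt (e p).2 ^ k * ‖G (e p).2‖) := by
        refine h.tsum_le_tsum (fun p => ?_) (e.summable_iff.2 hFG)
        have : wt p.1 ^ k ≤ wt p.2 ^ k * wt (p.1 - p.2) ^ k := by
          rw [← mul_pow]
          refine pow_le_pow_left₀ (wt_pos _).le ?_ _
          simpa using wt_add_le p.2 (p.1 - p.2)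
        calc _ ≤ (wt p.2 ^ k * wt (p.1 - p.2) ^ k) * (‖F p.2‖ * ‖G (p.1 - p.2)‖) :=
              mul_le_mul_of_nonneg_right this (by positivity)
          _ = _ := by simp only [e, Equiv.coe_fn_mk]; ring
    _ = ∑' p : ℤ × ℤ, wt p.1 ^ k * ‖F p.1‖ * (wt p.2 ^ k * ‖G p.2‖) :=
        e.tsum_eq fun p : ℤ × ℤ => wt p.1 ^ k * ‖F p.1‖ * (wt p.2 ^ k * ‖G p.2‖)
    _ = _ := by rw [hFG.tsum_prod]; simp_rw [tsum_mul_left, tsum_mul_right]; rfl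

theorem isMConvexFrechetAlgebra : IsMConvexFrechetAlgebra SchwartzZ := by
  refine ⟨seminorm, withSeminorms, fun k => ⟨1, one_pos, fun F G => ?_⟩, fun F h => ?_,
    fun s hs => ?_⟩
  · rw [one_mul]; exact seminorm_mul_le k F G
  · ext1 n
    have h1 := (F.summable_norm).le_tsum n fun _ _ => norm_nonneg _
    have h0 := h 0
    simp only [seminorm_apply, pow_zero, one_mul] at h0
    rw [h0] at h1
    exact norm_le_zero_iff.1 h1
  · obtain ⟨f, hf, hlim⟩ := exists_limit_of_weighted_cauchy (fun k n => wt n ^ k)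
      (fun k n => pow_nonneg (wt_pos n).le _) 0 (fun n => by simp) (fun i => s i)
      (fun i k => (s i).summable k) hs
    refine ⟨mk f hf, (withSeminorms.tendsto_nhds_atTop _ _).2 hlim⟩

end SchwartzZ

namespace CovariantPair

variable {D : Type*} [NormedRing D] [NormedAlgebra ℂ D] [CompleteSpace D] (P : CovariantPair D)

lemma norm_integrated_le (F : SchwartzZ) : ‖P.integrated F‖ ≤ SchwartzZ.seminorm 0 F := by
  refine (norm_tsum_le_tsum_norm (P.summable_term F)).trans ?_
  refine (P.summable_term F).tsum_le_tsum (fun n => ?_) (F.summable 0)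
  simpa using P.norm_term_le F n

lemma continuous_integrated : Continuous P.integrated := by
  refine continuous_of_tendsto_nhds_zero (P.integrated : SchwartzZ →+ D) ?_
  refine squeeze_zero_norm P.norm_integrated_le ?_
  simpa using (SchwartzZ.withSeminorms.continuous_seminorm 0).tendsto 0

lemma integrated_single (n : ℤ) (f : C(ZInfty, ℂ)) :
    P.integrated (SchwartzZ.single n f) = P.φ f * P.u (.ofAdd n) := by
  rw [integrated_apply, tsum_eq_single n (fun k hk => by
    rw [SchwartzZ.single_apply, Pi.single_eq_of_ne hk, map_zero, zero_mul]),
    SchwartzZ.single_apply, Pi.single_eq_same]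

end CovariantPair

/-! ### The algebra `K^∞` and its unitization -/

namespace KInf

lemma withSeminorms : WithSeminorms KInf.seminorm := ⟨rfl⟩

instance : IsTopologicalAddGroup KInf := withSeminorms.topologicalAddGroup

lemma seminorm_apply (x : ℕ × ℕ) (a : KInf) :
    seminorm x a = ∑' y : ℕ × ℕ, ‖a y.1 y.2‖ * (y.1 : ℝ) ^ x.1 * (y.2 : ℝ) ^ x.2 := rfl

/-- The summation index of a matrix product carries no weight, so the left factor only pays for its
row index and the right factor for its column index. The triples `(n, m, k)` embed into pairs of
matrix positions, which gives the product of sums as an upper bound. -/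
lemma seminorm_mul_le (p q : ℕ) (a b : KInf) :
    seminorm (p, q) (a * b) ≤ seminorm (p, 0) a * seminorm (0, q) b := by
  have h := summable_triple a b p q
  have hab := (a.summable p 0).mul_of_nonneg (b.summable 0 q)
    (fun _ => by positivity) (fun _ => by positivity)
  let j : (ℕ × ℕ) × ℕ → (ℕ × ℕ) × (ℕ × ℕ) := fun x => ((x.1.1, x.2), (x.2, x.1.2))
  have hinj : Function.Injective j := by
    rintro ⟨⟨a, b⟩, c⟩ ⟨⟨a', b'⟩, c'⟩ h
    simp only [j, Prod.mk.injEq] at h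
    obtain ⟨⟨rfl, rfl⟩, -, rfl⟩ := h
    rfl
  calc seminorm (p, q) (a * b)
      ≤ ∑' x : ℕ × ℕ, ∑' k, ‖a x.1 k * b k x.2‖ * (x.1 : ℝ) ^ p * (x.2 : ℝ) ^ q := by
        refine ((a * b).summable p q).tsum_le_tsum (fun x => ?_) h.prod
        rw [tsum_mul_right, tsum_mul_right]
        gcongr
        exact norm_tsum_le_tsum_norm (summable_conv a b x.1 x.2)
    _ = ∑' x : (ℕ × ℕ) × ℕ, ‖a x.1.1 x.2 * b x.2 x.1.2‖ * (x.1.1 : ℝ) ^ p * (x.1.2 : ℝ) ^ q :=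
        h.tsum_prod.symm
    _ ≤ ∑' y : (ℕ × ℕ) × (ℕ × ℕ), ‖a y.1.1 y.1.2‖ * (y.1.1 : ℝ) ^ p * (y.1.2 : ℝ) ^ 0 *
          (‖b y.2.1 y.2.2‖ * (y.2.1 : ℝ) ^ 0 * (y.2.2 : ℝ) ^ q) := by
        refine h.tsum_le_tsum_of_inj j hinj (fun _ _ => by positivity) (fun x => le_of_eq ?_) hab
        simp only [j, pow_zero, mul_one, norm_mul]; ring
    _ = _ := by rw [hab.tsum_prod]; simp_rw [tsum_mul_left, tsum_mul_right]; rfl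

/-- The increasing family of seminorms `max_{i ≤ p, j ≤ q} ‖a‖_{i,j}`, enumerated. -/
def supSeminorm : SeminormFamily ℂ KInf ℕ := fun n => (Finset.Iic (Nat.unpair n)).sup seminorm

lemma withSeminorms_sup : WithSeminorms supSeminorm :=
  withSeminorms.partial_sups.congr_equiv Nat.pairEquiv.symm

lemma seminorm_le_supSeminorm {x : ℕ × ℕ} {n : ℕ} (h : x ≤ Nat.unpair n) (a : KInf) :
    seminorm x a ≤ supSeminorm n a :=
  (Finset.le_sup (f := seminorm) (Finset.mem_Iic.2 h)) a

/-- The index set of the maximum is downward closed, so it contains the `(p, 0)` and `(0, q)`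
required by `seminorm_mul_le`. A single seminorm can fail: indices start at `0`, where positive
powers vanish, so `‖·‖_{1,1}` is zero on the matrix units `E₁₀` and `E₀₁` but not on their product
`E₁₁`. -/
lemma supSeminorm_mul_le (n : ℕ) (a b : KInf) :
    supSeminorm n (a * b) ≤ supSeminorm n a * supSeminorm n b := by
  refine Seminorm.finset_sup_apply_le (by positivity) fun x hx => ?_
  rw [Finset.mem_Iic] at hx
  refine (seminorm_mul_le x.1 x.2 a b).trans ?_
  refine mul_le_mul (seminorm_le_supSeminorm ?_ a) (seminorm_le_supSeminorm ?_ b)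
    (apply_nonneg _ _) (apply_nonneg _ _)
  · exact ⟨hx.1, Nat.zero_le _⟩
  · exact ⟨Nat.zero_le _, hx.2⟩

lemma exists_tendsto (s : ℕ → KInf)
    (hs : ∀ n, ∀ ε > 0, ∃ N, ∀ i ≥ N, ∀ j ≥ N, supSeminorm n (s i - s j) < ε) :
    ∃ a, Filter.Tendsto s Filter.atTop (nhds a) := by
  obtain ⟨f, hf, hlim⟩ := exists_limit_of_weighted_cauchy
    (fun (k : ℕ × ℕ) (x : ℕ × ℕ) => (x.1 : ℝ) ^ k.1 * (x.2 : ℝ) ^ k.2)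
    (fun k x => by positivity) (0, 0) (fun n => by simp) (fun i x => s i x.1 x.2)
    (fun i k => ((s i).summable k.1 k.2).congr fun x => by ring) (fun k ε hε => by
      obtain ⟨N, hN⟩ := hs (Nat.pair k.1 k.2) ε hε
      refine ⟨N, fun i hi j hj => lt_of_le_of_lt (le_of_eq ?_)
        ((seminorm_le_supSeminorm (x := k) (by simp) _).trans_lt (hN i hi j hj))⟩
      rw [seminorm_apply]
      exact tsum_congr fun x => by rw [mul_comm, ← mul_assoc]; rfl)
  refine ⟨mk (fun n m => f (n, m)) fun p q => (hf (p, q)).congr fun x => by ring,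
    (withSeminorms.tendsto_nhds_atTop _ _).2 fun k ε hε => ?_⟩
  obtain ⟨N, hN⟩ := hlim k ε hε
  refine ⟨N, fun i hi => lt_of_le_of_lt (le_of_eq ?_) (hN i hi)⟩
  rw [seminorm_apply]
  exact tsum_congr fun x => by rw [mul_assoc, mul_comm]; rfl

/-- The seminorms `|c| + max_{i ≤ p, j ≤ q} ‖a‖_{i,j}` on the unitization. -/
def unitizedSeminorm : SeminormFamily ℂ (Unitization ℂ KInf) ℕ := fun n =>
  Seminorm.of (fun x => ‖x.fst‖ + supSeminorm n x.snd)
    (fun x y => by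
      have h1 := norm_add_le x.fst y.fst
      have h2 := map_add_le_add (supSeminorm n) x.snd y.snd
      rw [Unitization.fst_add, Unitization.snd_add]
      linarith)
    (fun c x => by
      rw [Unitization.fst_smul, Unitization.snd_smul, norm_smul, map_smul_eq_mul, mul_add])

lemma unitizedSeminorm_apply (n : ℕ) (x : Unitization ℂ KInf) :
    unitizedSeminorm n x = ‖x.fst‖ + supSeminorm n x.snd := rfl

lemma isInducing_unitization :
    Topology.IsInducing fun x : Unitization ℂ KInf => (x.fst, x.snd) := ⟨rfl⟩

lemma continuous_fst_unitization : Continuous fun x : Unitization ℂ KInf => x.fst :=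
  continuous_fst.comp isInducing_unitization.continuous

lemma continuous_snd_unitization : Continuous fun x : Unitization ℂ KInf => x.snd :=
  continuous_snd.comp isInducing_unitization.continuous

instance : IsTopologicalAddGroup (Unitization ℂ KInf) :=
  topologicalAddGroup_induced (Unitization.addEquiv ℂ KInf)

/-- Neighbourhoods of `0` are compared: each seminorm is continuous for the product topology, and
conversely it dominates both the scalar part and the matrix part. -/
lemma withSeminorms_unitized : WithSeminorms unitizedSeminorm := by
  rw [SeminormFamily.withSeminorms_iff_nhds_eq_iInf]
  have h0 := (SeminormFamily.withSeminorms_iff_nhds_eq_iInf _).1 withSeminorms_sup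
  refine le_antisymm (le_iInf fun n => ?_) ?_
  · rw [← Filter.tendsto_iff_comap]
    have : Continuous (unitizedSeminorm n) := continuous_fst_unitization.norm.add
      ((withSeminorms_sup.continuous_seminorm n).comp continuous_snd_unitization)
    simpa using this.tendsto 0
  · have hr : ∀ n, Filter.Tendsto (unitizedSeminorm n)
        (⨅ i, (nhds 0).comap (unitizedSeminorm i)) (nhds 0) := fun n =>
      Filter.tendsto_comap.mono_left (iInf_le _ n)
    rw [isInducing_unitization.nhds_eq_comap, ← Filter.tendsto_iff_comap]
    refine Filter.Tendsto.prodMk_nhds ?_ ?_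
    · refine squeeze_zero_norm (fun x => ?_) (hr 0)
      exact le_add_of_nonneg_right (apply_nonneg _ _)
    · change Filter.Tendsto _ _ (nhds 0)
      rw [h0]
      refine Filter.tendsto_iInf.2 fun n => Filter.tendsto_comap_iff.2 ?_
      refine squeeze_zero (fun x => apply_nonneg _ _) (fun x => ?_) (hr n)
      exact le_add_of_nonneg_left (norm_nonneg _)

theorem isMConvexFrechetAlgebra_unitization :
    IsMConvexFrechetAlgebra (Unitization ℂ KInf) := by
  refine ⟨unitizedSeminorm, withSeminorms_unitized, fun n => ⟨1, one_pos, fun x y => ?_⟩,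
    fun x h => ?_, fun s hs => ?_⟩
  · simp only [unitizedSeminorm_apply, Unitization.fst_mul, Unitization.snd_mul, one_mul]
    -- The four resulting terms are exactly the expansion of `(|c| + ‖a‖)(|d| + ‖b‖)`.
    have h1 := map_add_le_add (supSeminorm n) (x.fst • y.snd + y.fst • x.snd) (x.snd * y.snd)
    have h2 := map_add_le_add (supSeminorm n) (x.fst • y.snd) (y.fst • x.snd)
    have h3 := supSeminorm_mul_le n x.snd y.snd
    rw [map_smul_eq_mul, map_smul_eq_mul] at h2
    rw [norm_mul]
    linarith
  · have h1 : x.fst = 0 := norm_le_zero_iff.1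
      ((le_add_of_nonneg_right (apply_nonneg _ _)).trans (h 0).le)
    have h2 : x.snd = 0 := by
      have h3 : seminorm (0, 0) x.snd ≤ 0 := (seminorm_le_supSeminorm (n := 0)
        (by simp) _).trans ((le_add_of_nonneg_left (norm_nonneg _)).trans (h 0).le)
      simp only [seminorm_apply, pow_zero, mul_one] at h3
      ext n m
      exact norm_le_zero_iff.1
        (((x.snd.summable_norm).le_tsum (n, m) fun _ _ => norm_nonneg _).trans h3)
    exact Unitization.ext h1 h2
  · obtain ⟨c, hc⟩ : ∃ c, Filter.Tendsto (fun i => (s i).fst) Filter.atTop (nhds c) := by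
      refine cauchySeq_tendsto_of_complete (Metric.cauchySeq_iff.2 fun ε hε => ?_)
      obtain ⟨N, hN⟩ := hs 0 ε hε
      refine ⟨N, fun i hi j hj => lt_of_le_of_lt ?_ (hN i hi j hj)⟩
      rw [dist_eq_norm, unitizedSeminorm_apply]
      exact le_add_of_nonneg_right (a := ‖(s i).fst - (s j).fst‖) (apply_nonneg _ _)
    obtain ⟨a, ha⟩ := exists_tendsto (fun i => (s i).snd) fun n ε hε => by
      obtain ⟨N, hN⟩ := hs n ε hε
      refine ⟨N, fun i hi j hj => lt_of_le_of_lt ?_ (hN i hi j hj)⟩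
      rw [unitizedSeminorm_apply]
      exact le_add_of_nonneg_left (a := supSeminorm n ((s i).snd - (s j).snd)) (norm_nonneg _)
    refine ⟨(Unitization.addEquiv ℂ KInf).symm (c, a), isInducing_unitization.tendsto_nhds_iff.2 ?_⟩
    exact hc.prodMk_nhds ha

end KInf

/-- Matrix units have norm at most `1 + m`, hence the operator norm is at most `‖a‖_{0,0} +
‖a‖_{0,1}`; by additivity, continuity at `0` suffices. -/
lemma CoordSystem.continuous_toOp {X : Type*} [NormedAddCommGroup X] [NormedSpace ℂ X]
    [CompleteSpace X] (S : CoordSystem X) : Continuous S.toOp := by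
  refine continuous_of_tendsto_nhds_zero (S.toOp : KInf →+ (X →L[ℂ] X)) ?_
  refine squeeze_zero_norm (a := fun a => KInf.seminorm (0, 0) a + KInf.seminorm (0, 1) a)
    (fun a => ?_) ?_
  · refine (norm_tsum_le_tsum_norm (S.summable_term a)).trans ?_
    rw [KInf.seminorm_apply, KInf.seminorm_apply,
      ← (a.summable 0 0).tsum_add (a.summable 0 1)]
    refine (S.summable_term a).tsum_le_tsum (fun x => ?_) ((a.summable 0 0).add (a.summable 0 1))
    rw [norm_smul]
    calc _ ≤ ‖a x.1 x.2‖ * (1 + x.2) :=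
          mul_le_mul_of_nonneg_left (S.norm_unit_le _ _) (norm_nonneg _)
      _ = _ := by ring
  · simpa [Pi.add_def] using ((KInf.withSeminorms.continuous_seminorm (0, 0)).add
      (KInf.withSeminorms.continuous_seminorm (0, 1))).tendsto 0

end Frechet

/-! ## Spaces with coordinates, and cyclic modules -/

section Coordinates

/-- A closed subspace invariant under all matrix units of a total system with separating
coordinates is trivial. -/
theorem Submodule.eq_bot_or_eq_top_of_coord {ι X : Type*} [NormedAddCommGroup X] [NormedSpace ℂ X]
    (e : ι → X) (f : ι → X → ℂ) (hsep : ∀ x, (∀ m, f m x = 0) → x = 0)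
    (hdense : Dense (Submodule.span ℂ (Set.range e) : Set X)) (W : Submodule ℂ X)
    (hW : IsClosed (W : Set X)) (hinv : ∀ n m, ∀ x ∈ W, f m x • e n ∈ W) : W = ⊥ ∨ W = ⊤ := by
  refine or_iff_not_imp_left.2 fun hne => ?_
  obtain ⟨x, hx, hx0⟩ := W.exists_mem_ne_zero_of_ne_bot hne
  obtain ⟨m, hm⟩ := not_forall.1 (mt (hsep x) hx0)
  have he : Submodule.span ℂ (Set.range e) ≤ W := Submodule.span_le.2 (by
    rintro _ ⟨n, rfl⟩
    simpa [smul_smul, inv_mul_cancel₀ hm] using W.smul_mem (f m x)⁻¹ (hinv n m x hx))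
  refine eq_top_iff.2 fun y _ => ?_
  exact closure_minimal he hW (hdense y)

/-- The identity of a normed space with infinitely many linearly independent vectors is not
compact. -/
theorem not_isCompactOperator_one_of_linearIndependent {ι X : Type*} [Infinite ι]
    [NormedAddCommGroup X] [NormedSpace ℂ X] (e : ι → X) (he : LinearIndependent ℂ e) :
    ¬ IsCompactOperator (1 : X →L[ℂ] X) := fun h => by
  have : FiniteDimensional ℂ X := (isCompactOperator_id_iff_finiteDimensional (𝕜 := ℂ)).1 h
  have := he.finite_of_isNoetherian
  exact not_finite ι

lemma dense_span_lp_single {ι : Type*} [DecidableEq ι] :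
    Dense (Submodule.span ℂ (Set.range fun n : ι =>
      (lp.single 2 n (1 : ℂ) : lp (fun _ : ι => ℂ) 2)) : Set (lp (fun _ : ι => ℂ) 2)) := fun x => by
  refine mem_closure_of_tendsto (lp.hasSum_single (p := 2) (by norm_num) x)
    (Filter.Eventually.of_forall fun s => Submodule.sum_mem _ fun n _ => ?_)
  have : lp.single (E := fun _ : ι => ℂ) 2 n (x n) = x n • lp.single 2 n (1 : ℂ) := by
    rw [← lp.single_smul, smul_eq_mul, mul_one]
  rw [this]
  exact Submodule.smul_mem _ _ (Submodule.subset_span ⟨n, rfl⟩)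

lemma orthonormal_lp_single {ι : Type*} [DecidableEq ι] :
    Orthonormal ℂ fun n : ι => (lp.single 2 n (1 : ℂ) : lp (fun _ : ι => ℂ) 2) := by
  refine orthonormal_iff_ite.2 fun i j => ?_
  rw [lp.inner_single_left, lp.single_apply, Pi.single_apply]
  split_ifs <;> simp

lemma linearIndependent_lp_single {ι : Type*} [DecidableEq ι] :
    LinearIndependent ℂ fun n : ι => (lp.single 2 n (1 : ℂ) : lp (fun _ : ι => ℂ) 2) :=
  orthonormal_lp_single.linearIndependent

variable {A : Type*} [Ring A] [Algebra ℂ A] {E : Type*} [NormedAddCommGroup E] [NormedSpace ℂ E]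

lemma self_mem_cyclicSubmodule (ρ : A →ₐ[ℂ] Module.End ℂ E) (ξ : E) :
    ξ ∈ cyclicSubmodule ρ ξ := by
  simpa using mem_cyclicSubmodule ρ ξ 1

/-- If elements `u_m` move the cyclic vector `ξ` to `c_m δ` and the partial sums of `∑ u_m^* u_m`
are bounded by `1`, then containment of `A ξ` in a `*`-representation makes `c` square summable. -/
theorem memℓp_two_of_isContainedIn_cyclic {A₀ B ι H : Type*} [NonUnitalRing A₀] [Module ℂ A₀]
    [NonUnitalCStarAlgebra B] [TopologicalSpace A]
    [NormedAddCommGroup H] [InnerProductSpace ℂ H] [CompleteSpace H]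
    (ρ : A →ₐ[ℂ] Module.End ℂ E) (ξ : E) {σ : A₀ →ₙₐ[ℂ] Module.End ℂ (Cyclic ρ ξ)}
    {j : A₀ →ₙₐ[ℂ] B} {π : B →⋆ₙₐ[ℂ] (H →L[ℂ] H)} (hF : IsContainedIn σ j π) (u : ι → A₀)
    (hu : ∀ s : Finset ι, ‖∑ i ∈ s, star (j (u i)) * j (u i)‖ ≤ 1) {δ : E} (hδ : δ ≠ 0)
    (c : ι → ℂ) (h : ∀ i, Cyclic.val ρ ξ (σ (u i) (Cyclic.mk ρ ξ 1)) = c i • δ) :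
    Memℓp c 2 := by
  -- Some `c i ≠ 0` is needed to place `δ` inside the cyclic module, as `(c i)⁻¹ u_i ξ`; if all
  -- vanish, the conclusion is trivial.
  by_cases hc : ∀ i, c i = 0
  · rw [funext hc]; exact zero_memℓp
  obtain ⟨i, hi⟩ := not_forall.1 hc
  have hinj : Function.Injective (Cyclic.val ρ ξ) := Subtype.val_injective
  have hδ' : Cyclic.val ρ ξ ((c i)⁻¹ • σ (u i) (Cyclic.mk ρ ξ 1)) = δ := by
    rw [map_smul, h, smul_smul, inv_mul_cancel₀ hi, one_smul]
  refine hF.memℓp_two u hu (ξ := Cyclic.mk ρ ξ 1)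
    (δ := (c i)⁻¹ • σ (u i) (Cyclic.mk ρ ξ 1)) (fun h0 => hδ ?_) c fun k => hinj ?_
  · rw [← hδ', h0, map_zero]
  · rw [h, map_smul, hδ']

/-- If an irreducible representation of a unital C⋆-algebra has commutative image, then its image
contains the compact operators. -/
theorem IsIrreducibleStarRep.exists_eq_of_isCompactOperator_of_commute {B H : Type*}
    [CStarAlgebra B] [NormedAddCommGroup H] [InnerProductSpace ℂ H] [CompleteSpace H]
    {π : B →⋆ₙₐ[ℂ] (H →L[ℂ] H)} (hπ : IsIrreducibleStarRep π)
    (hc : ∀ a b, Commute (π a) (π b)) {T : H →L[ℂ] H} (hT : IsCompactOperator T) :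
    ∃ b, π b = T := by
  -- By Schur's lemma the corner at the unit is already scalar.
  refine hπ.exists_eq_of_isCompactOperator (p := 1) (.one B) (fun h => ?_) (fun b => ?_) hT
  · obtain ⟨b, hb⟩ := hπ.1
    exact hb (by rw [← mul_one b, map_mul, h, mul_zero])
  · obtain ⟨c, h⟩ := hπ.exists_eq_smul_one_of_commute hc b
    exact ⟨c, by rw [one_mul, mul_one, ← mul_one b, map_mul, h, smul_mul_assoc, one_mul]⟩

end Coordinates

/-! ## The compact operators -/

section CompactOperators

namespace KInf

/-- The matrix units. -/
def single (n m : ℕ) : KInf := mk (fun k l => if n = k ∧ m = l then 1 else 0) fun p q =>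
  summable_of_ne_finset_zero (s := {(n, m)}) fun x hx => by
    have : ¬ (n = x.1 ∧ m = x.2) := fun h => hx (by simp [h.1, h.2])
    simp [this]

lemma single_apply (n m k l : ℕ) : single n m k l = if n = k ∧ m = l then 1 else 0 := rfl

end KInf

lemma CoordSystem.toOp_single {X : Type*} [NormedAddCommGroup X] [NormedSpace ℂ X]
    [CompleteSpace X] (S : CoordSystem X) (n m : ℕ) : S.toOp (KInf.single n m) = S.unit n m := by
  rw [S.toOp_eq, tsum_eq_single (n, m)]
  · simp [KInf.single_apply]
  · intro x hx
    have : ¬ (n = x.1 ∧ m = x.2) := fun h => hx (Prod.ext h.1.symm h.2.symm)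
    simp [KInf.single_apply, this]

namespace CompactOps

/-- The inclusion into the bounded operators. -/
def toCLM : CompactOps →⋆ₙₐ[ℂ] (Ell2 →L[ℂ] Ell2) := NonUnitalStarSubalgebraClass.subtype compactSubalgebra

lemma toCLM_injective : Function.Injective toCLM := Subtype.val_injective

lemma isometry_toCLM : Isometry toCLM := fun _ _ => rfl

lemma isCompactOperator_toCLM (k : CompactOps) : IsCompactOperator (toCLM k) := k.2

/-- The matrix units in the compact operators. -/
def unit (n m : ℕ) : CompactOps := kInfInclusion (KInf.single n m)

lemma toCLM_unit (n m : ℕ) : toCLM (unit n m) = ell2Coord.unit n m :=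
  ell2Coord.toOp_single n m

lemma unit_mul (n m k l : ℕ) : unit n m * unit k l = if m = k then unit n l else 0 := by
  refine toCLM_injective ?_
  rw [map_mul, toCLM_unit, toCLM_unit, CoordSystem.unit_mul]
  split_ifs
  · rw [toCLM_unit]
  · rw [map_zero]

lemma ell2Coord_unit_eq_rankOne (n m : ℕ) :
    ell2Coord.unit n m = InnerProductSpace.rankOne ℂ (ell2Coord.e n) (ell2Coord.e m) := by
  ext x : 1
  rw [CoordSystem.unit_apply, InnerProductSpace.rankOne_apply]
  congr 1
  change x m = inner ℂ (lp.single 2 m (1 : ℂ)) x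
  rw [lp.inner_single_left]
  simp

lemma star_unit (n m : ℕ) : star (unit n m) = unit m n := by
  refine toCLM_injective ?_
  rw [map_star, toCLM_unit, toCLM_unit, ell2Coord_unit_eq_rankOne, ell2Coord_unit_eq_rankOne,
    ContinuousLinearMap.star_eq_adjoint, InnerProductSpace.adjoint_rankOne]

lemma star_unit_mul_unit (m : ℕ) : star (unit 0 m) * unit 0 m = unit m m := by
  rw [star_unit, unit_mul, if_pos rfl]

/-- The sum is the coordinate projection `∑ E_mm` onto the indices in `s`. -/
lemma norm_sum_le (s : Finset ℕ) : ‖∑ m ∈ s, star (unit 0 m) * unit 0 m‖ ≤ 1 := by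
  refine IsStarProjection.norm_le _ ⟨?_, ?_⟩
  · simp only [star_unit_mul_unit]
    rw [IsIdempotentElem, Finset.sum_mul_sum]
    simp [unit_mul]
  · rw [IsSelfAdjoint, star_sum]
    simp

/-- Closed subspaces containing the matrix units contain everything. -/
lemma mem_of_unit_mem (W : Submodule ℂ CompactOps) (hW : IsClosed (W : Set CompactOps))
    (h : ∀ n m, unit n m ∈ W) (k : CompactOps) : k ∈ W := by
  have hcl : Topology.IsClosedEmbedding toCLM := isometry_toCLM.isClosedEmbedding
  obtain ⟨k', hk', hkk⟩ := (isCompactOperator_toCLM k).mem_of_rankOne_mem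
    (W.map (toCLM : CompactOps →ₗ[ℂ] Ell2 →L[ℂ] Ell2)) (hcl.isClosedMap _ hW)
    (Set.range ell2Coord.e) dense_span_lp_single (by
      rintro _ ⟨n, rfl⟩ _ ⟨m, rfl⟩
      exact ⟨unit n m, h n m, by rw [← ell2Coord_unit_eq_rankOne]; exact toCLM_unit n m⟩)
  rwa [← toCLM_injective hkk]

lemma denseRange_kInfInclusion : DenseRange kInfInclusion := fun k =>
  mem_of_unit_mem (LinearMap.range (kInfInclusion : KInf →ₗ[ℂ] CompactOps)).topologicalClosure
    (Submodule.isClosed_topologicalClosure _)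
    (fun n m => Submodule.le_topologicalClosure _ ⟨KInf.single n m, rfl⟩) k

lemma toCLM_kInfInclusion_single (a : KInf) (n m : ℕ) :
    toCLM (kInfInclusion a) (ell2Coord.e m) n = a n m := by
  refine (kInfInclusion_apply a _ n).trans ?_
  rw [tsum_eq_single m]
  · change a n m * (lp.single (E := fun _ : ℕ => ℂ) 2 m 1 : Ell2) m = _
    rw [lp.single_apply_self, mul_one]
  · intro l hl
    change a n l * (lp.single (E := fun _ : ℕ => ℂ) 2 m 1 : Ell2) l = _
    rw [lp.single_apply_ne _ _ _ hl, mul_zero]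

/-- Operators on `ℓ²(ℕ)` are determined by their matrices. -/
lemma ext_matrix {S T : Ell2 →L[ℂ] Ell2}
    (h : ∀ n m, S (ell2Coord.e m) n = T (ell2Coord.e m) n) : S = T := by
  refine ContinuousLinearMap.ext_on dense_span_lp_single ?_
  rintro _ ⟨m, rfl⟩
  exact lp.ext (funext fun n => h n m)

lemma kInfInclusion_injective : Function.Injective kInfInclusion := fun a b h => by
  ext n m
  rw [← toCLM_kInfInclusion_single, h, toCLM_kInfInclusion_single]

/-- Products `a k b` with `a, b ∈ K^∞` and `k` compact are in `K^∞`. -/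
lemma exists_kInf_eq_mul_mul (a b : KInf) (k : CompactOps) :
    ∃ s, kInfInclusion s = kInfInclusion a * k * kInfInclusion b := by
  let T := toCLM (kInfInclusion a * k * kInfInclusion b)
  have hrow : ∀ (x : Ell2) (n : ℕ), ‖toCLM (kInfInclusion a) x n‖ ≤ (∑' j, ‖a n j‖) * ‖x‖ :=
    fun x n => by
      have hle : ∀ j, ‖a n j * x j‖ ≤ ‖a n j‖ * ‖x‖ := fun j => by
        rw [norm_mul]
        exact mul_le_mul_of_nonneg_left (lp.norm_apply_le_norm two_ne_zero x j) (norm_nonneg _)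
      have hs := Summable.of_nonneg_of_le (fun _ => norm_nonneg _) hle
        ((a.summable_row n).mul_right ‖x‖)
      have := kInfInclusion_apply a x n
      change toCLM (kInfInclusion a) x n = _ at this
      rw [this, ← tsum_mul_right]
      exact (norm_tsum_le_tsum_norm hs).trans (hs.tsum_le_tsum hle ((a.summable_row n).mul_right _))
  -- The transpose of `b` is used so that iterated summation yields sums over columns.
  have hswap : ∀ q : ℕ, Summable fun x : ℕ × ℕ => ‖b x.2 x.1‖ * (x.2 : ℝ) ^ 0 * (x.1 : ℝ) ^ q :=
    fun q => (Equiv.prodComm ℕ ℕ).summable_iff.2 (b.summable 0 q)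
  have hcolumn : ∀ m, Summable fun l => ‖b l m‖ := fun m => by
    simpa using (hswap 0).prod_factor m
  have hcol : ∀ m, ‖toCLM (kInfInclusion b) (ell2Coord.e m)‖ ≤ ∑' l, ‖b l m‖ := fun m => by
    have hs : Summable fun l => ‖b l m • (ell2Coord.e l : Ell2)‖ :=
      Summable.of_nonneg_of_le (fun _ => norm_nonneg _) (fun l => by
        rw [norm_smul]
        exact mul_le_of_le_one_right (norm_nonneg _) (ell2Coord.norm_e l)) (hcolumn m)
    have h : toCLM (kInfInclusion b) (ell2Coord.e m) = ∑' l, b l m • (ell2Coord.e l : Ell2) := by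
      refine (HasSum.tsum_eq ?_).symm
      convert lp.hasSum_single (p := 2) (by norm_num)
        (toCLM (kInfInclusion b) (ell2Coord.e m)) using 2 with l
      rw [toCLM_kInfInclusion_single]
      change b l m • lp.single (E := fun _ : ℕ => ℂ) 2 l 1 = _
      rw [← lp.single_smul, smul_eq_mul, mul_one]
    rw [h]
    refine (norm_tsum_le_tsum_norm hs).trans (hs.tsum_le_tsum (fun l => ?_) (hcolumn m))
    rw [norm_smul]
    exact mul_le_of_le_one_right (norm_nonneg _) (ell2Coord.norm_e l)
  -- Decay in `n` comes from the rows of `a` alone and decay in `m` from the columns of `b` alone;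
  -- the compact factor contributes only its norm.
  have hT : ∀ n m, ‖T (ell2Coord.e m) n‖ ≤ (∑' j, ‖a n j‖) * (‖toCLM k‖ * ∑' l, ‖b l m‖) :=
    fun n m => by
      have : T (ell2Coord.e m) = toCLM (kInfInclusion a) (toCLM k
          (toCLM (kInfInclusion b) (ell2Coord.e m))) := by
        simp only [T, map_mul]; rfl
      rw [this]
      refine (hrow _ n).trans ?_
      refine mul_le_mul_of_nonneg_left ?_ (tsum_nonneg fun _ => norm_nonneg _)
      exact (toCLM k).le_opNorm_of_le (hcol m)
  refine ⟨KInf.mk (fun n m => T (ell2Coord.e m) n) fun p q => ?_, toCLM_injective (ext_matrix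
    fun n m => toCLM_kInfInclusion_single _ n m)⟩
  have h1 : Summable fun n : ℕ => (∑' j, ‖a n j‖) * (n : ℝ) ^ p := by
    refine (a.summable p 0).prod.congr fun n => ?_
    simp [tsum_mul_right]
  have h2 : Summable fun m : ℕ => (∑' l, ‖b l m‖) * (m : ℝ) ^ q := by
    refine (hswap q).prod.congr fun n => ?_
    simp [tsum_mul_right]
  refine Summable.of_nonneg_of_le (fun x => by positivity) (fun x => ?_)
    ((h1.mul_of_nonneg h2 (fun n => mul_nonneg (tsum_nonneg fun _ => norm_nonneg _) (by positivity))
      (fun n => mul_nonneg (tsum_nonneg fun _ => norm_nonneg _) (by positivity))).mul_left ‖toCLM k‖)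
  calc _ ≤ (∑' j, ‖a x.1 j‖) * (‖toCLM k‖ * ∑' l, ‖b l x.2‖) * (x.1 : ℝ) ^ p * (x.2 : ℝ) ^ q := by
        gcongr
        exact hT _ _
    _ = _ := by ring

end CompactOps

end CompactOperators

/-! ### The unitized compact operators and the weighted `ℓ²`-module. -/

section UnitizedCompact

open CompactOps

lemma unitizedInclusion_apply (c : ℂ) (a : KInf) :
    unitizedInclusion (Unitization.inl c + Unitization.inr a)
      = Unitization.inl c + Unitization.inr (kInfInclusion a) := by
  simp [unitizedInclusion]
  rfl

lemma unitizedInclusion_inr (a : KInf) :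
    unitizedInclusion (Unitization.inr a) = Unitization.inr (kInfInclusion a) := by
  simpa using unitizedInclusion_apply 0 a

/-- The dichotomy is on the minimal projection `unit 0 0`. Either its one-dimensional corner
survives in `π`, or `π` kills all compact operators and factors through the scalars. -/
theorem isGCR_unitization_compactOps : IsGCR (Unitization ℂ CompactOps) := by
  intro H _ _ _ π hπ T hT
  by_cases h0 : π (Unitization.inr (unit 0 0)) = 0
  · refine hπ.exists_eq_of_isCompactOperator_of_commute (fun x y => ?_) hT
    -- Every matrix unit factors through `unit 0 0`, and the matrix units span a dense subspace.
    have hk : ∀ k : CompactOps, π (Unitization.inr k) = 0 := fun k => by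
      let j : CompactOps →ₗ[ℂ] (H →L[ℂ] H) :=
        (π : Unitization ℂ CompactOps →ₗ[ℂ] H →L[ℂ] H) ∘ₗ
          (Unitization.inrNonUnitalAlgHom ℂ CompactOps : CompactOps →ₗ[ℂ] Unitization ℂ CompactOps)
      have hj : Continuous j := AddMonoidHomClass.continuous_of_bound j 1 fun k => by
        rw [one_mul, ← Unitization.norm_inr (𝕜 := ℂ) k]
        exact NonUnitalStarAlgHom.norm_apply_le π _
      refine mem_of_unit_mem (LinearMap.ker j) (isClosed_singleton.preimage hj) (fun n m => ?_) k
      have : unit n m = unit n 0 * unit 0 0 * unit 0 m := by simp [unit_mul]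
      change π (Unitization.inr (unit n m)) = 0
      rw [this, Unitization.inr_mul, Unitization.inr_mul, map_mul, map_mul, h0, mul_zero, zero_mul]
    have hs : ∀ x : Unitization ℂ CompactOps, π x = x.fst • π 1 := fun x => by
      conv_lhs => rw [← Unitization.inl_fst_add_inr_snd_eq x, map_add, hk, add_zero]
      rw [← map_smul]
      congr 1
      ext <;> simp
    rw [hs x, hs y]
    exact ((Commute.refl _).smul_left _).smul_right _
  · refine hπ.exists_eq_of_isCompactOperator (p := Unitization.inr (unit 0 0)) ⟨?_, ?_⟩ h0
      (fun b => ?_) hT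
    · rw [IsIdempotentElem, ← Unitization.inr_mul, unit_mul, if_pos rfl]
    · rw [IsSelfAdjoint, ← Unitization.inr_star, star_unit]
    -- Compressing `λ + k` to the first basis vector leaves the scalar `λ + k₀₀`.
    · refine ⟨b.fst + toCLM b.snd (ell2Coord.e 0) 0, ?_⟩
      rw [← map_smul]
      congr 1
      have h1 : unit 0 0 * b.snd * unit 0 0
          = (toCLM b.snd (ell2Coord.e 0) 0 : ℂ) • unit 0 0 := by
        refine toCLM_injective ?_
        rw [map_mul, map_mul, map_smul, toCLM_unit]
        ext x : 1
        change ell2Coord.f 0 (toCLM b.snd (ell2Coord.f 0 x • ell2Coord.e 0)) • ell2Coord.e 0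
          = toCLM b.snd (ell2Coord.e 0) 0 • ell2Coord.f 0 x • ell2Coord.e 0
        rw [map_smul, map_smul, smul_smul, smul_eq_mul, mul_comm]
        rfl
      conv_lhs => rw [← Unitization.inl_fst_add_inr_snd_eq b, mul_add, add_mul]
      rw [← Unitization.inr_mul, ← Unitization.inr_mul, h1, Unitization.inr_smul, add_smul]
      congr 1
      rw [Unitization.inr_mul_inl, ← Unitization.inr_mul, smul_mul_assoc, unit_mul, if_pos rfl,
        Unitization.inr_smul]

/-- The unital extension of the identity representation on `ℓ²(ℕ)` is irreducible, since it contains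
the matrix units, but it sends `1` to a noncompact operator. -/
theorem not_isCCR_unitization_compactOps : ¬ IsCCR (Unitization ℂ CompactOps) := fun h => by
  let π : Unitization ℂ CompactOps →⋆ₐ[ℂ] (Ell2 →L[ℂ] Ell2) := Unitization.starLift toCLM
  refine not_isCompactOperator_one_of_linearIndependent _ (linearIndependent_lp_single (ι := ℕ)) ?_
  have hr : ∀ n m, π (Unitization.inr (unit n m)) = ell2Coord.unit n m := fun n m => by
    rw [← toCLM_unit]
    exact DFunLike.congr_fun (Unitization.starLift.symm_apply_apply toCLM) (unit n m)
  have := h Ell2 (π : Unitization ℂ CompactOps →⋆ₙₐ[ℂ] (Ell2 →L[ℂ] Ell2)) ⟨⟨1, ?_⟩, ?_⟩ 1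
  · change IsCompactOperator (π 1) at this
    rwa [map_one] at this
  · change π 1 ≠ 0
    rw [map_one]
    intro h0
    exact (linearIndependent_lp_single (ι := ℕ)).ne_zero 0
      (DFunLike.congr_fun h0 (ell2Coord.e 0))
  · intro S hS hinv
    refine S.eq_bot_or_eq_top_of_coord ell2Coord.e (fun m x => x m)
      (fun x hx => lp.ext (funext hx)) dense_span_lp_single hS fun n m x hx => ?_
    have := hinv (Unitization.inr (unit n m)) x hx
    change π (Unitization.inr (unit n m)) x ∈ S at this
    rwa [hr] at this

theorem isDenseFrechetSubalgebra_unitizedInclusion :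
    IsDenseFrechetSubalgebra unitizedInclusion where
  frechet := KInf.isMConvexFrechetAlgebra_unitization
  injective x y h := by
    rw [← Unitization.inl_fst_add_inr_snd_eq x, ← Unitization.inl_fst_add_inr_snd_eq y,
      unitizedInclusion_apply, unitizedInclusion_apply] at h
    refine Unitization.ext ?_ (kInfInclusion_injective ?_)
    · simpa using congrArg (fun z => z.fst) h
    · simpa using congrArg (fun z => z.snd) h
  continuous := by
    have h : ∀ x, unitizedInclusion x
        = algebraMap ℂ _ x.fst + Unitization.inr (kInfInclusion x.snd) := fun x => by
      conv_lhs => rw [← Unitization.inl_fst_add_inr_snd_eq x, unitizedInclusion_apply]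
      rfl
    rw [funext h]
    refine ((algebraMapCLM ℂ _).continuous.comp KInf.continuous_fst_unitization).add ?_
    refine (Unitization.isometry_inr (𝕜 := ℂ)).continuous.comp ?_
    refine Continuous.comp ?_ KInf.continuous_snd_unitization
    exact isometry_toCLM.isEmbedding.continuous_iff.2 ell2Coord.continuous_toOp
  dense x := by
    have h : Continuous fun k : CompactOps =>
        (Unitization.inl x.fst + Unitization.inr k : Unitization ℂ CompactOps) :=
      continuous_const.add (Unitization.isometry_inr (𝕜 := ℂ)).continuous
    have h1 := map_mem_closure h (denseRange_kInfInclusion x.snd)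
      (t := Set.range unitizedInclusion) (by
        rintro _ ⟨a, rfl⟩
        exact ⟨_, unitizedInclusion_apply x.fst a⟩)
    rwa [Unitization.inl_fst_add_inr_snd_eq] at h1

/-- It suffices to find the inverse in the image, since injectivity then transfers the relations.
For `c + K` with inverse `d + b`, the two inverse equations combine to express `b` through `K`, `K²`
and `KbK`. -/
theorem isSpectralInvariant_unitizedInclusion : IsSpectralInvariant unitizedInclusion := by
  refine fun x => ⟨fun h => h.map unitizedInclusion, fun h => ?_⟩
  obtain ⟨y, hxy, hyx⟩ := isUnit_iff_exists.1 h
  have hinj := isDenseFrechetSubalgebra_unitizedInclusion.injective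
  obtain ⟨z, rfl⟩ : ∃ z, unitizedInclusion z = y := by
    rw [← Unitization.inl_fst_add_inr_snd_eq x, unitizedInclusion_apply] at hxy hyx
    set c := x.fst
    set a := x.snd
    have hcd : c * y.fst = 1 := by simpa using congrArg (fun z => z.fst) hxy
    have h1 := congrArg (fun z => z.snd) hxy
    have h2 := congrArg (fun z => z.snd) hyx
    set d := y.fst
    set b := y.snd
    set K := kInfInclusion a
    simp at h1 h2
    change c • b + d • K + K * b = 0 at h1
    change d • K + c • b + b * K = 0 at h2
    have hb : b = d • c • b := by rw [smul_smul, mul_comm, hcd, one_smul]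
    have hb1 : b = -(d ^ 2 • K) - d • (K * b) := by
      have h3 : c • b = -(d • K + K * b) := by
        rw [add_assoc] at h1; exact eq_neg_of_add_eq_zero_left h1
      conv_lhs => rw [hb, h3]
      module
    have hb2 : b = -(d ^ 2 • K) - d • (b * K) := by
      have h3 : c • b = -(d • K + b * K) := by
        rw [add_comm (d • K), add_assoc] at h2; exact eq_neg_of_add_eq_zero_left h2
      conv_lhs => rw [hb, h3]
      module
    -- Inserting the equation for the left inverse into the one for the right inverse places `b`
    -- between two factors `K`, which is what `exists_kInf_eq_mul_mul` needs.
    have hKb : K * b = -(d ^ 2 • (K * K)) - d • (K * b * K) := by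
      conv_lhs => rw [hb2, mul_sub, mul_neg, mul_smul_comm, mul_smul_comm, ← mul_assoc]
    obtain ⟨s, hs⟩ := exists_kInf_eq_mul_mul a a b
    refine ⟨Unitization.inl d + Unitization.inr
      (-(d ^ 2 • a) + d ^ 3 • (a * a) + d ^ 2 • s), ?_⟩
    rw [unitizedInclusion_apply]
    refine Unitization.ext (by simp [d]) ?_
    have : kInfInclusion (-(d ^ 2 • a) + d ^ 3 • (a * a) + d ^ 2 • s) = b := by
      rw [map_add, map_add, map_neg, map_smul, map_smul, map_smul, map_mul, hs]
      change -(d ^ 2 • K) + d ^ 3 • (K * K) + d ^ 2 • (K * b * K) = b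
      conv_rhs => rw [hb1, hKb]
      module
    simpa using this
  refine isUnit_iff_exists.2 ⟨z, hinj ?_, hinj ?_⟩
  · rw [map_mul, hxy, map_one]
  · rw [map_mul, hyx, map_one]

namespace WeightedEll2

/-- The basis expansion of `ℓ²(ℕ)` is pulled back along the isometry; the factor `root n` cancels
termwise. -/
lemma hasSum_coord (ξ : WeightedEll2) : HasSum (fun n => ξ n • coord.e n) ξ := by
  have h := lp.hasSum_single (p := 2) (by norm_num) (toEll2 ξ)
  have h2 := h.map toEll2Isometry.symm toEll2Isometry.symm.continuous
  rw [show toEll2Isometry.symm (toEll2 ξ) = ξ from toEll2.symm_apply_apply ξ] at h2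
  refine h2.congr_fun fun n => ?_
  ext m
  change ξ n * (Pi.single n (1 : ℂ) : ℕ → ℂ) m
    = lp.single (E := fun _ : ℕ => ℂ) 2 n (toEll2 ξ n) m * (root m : ℂ)
  rw [lp.single_apply, Pi.single_apply, Pi.single_apply]
  split_ifs with hmn
  · subst hmn
    exact (mul_one _).trans (div_mul_cancel₀ (ξ m) (root_ne m)).symm
  · simp

lemma dense_span_coord : Dense (Submodule.span ℂ (Set.range coord.e) : Set WeightedEll2) :=
  fun ξ => mem_closure_of_tendsto (hasSum_coord ξ) <| Filter.Eventually.of_forall fun _ =>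
    Submodule.sum_mem _ fun n _ => Submodule.smul_mem _ _ (Submodule.subset_span ⟨n, rfl⟩)

lemma rep_inr_single (n m : ℕ) (ξ : WeightedEll2) :
    rep (Unitization.inr (KInf.single n m)) ξ = ξ m • coord.e n := by
  have h2 : rep (Unitization.inr (KInf.single n m))
      = opToEnd _ (coord.toOp (KInf.single n m)) := by simp [rep]
  rw [h2, coord.toOp_single]
  rfl

/-- Joint continuity holds because `coord.toOp` is continuous into the operator norm; irreducibility
holds because the algebra contains all matrix units. -/
theorem isIrreducibleModule_rep : IsIrreducibleModule rep where
  continuous := by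
    have h : ∀ x : Unitization ℂ KInf × WeightedEll2,
        rep x.1 x.2 = x.1.fst • x.2 + coord.toOp x.1.snd x.2 := fun x => by
      conv_lhs => rw [← Unitization.inl_fst_add_inr_snd_eq x.1]
      ext n
      rw [rep_apply]
      have h := coord.f_toOp x.1.snd x.2 n
      change _ = ∑' m, x.1.snd n m * x.2 m at h
      rw [← h]
      rfl
    rw [funext h]
    exact ((KInf.continuous_fst_unitization.comp continuous_fst).smul continuous_snd).add
      ((coord.continuous_toOp.comp (KInf.continuous_snd_unitization.comp continuous_fst)).clm_apply
        continuous_snd)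
  nontrivial := ⟨coord.e 0, 0, fun h => by simpa [h] using coord.biorth 0 0⟩
  irreducible S hS hinv := S.eq_bot_or_eq_top_of_coord coord.e (fun m ξ => ξ m)
    (fun ξ h => ext h) dense_span_coord hS fun n m ξ hξ => by
      rw [← rep_inr_single]; exact hinv _ ξ hξ

lemma not_memℓp_one : ¬ Memℓp (fun n : ℕ => one n) 2 := fun h => by
  have h1 := (memℓp_gen_iff (by norm_num)).1 h
  have h2 := h1.tendsto_cofinite_zero
  have h3 : (fun n => ‖one n‖ ^ (2 : ℝ≥0∞).toReal) = fun _ : ℕ => (1 : ℝ) := by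
    ext n; simp [one, mk_apply]
  rw [h3] at h2
  exact one_ne_zero (tendsto_nhds_unique tendsto_const_nhds h2)

end WeightedEll2

/-- The first-row matrix units `E_0m` send `ξ` to `ξ(m)` times the basis vector at `0`. -/
theorem memℓp_two_of_isContainedIn_unitization {H : Type*} [NormedAddCommGroup H]
    [InnerProductSpace ℂ H] [CompleteSpace H] (ξ : WeightedEll2)
    (π : Unitization ℂ CompactOps →⋆ₙₐ[ℂ] (H →L[ℂ] H))
    (h : IsContainedIn (F := Cyclic WeightedEll2.rep ξ)
      (Cyclic.action WeightedEll2.rep ξ :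
        Unitization ℂ KInf →ₙₐ[ℂ] Module.End ℂ (Cyclic WeightedEll2.rep ξ))
      (unitizedInclusion : Unitization ℂ KInf →ₙₐ[ℂ] Unitization ℂ CompactOps) π) :
    Memℓp (fun n : ℕ => ξ n) 2 := by
  refine memℓp_two_of_isContainedIn_cyclic _ ξ h
    (fun m => Unitization.inr (KInf.single 0 m)) (fun s => ?_) (δ := WeightedEll2.coord.e 0)
    (fun h => by simpa [h] using WeightedEll2.coord.biorth 0 0) _ fun m => ?_
  · have : ∀ m, (unitizedInclusion : Unitization ℂ KInf →ₙₐ[ℂ] Unitization ℂ CompactOps)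
        (Unitization.inr (KInf.single 0 m)) = Unitization.inr (unit 0 m) := fun m =>
      unitizedInclusion_inr _
    simp only [this, ← Unitization.inr_star, ← Unitization.inr_mul]
    have hsum : ∀ f : ℕ → CompactOps, ∑ m ∈ s, (Unitization.inr (f m) : Unitization ℂ CompactOps)
        = Unitization.inr (∑ m ∈ s, f m) := fun f =>
      (map_sum (Unitization.inrNonUnitalAlgHom ℂ CompactOps) f s).symm
    rw [hsum, Unitization.norm_inr]
    exact norm_sum_le s
  · change WeightedEll2.rep _ (WeightedEll2.rep 1 ξ) = _
    rw [map_one]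
    exact WeightedEll2.rep_inr_single 0 m ξ

theorem memℓp_two_of_isContainedIn_compactOps {H : Type*} [NormedAddCommGroup H]
    [InnerProductSpace ℂ H] [CompleteSpace H] (ξ : WeightedEll2)
    (π : CompactOps →⋆ₙₐ[ℂ] (H →L[ℂ] H))
    (h : IsContainedIn (F := Cyclic WeightedEll2.rep ξ)
      ((Cyclic.action WeightedEll2.rep ξ :
        Unitization ℂ KInf →ₙₐ[ℂ] Module.End ℂ (Cyclic WeightedEll2.rep ξ)).comp
        (Unitization.inrNonUnitalAlgHom ℂ KInf)) kInfInclusion π) :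
    Memℓp (fun n : ℕ => ξ n) 2 := by
  refine memℓp_two_of_isContainedIn_cyclic _ ξ h
    (fun m => KInf.single 0 m) norm_sum_le (δ := WeightedEll2.coord.e 0)
    (fun h => by simpa [h] using WeightedEll2.coord.biorth 0 0) _ fun m => ?_
  change WeightedEll2.rep _ (WeightedEll2.rep 1 ξ) = _
  rw [map_one]
  exact WeightedEll2.rep_inr_single 0 m ξ

end UnitizedCompact

/-! ## The representation of the crossed product on `ℓ²(ℤ)` -/

section RegularRep

/-- The Hilbert space `ℓ²(ℤ)`. -/
abbrev Ell2Z : Type := lp (fun _ : ℤ => ℂ) 2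

namespace Ell2Z

/-- The standard basis vectors. -/
def e (n : ℤ) : Ell2Z := lp.single 2 n 1

lemma e_apply (n z : ℤ) : e n z = if z = n then 1 else 0 := by
  rw [e, lp.single_apply, Pi.single_apply]

lemma norm_e (n : ℤ) : ‖e n‖ = 1 := by simp [e]

/-- Multiplication by a bounded function. -/
def mulFun (f : ℤ →ᵇ ℂ) (x : Ell2Z) : Ell2Z :=
  ⟨fun z => f z * x z, ((lp.memℓp x).norm.const_mul ‖f‖).mono fun z => by
    rw [norm_mul]
    exact mul_le_mul_of_nonneg_right (f.norm_coe_le_norm z) (norm_nonneg _)⟩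

lemma norm_mulFun_le (f : ℤ →ᵇ ℂ) (x : Ell2Z) : ‖mulFun f x‖ ≤ ‖f‖ * ‖x‖ := by
  have h : ‖mulFun f x‖ ≤ ‖(‖f‖ : ℂ) • x‖ := lp.norm_mono two_ne_zero fun z => by
    change ‖f z * x z‖ ≤ ‖(‖f‖ : ℂ) * x z‖
    rw [norm_mul, norm_mul, Complex.norm_real, norm_norm]
    exact mul_le_mul_of_nonneg_right (f.norm_coe_le_norm z) (norm_nonneg _)
  rwa [norm_smul, Complex.norm_real, norm_norm] at h

/-- Multiplication by a bounded function as a bounded operator. -/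
def mulOp (f : ℤ →ᵇ ℂ) : Ell2Z →L[ℂ] Ell2Z :=
  LinearMap.mkContinuous
    { toFun := mulFun f
      map_add' := fun x y => lp.ext (funext fun z => mul_add (f z) (x z) (y z))
      map_smul' := fun c x => lp.ext (funext fun z => mul_left_comm (f z) c (x z)) } ‖f‖
    (norm_mulFun_le f)

lemma mulOp_apply (f : ℤ →ᵇ ℂ) (x : Ell2Z) (z : ℤ) : mulOp f x z = f z * x z := rfl

/-- The representation of bounded functions by multiplication operators. -/
def mulHom : (ℤ →ᵇ ℂ) →⋆ₐ[ℂ] (Ell2Z →L[ℂ] Ell2Z) where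
  toFun := mulOp
  map_one' := by ext x z; exact one_mul (x z)
  map_mul' f g := by ext x z; exact mul_assoc (f z) (g z) (x z)
  map_zero' := by ext x z; exact zero_mul (x z)
  map_add' f g := by ext x z; exact add_mul (f z) (g z) (x z)
  commutes' c := by
    ext x z
    rw [Algebra.algebraMap_eq_smul_one, Algebra.algebraMap_eq_smul_one]
    change (c • (1 : ℂ)) * x z = c * x z
    simp
  map_star' f := by
    rw [ContinuousLinearMap.star_eq_adjoint, ContinuousLinearMap.eq_adjoint_iff]
    intro x y
    rw [lp.inner_eq_tsum, lp.inner_eq_tsum]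
    refine tsum_congr fun z => ?_
    rw [mulOp_apply, mulOp_apply]
    simp only [BoundedContinuousFunction.star_apply, RCLike.inner_apply, map_mul, RCLike.star_def,
      RCLike.conj_conj]
    ring

lemma memℓp_comp_equiv (σ : ℤ ≃ ℤ) (x : Ell2Z) : Memℓp (fun z => x (σ z)) 2 :=
  memℓp_gen (σ.summable_iff.2
    ((memℓp_gen_iff (E := fun _ : ℤ => ℂ) (p := 2) (by norm_num)).1 (lp.memℓp x)))

/-- Translation by `n`. -/
def shift (n : ℤ) : Ell2Z ≃ₗᵢ[ℂ] Ell2Z where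
  toFun x := ⟨fun z => x (z - n), memℓp_comp_equiv (Equiv.subRight n) x⟩
  invFun x := ⟨fun z => x (z + n), memℓp_comp_equiv (Equiv.addRight n) x⟩
  map_add' x y := rfl
  map_smul' c x := rfl
  left_inv x := lp.ext (funext fun z => congrArg x (add_sub_cancel_right z n))
  right_inv x := lp.ext (funext fun z => congrArg x (sub_add_cancel z n))
  norm_map' x := by
    rw [lp.norm_eq_tsum_rpow (by norm_num), lp.norm_eq_tsum_rpow (by norm_num)]
    congr 1
    exact (Equiv.subRight n).tsum_eq fun z => ‖x z‖ ^ (2 : ℝ≥0∞).toReal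

lemma shift_apply (n : ℤ) (x : Ell2Z) (z : ℤ) : shift n x z = x (z - n) := rfl

/-- The matrix entries of an operator. -/
def entry (z w : ℤ) : (Ell2Z →L[ℂ] Ell2Z) →L[ℂ] ℂ :=
  LinearMap.mkContinuous
    { toFun := fun T => T (e w) z, map_add' := fun _ _ => rfl, map_smul' := fun _ _ => rfl } 1
    fun T => by
      refine (lp.norm_apply_le_norm two_ne_zero (T (e w)) z).trans ?_
      simpa [norm_e] using T.le_opNorm (e w)

lemma entry_apply (z w : ℤ) (T : Ell2Z →L[ℂ] Ell2Z) : entry z w T = T (e w) z := rfl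

lemma norm_entry_le (z w : ℤ) : ‖entry z w‖ ≤ 1 := LinearMap.mkContinuous_norm_le _ zero_le_one _

lemma ext_entry {S T : Ell2Z →L[ℂ] Ell2Z} (h : ∀ z w, entry z w S = entry z w T) : S = T := by
  refine ContinuousLinearMap.ext_on dense_span_lp_single ?_
  rintro _ ⟨w, rfl⟩
  exact lp.ext (funext fun z => h z w)

lemma entry_mulHom_mul (f : ℤ →ᵇ ℂ) (T : Ell2Z →L[ℂ] Ell2Z) (z w : ℤ) :
    entry z w (mulHom f * T) = f z * entry z w T := rfl

lemma entry_mul_mulHom (f : ℤ →ᵇ ℂ) (T : Ell2Z →L[ℂ] Ell2Z) (z w : ℤ) :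
    entry z w (T * mulHom f) = f w * entry z w T := by
  have : mulHom f (e w) = f w • e w := lp.ext (funext fun y => by
    change f y * e w y = f w * e w y
    rw [e_apply]
    split_ifs with h
    · rw [h]
    · simp)
  change T (mulHom f (e w)) z = f w * T (e w) z
  rw [this, map_smul]
  rfl

end Ell2Z

/-- Restriction of functions from `M` to `ℤ`. -/
def restrictZ : C(ZInfty, ℂ) →⋆ₐ[ℂ] (ℤ →ᵇ ℂ) where
  toFun f := (BoundedContinuousFunction.mkOfCompact f).compContinuous
    ⟨((↑) : ℤ → ZInfty), OnePoint.continuous_coe⟩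
  map_one' := rfl
  map_mul' _ _ := rfl
  map_zero' := rfl
  map_add' _ _ := rfl
  commutes' _ := rfl
  map_star' _ := rfl

/-- `ℤ` is dense in `M`, since it is not compact. -/
lemma norm_le_of_forall_int (f : C(ZInfty, ℂ)) {C : ℝ} (hC : 0 ≤ C) (h : ∀ z : ℤ, ‖f z‖ ≤ C) :
    ‖f‖ ≤ C := by
  refine (ContinuousMap.norm_le f hC).2 fun x => ?_
  refine (OnePoint.denseRange_coe (X := ℤ)).induction_on x ?_ h
  exact isClosed_le (by fun_prop) continuous_const

lemma norm_restrictZ (f : C(ZInfty, ℂ)) : ‖restrictZ f‖ = ‖f‖ := by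
  refine le_antisymm ?_ (norm_le_of_forall_int f (norm_nonneg _) fun z =>
    (restrictZ f).norm_coe_le_norm z)
  exact (BoundedContinuousFunction.norm_le (norm_nonneg _)).2 fun z => f.norm_coe_le_norm z

lemma ext_int {f g : C(ZInfty, ℂ)} (h : ∀ z : ℤ, f z = g z) : f = g := by
  refine sub_eq_zero.1 (norm_le_zero_iff.1 (norm_le_of_forall_int _ le_rfl fun z => ?_))
  rw [ContinuousMap.sub_apply, h, sub_self, norm_zero]

open Ell2Z in
/-- The covariant representation on `ℓ²(ℤ)` by multiplication and translation. -/
def regularRep : CovariantRep where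
  H := Ell2Z
  nontrivial := ⟨e 0, 0, fun h => by simpa [h] using norm_e 0⟩
  π := mulHom.comp restrictZ
  U := Unitary.linearIsometryEquiv.symm.toMonoidHom.comp
    { toFun := fun n => shift n.toAdd
      map_one' := by ext x z; simp [shift_apply]
      map_mul' := fun m n => by
        ext x z
        change x (z - (m * n).toAdd) = x (z - m.toAdd - n.toAdd)
        rw [toAdd_mul, sub_sub] }
  covariant n f := by
    have hc : ∀ n : ℤ, ((shift n : Ell2Z ≃ₗᵢ[ℂ] Ell2Z) : Ell2Z →L[ℂ] Ell2Z) * mulHom (restrictZ f)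
        = mulHom (restrictZ (alpha n f)) * (shift n : Ell2Z ≃ₗᵢ[ℂ] Ell2Z) := fun n => by
      ext x z
      change f ((z - n : ℤ) : ZInfty) * x (z - n) = f ((z + -n : ℤ) : ZInfty) * x (z - n)
      rw [sub_eq_add_neg]
    change ((Unitary.linearIsometryEquiv.symm (shift n) : unitary _) : Ell2Z →L[ℂ] Ell2Z)
      * mulHom (restrictZ f) * star ((Unitary.linearIsometryEquiv.symm (shift n) : unitary _) :
        Ell2Z →L[ℂ] Ell2Z) = mulHom (restrictZ (alpha n f))
    have h1 := Unitary.coe_symm_linearIsometryEquiv_apply (shift n)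
    have h2 := Unitary.coe_mul_star_self (Unitary.linearIsometryEquiv.symm (shift n))
    rw [Unitary.coe_star, h1] at h2
    rw [h1, hc, mul_assoc, h2, mul_one]

namespace CrossedProduct

/-- The representation of the crossed product on `ℓ²(ℤ)`. -/
def regular : CrossedProduct →⋆ₐ[ℂ] (Ell2Z →L[ℂ] Ell2Z) where
  toFun b := val b regularRep
  map_one' := rfl
  map_mul' _ _ := rfl
  map_zero' := rfl
  map_add' _ _ := rfl
  commutes' _ := rfl
  map_star' _ := rfl

lemma regular_φ_mul_u_apply (f : C(ZInfty, ℂ)) (n : ℤ) (x : Ell2Z) (z : ℤ) :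
    regular (pair.φ f * pair.u (.ofAdd n)) x z = f z * x (z - n) := by
  rw [map_mul]; rfl

lemma norm_regular_le (b : CrossedProduct) : ‖regular b‖ ≤ ‖b‖ :=
  NonUnitalStarAlgHom.norm_apply_le regular b

/-- `regular` as a bounded linear map. -/
def regularCLM : CrossedProduct →L[ℂ] (Ell2Z →L[ℂ] Ell2Z) :=
  LinearMap.mkContinuous (regular : CrossedProduct →ₗ[ℂ] Ell2Z →L[ℂ] Ell2Z) 1 fun b => by
    rw [one_mul]; exact norm_regular_le b

lemma regular_schwartzInclusion (F : SchwartzZ) :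
    regular (schwartzInclusion F) = ∑' n, regular (pair.φ (F n) * pair.u (.ofAdd n)) :=
  regularCLM.map_tsum (pair.summable_term F).of_norm

lemma entry_regular_φ_mul_u (f : C(ZInfty, ℂ)) (n z w : ℤ) :
    Ell2Z.entry z w (regular (pair.φ f * pair.u (.ofAdd n))) = if z - n = w then f z else 0 := by
  rw [Ell2Z.entry_apply, regular_φ_mul_u_apply, Ell2Z.e_apply]
  split_ifs <;> simp

lemma summable_regular (F : SchwartzZ) :
    Summable fun n => regular (pair.φ (F n) * pair.u (.ofAdd n)) :=
  (pair.summable_term F).of_norm.mapL regularCLM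

/-- Each `f u_n` is supported on the `n`-th diagonal, so the coefficient `F n` can be read off from
that diagonal. -/
lemma entry_regular_schwartzInclusion (F : SchwartzZ) (z w : ℤ) :
    Ell2Z.entry z w (regular (schwartzInclusion F)) = F (z - w) z := by
  rw [regular_schwartzInclusion, (Ell2Z.entry z w).map_tsum (summable_regular F),
    tsum_eq_single (z - w)]
  · rw [entry_regular_φ_mul_u, if_pos (by ring)]
  · intro n hn
    rw [entry_regular_φ_mul_u, if_neg (fun h => hn (by rw [← h]; ring))]

/-- Faithfulness on the Schwartz algebra is enough for what follows; faithfulness of `regular` on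
the whole crossed product is never needed. -/
lemma regular_schwartzInclusion_injective :
    Function.Injective fun F => regular (schwartzInclusion F) := fun F G h => by
  ext1 n
  refine ext_int fun z => ?_
  have := congrArg (Ell2Z.entry z (z - n)) h
  simpa [entry_regular_schwartzInclusion] using this

/-- The image is an algebra containing the generators and their adjoints, hence the whole
`*`-algebra whose closure defines the crossed product. -/
lemma denseRange_schwartzInclusion : DenseRange schwartzInclusion := fun b => by
  have hval : Topology.IsInducing val := ⟨rfl⟩
  have hgen : ∀ x ∈ StarAlgebra.adjoin ℂ (Set.range AllReps.π ∪ Set.range AllReps.U),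
      x ∈ ((val : CrossedProduct →ₐ[ℂ] AllReps).comp schwartzInclusion).range := fun x hx => by
    have hx' : x ∈ Algebra.adjoin ℂ ((Set.range AllReps.π ∪ Set.range AllReps.U) ∪
      star (Set.range AllReps.π ∪ Set.range AllReps.U)) := hx
    refine Algebra.adjoin_le ?_ hx'
    have hπ : ∀ f, AllReps.π f ∈ ((val : CrossedProduct →ₐ[ℂ] AllReps).comp
        schwartzInclusion).range := fun f => ⟨SchwartzZ.single 0 f, by
      change val (schwartzInclusion _) = _
      rw [schwartzInclusion, CovariantPair.integrated_single, ofAdd_zero, map_one, mul_one]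
      rfl⟩
    have hU : ∀ n, AllReps.U n ∈ ((val : CrossedProduct →ₐ[ℂ] AllReps).comp
        schwartzInclusion).range := fun n => ⟨SchwartzZ.single n.toAdd 1, by
      change val (schwartzInclusion _) = _
      rw [schwartzInclusion, CovariantPair.integrated_single, map_one, one_mul]
      rfl⟩
    rintro y ((⟨f, rfl⟩ | ⟨n, rfl⟩) | hy)
    · exact hπ f
    · exact hU n
    · rcases hy with ⟨f, hf⟩ | ⟨n, hn⟩
      · rw [← star_star y, ← hf, ← map_star]
        exact hπ _
      · have : star (AllReps.U n) = AllReps.U n⁻¹ := by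
          ext1 i
          change star (i.U n : i.Op) = (i.U n⁻¹ : i.Op)
          rw [map_inv]
          rfl
        rw [← star_star y, ← hn, this]
        exact hU _
  rw [hval.closure_eq_preimage_closure_image]
  refine closure_mono ?_ b.2
  intro x hx
  obtain ⟨F, hF⟩ := hgen x hx
  exact ⟨_, ⟨F, rfl⟩, hF⟩

/-- Closed subspaces containing all `f u_n` contain everything. -/
lemma mem_of_φ_mul_u_mem (W : Submodule ℂ CrossedProduct) (hW : IsClosed (W : Set CrossedProduct))
    (h : ∀ f n, pair.φ f * pair.u (.ofAdd n) ∈ W) (b : CrossedProduct) : b ∈ W := by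
  refine closure_minimal ?_ hW (denseRange_schwartzInclusion b)
  rintro _ ⟨F, rfl⟩
  exact hW.mem_of_tendsto (pair.summable_term F).of_norm.hasSum
    (Filter.Eventually.of_forall fun s => W.sum_mem fun n _ => h _ _)

end CrossedProduct

theorem isDenseFrechetSubalgebra_schwartzInclusion :
    IsDenseFrechetSubalgebra schwartzInclusion where
  frechet := SchwartzZ.isMConvexFrechetAlgebra
  injective _ _ h := CrossedProduct.regular_schwartzInclusion_injective
    (congrArg CrossedProduct.regular h)
  continuous := CrossedProduct.pair.continuous_integrated
  dense := CrossedProduct.denseRange_schwartzInclusion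

end RegularRep

/-! ### Minimal projections in the crossed product; GCR but not CCR. -/

section CrossedProductStructure

/-- The indicator function of the isolated point `z` of `M`. -/
def deltaZ (z : ℤ) : C(ZInfty, ℂ) where
  toFun := Set.indicator {(z : ZInfty)} 1
  continuous_toFun := by
    have h : IsClopen ({(z : ZInfty)} : Set ZInfty) := ⟨isClosed_singleton, by
      simpa using (OnePoint.isOpenEmbedding_coe (X := ℤ)).isOpenMap {z} (isOpen_discrete _)⟩
    exact continuous_one.indicator (by simp [h.frontier_eq])

lemma deltaZ_coe (z w : ℤ) : deltaZ z w = if w = z then 1 else 0 := by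
  classical
  change Set.indicator {(z : ZInfty)} 1 (w : ZInfty) = (_ : ℂ)
  rw [Set.indicator_apply]
  simp

lemma deltaZ_infty (z : ℤ) : deltaZ z OnePoint.infty = 0 := by
  simp [deltaZ]

lemma star_deltaZ (z : ℤ) : star (deltaZ z) = deltaZ z := by
  refine ext_int fun w => ?_
  rw [ContinuousMap.star_apply, deltaZ_coe]
  split_ifs <;> simp

lemma mul_deltaZ (f : C(ZInfty, ℂ)) (z : ℤ) : f * deltaZ z = f z • deltaZ z := by
  refine ext_int fun w => ?_
  rw [ContinuousMap.mul_apply, ContinuousMap.smul_apply, deltaZ_coe, smul_eq_mul]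
  split_ifs with h
  · rw [h]
  · simp

lemma alpha_deltaZ (n z : ℤ) : alpha n (deltaZ z) = deltaZ (z + n) := by
  refine ext_int fun w => ?_
  rw [alpha_apply, shiftM_coe, deltaZ_coe, deltaZ_coe]
  congr 1
  exact propext ⟨fun h => by rw [← h]; ring, fun h => by rw [h]; ring⟩

/-- Closed subspaces of `C(M)` containing `1` and all indicators of points of `ℤ` contain
everything. -/
lemma mem_of_deltaZ_mem (W : Submodule ℂ C(ZInfty, ℂ)) (hW : IsClosed (W : Set C(ZInfty, ℂ)))
    (h1 : 1 ∈ W) (hδ : ∀ z, deltaZ z ∈ W) (f : C(ZInfty, ℂ)) : f ∈ W := by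
  refine hW.closure_subset_iff.2 subset_rfl (Metric.mem_closure_iff.2 fun ε hε => ?_)
  -- Once the value at `∞` is removed, only finitely many integers carry values of size at least
  -- `ε/2`; the corresponding point indicators give the approximation.
  let g : C(ZInfty, ℂ) := f - f OnePoint.infty • 1
  have hg : g OnePoint.infty = 0 := by simp [g]
  have hfin : {z : ℤ | ε / 2 ≤ ‖g z‖}.Finite := by
    have hc : Filter.Tendsto (fun z : ℤ => g z) Filter.cofinite (nhds 0) := by
      rw [← Filter.cocompact_eq_cofinite, ← hg]
      refine (g.continuous.tendsto _).comp ?_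
      refine OnePoint.tendsto_coe_infty.mono_left ?_
      rw [Filter.coclosedCompact_eq_cocompact]
    have := hc.norm.eventually_lt_const (show ‖(0 : ℂ)‖ < ε / 2 by simpa using hε)
    rw [Filter.eventually_cofinite] at this
    simpa only [not_lt] using this
  refine ⟨f OnePoint.infty • 1 + ∑ z ∈ hfin.toFinset, g z • deltaZ z,
    W.add_mem (W.smul_mem _ h1) (W.sum_mem fun z _ => W.smul_mem _ (hδ z)), ?_⟩
  rw [dist_eq_norm, ← sub_sub]
  refine lt_of_le_of_lt (norm_le_of_forall_int _ (half_pos hε).le fun w => ?_) (half_lt_self hε)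
  have hs : (∑ z ∈ hfin.toFinset, g z • deltaZ z) w
      = if w ∈ hfin.toFinset then g w else 0 := by
    rw [ContinuousMap.sum_apply]
    simp only [ContinuousMap.smul_apply, deltaZ_coe, smul_eq_mul, mul_ite, mul_one, mul_zero]
    rw [Finset.sum_ite_eq]
  rw [ContinuousMap.sub_apply, hs]
  change ‖g w - _‖ ≤ _
  split_ifs with hw
  · simpa using (half_pos hε).le
  · rw [sub_zero]
    simpa using (not_le.1 (by simpa using hw)).le

namespace CrossedProduct

lemma star_φ (f : C(ZInfty, ℂ)) : star (pair.φ f) = pair.φ (star f) :=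
  Subtype.ext (map_star AllReps.π f).symm

lemma star_u (n : ℤ) : star (pair.u (.ofAdd n)) = pair.u (.ofAdd (-n)) := by
  refine Subtype.ext ?_
  change star (AllReps.U (.ofAdd n)) = AllReps.U (.ofAdd (-n))
  ext1 i
  change star (i.U (.ofAdd n) : i.Op) = (i.U (.ofAdd (-n)) : i.Op)
  rw [ofAdd_neg, map_inv]
  rfl

lemma u_mul_u (m n : ℤ) :
    pair.u (.ofAdd m) * pair.u (.ofAdd n) = pair.u (.ofAdd (m + n)) := by
  rw [ofAdd_add, map_mul]

lemma u_zero : pair.u (.ofAdd (0 : ℤ)) = 1 := by rw [ofAdd_zero, map_one]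

lemma isStarProjection_φ {f : C(ZInfty, ℂ)} (hf : IsStarProjection f) :
    IsStarProjection (pair.φ f) :=
  ⟨by rw [IsIdempotentElem, ← map_mul, hf.isIdempotentElem.eq],
    by rw [IsSelfAdjoint, star_φ, hf.isSelfAdjoint.star_eq]⟩

lemma deltaZ_mul_deltaZ (z w : ℤ) : deltaZ z * deltaZ w = if w = z then deltaZ z else 0 := by
  rw [mul_deltaZ, deltaZ_coe]
  split_ifs with h
  · rw [h, one_smul]
  · rw [zero_smul]

lemma isStarProjection_sum_deltaZ (s : Finset ℤ) : IsStarProjection (∑ z ∈ s, deltaZ z) := by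
  refine ⟨?_, ?_⟩
  · rw [IsIdempotentElem, Finset.sum_mul_sum]
    simp [deltaZ_mul_deltaZ]
  · rw [IsSelfAdjoint, star_sum]
    simp [star_deltaZ]

lemma isStarProjection_deltaZ (z : ℤ) : IsStarProjection (deltaZ z) := by
  simpa using isStarProjection_sum_deltaZ {z}

/-- The corner of the crossed product at an isolated point is one-dimensional. -/
lemma exists_corner_eq_smul (b : CrossedProduct) :
    ∃ c : ℂ, pair.φ (deltaZ 0) * b * pair.φ (deltaZ 0) = c • pair.φ (deltaZ 0) := by
  let p := pair.φ (deltaZ 0)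
  let L : CrossedProduct →ₗ[ℂ] CrossedProduct := LinearMap.mulLeft ℂ p ∘ₗ LinearMap.mulRight ℂ p
  have hL : Continuous L := continuous_const.mul (continuous_id.mul continuous_const)
  have hcl : IsClosed (Submodule.span ℂ {p} : Set CrossedProduct) :=
    Submodule.closed_of_finiteDimensional _
  have h := mem_of_φ_mul_u_mem ((Submodule.span ℂ {p}).comap L)
    (hcl.preimage hL) (fun f n => ?_) b
  · obtain ⟨c, hc⟩ := Submodule.mem_span_singleton.1 h
    refine ⟨c, ?_⟩
    rw [mul_assoc]
    exact hc.symm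
  -- Moving `u_n` past the indicator of `0` turns it into the indicator of `n`, so the compression
  -- vanishes unless `n = 0`.
  · have : L (pair.φ f * pair.u (.ofAdd n))
        = pair.φ (f * (deltaZ 0 * deltaZ (0 + n))) * pair.u (.ofAdd n) := by
      change pair.φ (deltaZ 0) * (pair.φ f * pair.u (.ofAdd n) * pair.φ (deltaZ 0)) = _
      rw [mul_assoc (pair.φ f), pair.covariant, alpha_deltaZ, ← mul_assoc, ← mul_assoc,
        ← map_mul, ← map_mul]
      congr 2
      ring
    rw [Submodule.mem_comap, this, deltaZ_mul_deltaZ]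
    split_ifs with hn
    · rw [zero_add] at hn
      rw [hn, u_zero, mul_one, mul_deltaZ, map_smul]
      exact Submodule.smul_mem _ _ (Submodule.mem_span_singleton_self _)
    · rw [mul_zero, map_zero, zero_mul]
      exact Submodule.zero_mem _

lemma continuous_φ : Continuous pair.φ :=
  AddMonoidHomClass.continuous_of_bound pair.φ 1 fun f => by rw [one_mul]; exact pair.norm_φ f

/-- The indicator of `0` is a minimal projection. If `π` kills it, then `C(M)` acts only through the
value at `∞`, and the image is generated by scalar multiples of the commuting operators `π(u_n)`. -/
theorem isGCR : IsGCR CrossedProduct := by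
  intro H _ _ _ π hπ T hT
  by_cases h0 : π (pair.φ (deltaZ 0)) = 0
  · refine hπ.exists_eq_of_isCompactOperator_of_commute ?_ hT
    have hcont : Continuous π := AddMonoidHomClass.continuous_of_bound π 1 fun b => by
      rw [one_mul]; exact NonUnitalStarAlgHom.norm_apply_le π b
    -- Translation is transitive on `ℤ`, so all point indicators are conjugate under the `u_n`.
    have hδ : ∀ z, π (pair.φ (deltaZ z)) = 0 := fun z => by
      have : pair.φ (deltaZ z) = pair.u (.ofAdd z) * pair.φ (deltaZ 0) * pair.u (.ofAdd (-z)) := by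
        rw [pair.covariant, alpha_deltaZ, mul_assoc, u_mul_u, add_neg_cancel, u_zero, mul_one,
          zero_add]
      rw [this, map_mul, map_mul, h0, mul_zero, zero_mul]
    let π' : CrossedProduct →ₗ[ℂ] (H →L[ℂ] H) :=
      { toFun := π, map_add' := map_add π, map_smul' := map_smul π }
    let evInfty : C(ZInfty, ℂ) →ₗ[ℂ] ℂ :=
      { toFun := fun f => f OnePoint.infty, map_add' := fun _ _ => rfl, map_smul' := fun _ _ => rfl }
    have hφ : ∀ f, π (pair.φ f) = f OnePoint.infty • π 1 := fun f => by
      refine sub_eq_zero.1 (mem_of_deltaZ_mem (LinearMap.ker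
        (π' ∘ₗ pair.φ.toLinearMap
          - evInfty.smulRight (π 1))) ?_ ?_ ?_ f)
      · refine isClosed_singleton.preimage (f := fun f : C(ZInfty, ℂ) =>
          π (pair.φ f) - f OnePoint.infty • π 1) ?_
        exact (hcont.comp continuous_φ).sub
          (by fun_prop : Continuous fun f : C(ZInfty, ℂ) => f OnePoint.infty • π 1)
      · change π (pair.φ 1) - (1 : ℂ) • π 1 = 0
        rw [map_one, one_smul, sub_self]
      · intro z
        change π (pair.φ (deltaZ z)) - deltaZ z OnePoint.infty • π 1 = 0
        rw [hδ, deltaZ_infty, zero_smul, sub_zero]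
    have hgen : ∀ f n, π (pair.φ f * pair.u (.ofAdd n))
        = f OnePoint.infty • π (pair.u (.ofAdd n)) := fun f n => by
      rw [map_mul, hφ, smul_mul_assoc, ← map_mul, one_mul]
    -- Commuting with a fixed operator is a closed linear condition, so it may be checked on
    -- generators; this is applied once in each variable.
    have hcl : ∀ S : H →L[ℂ] H, (∀ f n, Commute (π (pair.φ f * pair.u (.ofAdd n))) S) →
        ∀ b, Commute (π b) S := fun S hS b => by
      refine sub_eq_zero.1 (mem_of_φ_mul_u_mem (LinearMap.ker
        ((LinearMap.mulRight ℂ S - LinearMap.mulLeft ℂ S) ∘ₗ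
          π')) ?_ (fun f n => sub_eq_zero.2 (hS f n)) b)
      exact isClosed_singleton.preimage (f := fun b => π b * S - S * π b)
        ((hcont.mul continuous_const).sub (continuous_const.mul hcont))
    refine fun a b => hcl _ (fun f n => (hcl _ (fun g m => ?_) b).symm) a
    rw [hgen, hgen]
    refine (Commute.smul_left ?_ _).smul_right _
    rw [commute_iff_eq, ← map_mul π, ← map_mul π, u_mul_u, u_mul_u, add_comm]
  · refine hπ.exists_eq_of_isCompactOperator (isStarProjection_φ (isStarProjection_deltaZ 0)) h0
      (fun b => ?_) hT
    obtain ⟨c, hc⟩ := exists_corner_eq_smul b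
    exact ⟨c, by rw [hc, map_smul]⟩

/-- These are the matrix units of `ℓ²(ℤ)`, which make the representation irreducible. -/
lemma regular_deltaZ_mul_u (n m : ℤ) (x : Ell2Z) :
    regular (pair.φ (deltaZ n) * pair.u (.ofAdd (n - m))) x = x m • Ell2Z.e n := by
  refine lp.ext (funext fun z => ?_)
  rw [regular_φ_mul_u_apply, deltaZ_coe]
  change _ = x m * Ell2Z.e n z
  rw [Ell2Z.e_apply]
  split_ifs with h
  · rw [h, one_mul, mul_one, sub_sub_cancel]
  · simp

theorem not_isCCR : ¬ IsCCR CrossedProduct := fun h => by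
  -- The crossed product lives in `Type 1`, and `IsCCR` quantifies over Hilbert spaces in that
  -- universe. The representation on `ℓ²(ℤ)` is therefore transported to an isometric copy with
  -- lifted index set.
  let H := lp (fun _ : ULift.{1} ℤ => ℂ) 2
  let b : HilbertBasis ℤ ℂ H := HilbertBasis.mk
    (orthonormal_lp_single.comp ULift.up ULift.up_injective) (by
      rw [ULift.up_surjective.range_comp, Submodule.dense_iff_topologicalClosure_eq_top.1
        dense_span_lp_single])
  let V : H ≃ₗᵢ[ℂ] Ell2Z := b.repr
  let π : CrossedProduct →⋆ₐ[ℂ] (H →L[ℂ] H) :=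
    (V.symm.conjStarAlgEquiv : _ →⋆ₐ[ℂ] _).comp regular
  let π' : CrossedProduct →⋆ₙₐ[ℂ] (H →L[ℂ] H) :=
    { toFun := π
      map_smul' := map_smul π
      map_zero' := map_zero π
      map_add' := map_add π
      map_mul' := map_mul π
      map_star' := map_star π }
  have hπ : ∀ b x, π b x = V.symm (regular b (V x)) := fun b x => rfl
  have hli := orthonormal_lp_single (ι := ULift.{1} ℤ) |>.linearIndependent
  refine not_isCompactOperator_one_of_linearIndependent _ hli ?_
  have := h H π' ⟨⟨1, ?_⟩, ?_⟩ 1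
  · change IsCompactOperator (π 1) at this
    rwa [map_one] at this
  · change π 1 ≠ 0
    rw [map_one]
    exact fun h0 => hli.ne_zero 0 (DFunLike.congr_fun h0 _)
  · intro S hS hinv
    refine S.eq_bot_or_eq_top_of_coord (fun n => V.symm (Ell2Z.e n)) (fun m x => V x m)
      (fun x hx => ?_) ?_ hS fun n m x hx => ?_
    · exact V.map_eq_zero_iff.1 (lp.ext (funext hx))
    · have hb : (fun n => V.symm (Ell2Z.e n)) = b := funext fun n => b.repr_symm_single n
      rw [hb, Submodule.dense_iff_topologicalClosure_eq_top]
      exact b.dense_span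
    · have := hinv (pair.φ (deltaZ n) * pair.u (.ofAdd (n - m))) x hx
      change π _ x ∈ S at this
      rwa [hπ, regular_deltaZ_mul_u, map_smul] at this

end CrossedProduct

end CrossedProductStructure

/-! ## Spectral invariance of the Schwartz algebra -/

section SpectralInvariance

lemma hasDerivAt_cexp_smul {X : Type*} [NormedAddCommGroup X] [NormedSpace ℂ X] (c : ℂ) (x : X)
    (t : ℝ) : HasDerivAt (fun t : ℝ => Complex.exp (t * c) • x) (Complex.exp (t * c) • c • x) t := by
  have h1 : HasDerivAt (fun t : ℝ => (t : ℂ) * c) c t := by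
    simpa using (Complex.ofRealCLM.hasDerivAt (x := t)).mul_const c
  simpa [smul_smul] using h1.cexp.smul_const x

lemma iteratedDeriv_cexp_smul {X : Type*} [NormedAddCommGroup X] [NormedSpace ℂ X] (c : ℂ) (x : X)
    (k : ℕ) : iteratedDeriv k (fun t : ℝ => Complex.exp (t * c) • x)
      = fun t : ℝ => Complex.exp (t * c) • c ^ k • x := by
  induction k with
  | zero => simp
  | succ k ih =>
    rw [iteratedDeriv_succ, ih]
    ext t
    rw [(hasDerivAt_cexp_smul c (c ^ k • x) t).deriv, smul_smul c, ← pow_succ']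

lemma contDiff_cexp_smul {X : Type*} [NormedAddCommGroup X] [NormedSpace ℂ X] (c : ℂ) (x : X)
    {n : WithTop ℕ∞} : ContDiff ℝ n (fun t : ℝ => Complex.exp (t * c) • x) := by
  refine ContDiff.smul (ContDiff.cexp ?_) contDiff_const
  exact Complex.ofRealCLM.contDiff.mul contDiff_const

namespace Ell2Z

/-- The function `z ↦ exp (i t z)`. -/
def phase (t : ℝ) : ℤ →ᵇ ℂ := BoundedContinuousFunction.ofNormedAddCommGroupDiscrete
  (fun z => Complex.exp (t * (z * Complex.I))) 1 fun z => by
    rw [← mul_assoc, ← Complex.ofReal_intCast, ← Complex.ofReal_mul, Complex.norm_exp_ofReal_mul_I]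

lemma phase_apply (t : ℝ) (z : ℤ) : phase t z = Complex.exp (t * (z * Complex.I)) := rfl

lemma phase_mul_phase_neg (t : ℝ) : phase t * phase (-t) = 1 := by
  ext z
  change phase t z * phase (-t) z = 1
  rw [phase_apply, phase_apply, ← Complex.exp_add]
  simp

/-- The conjugates of an operator by the phases. -/
def conjPhase (t : ℝ) (T : Ell2Z →L[ℂ] Ell2Z) : Ell2Z →L[ℂ] Ell2Z :=
  mulHom (phase t) * T * mulHom (phase (-t))

lemma conjPhase_mul (t : ℝ) (S T : Ell2Z →L[ℂ] Ell2Z) :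
    conjPhase t (S * T) = conjPhase t S * conjPhase t T := by
  have h : mulHom (phase (-t)) * mulHom (phase t) = 1 := by
    have := phase_mul_phase_neg (-t)
    rw [neg_neg] at this
    rw [← map_mul, this, map_one]
  calc _ = mulHom (phase t) * S * 1 * T * mulHom (phase (-t)) := by
        rw [mul_one, conjPhase, ← mul_assoc]
    _ = _ := by rw [← h]; simp only [conjPhase, mul_assoc]

lemma conjPhase_one (t : ℝ) : conjPhase t 1 = 1 := by
  rw [conjPhase, mul_one, ← map_mul, phase_mul_phase_neg, map_one]

/-- Each derivative in `t` brings down a factor `i(z - w)`, so smoothness in `t` becomes decay away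
from the diagonal. -/
lemma entry_conjPhase (t : ℝ) (T : Ell2Z →L[ℂ] Ell2Z) (z w : ℤ) :
    entry z w (conjPhase t T)
      = Complex.exp (t * (((z - w : ℤ) : ℂ) * Complex.I)) • entry z w T := by
  rw [conjPhase, entry_mul_mulHom, entry_mulHom_mul, phase_apply, phase_apply, smul_eq_mul,
    ← mul_assoc, ← Complex.exp_add]
  congr 2
  push_cast
  ring

/-- If the conjugates of an invertible operator depend smoothly on the phase, then the inverse has
rapidly decreasing off-diagonal entries. -/
lemma exists_entry_bound_of_contDiff {S T : Ell2Z →L[ℂ] Ell2Z} (hTS : T * S = 1) (hST : S * T = 1)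
    (h : ContDiff ℝ ((⊤ : ℕ∞) : WithTop ℕ∞) fun t => conjPhase t T) (k : ℕ) :
    ∃ C : ℝ, ∀ z w : ℤ, |((z - w : ℤ) : ℝ)| ^ k * ‖entry z w S‖ ≤ C := by
  let u : ℝ → (Ell2Z →L[ℂ] Ell2Z)ˣ := fun t =>
    ⟨conjPhase t T, conjPhase t S, by rw [← conjPhase_mul, hTS, conjPhase_one],
      by rw [← conjPhase_mul, hST, conjPhase_one]⟩
  have hS : ContDiff ℝ ((⊤ : ℕ∞) : WithTop ℕ∞) fun t => conjPhase t S := by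
    have : (fun t => conjPhase t S) = fun t => Ring.inverse (conjPhase t T) := funext fun t =>
      (Ring.inverse_unit (u t)).symm
    rw [this]
    refine contDiff_iff_contDiffAt.2 fun t => ?_
    exact (contDiffAt_ringInverse ℝ (u t)).comp t h.contDiffAt
  -- The bound is uniform in `z` and `w` because every entry functional has norm at most `1`.
  refine ⟨‖iteratedFDeriv ℝ k (fun t => conjPhase t S) 0‖, fun z w => ?_⟩
  let L : (Ell2Z →L[ℂ] Ell2Z) →L[ℝ] ℂ := (entry z w).restrictScalars ℝ
  have hL : ‖L‖ ≤ 1 := (ContinuousLinearMap.norm_restrictScalars (entry z w)).trans_le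
    (norm_entry_le z w)
  have h1 := L.norm_iteratedFDeriv_comp_left (x := (0 : ℝ)) (n := k) hS.contDiffAt
    (by exact_mod_cast le_top)
  have h2 : (L ∘ fun t => conjPhase t S) = fun t : ℝ =>
      Complex.exp (t * (((z - w : ℤ) : ℂ) * Complex.I)) • entry z w S :=
    funext fun t => entry_conjPhase t S z w
  rw [h2, norm_iteratedFDeriv_eq_norm_iteratedDeriv, iteratedDeriv_cexp_smul] at h1
  have h3 : ‖(((z - w : ℤ) : ℂ) * Complex.I) ^ k‖ = |((z - w : ℤ) : ℝ)| ^ k := by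
    rw [norm_pow, norm_mul, Complex.norm_I, mul_one, Complex.norm_intCast]
  rw [norm_smul, norm_smul, h3] at h1
  simp only [Complex.ofReal_zero, zero_mul, Complex.exp_zero, norm_one, one_mul] at h1
  exact h1.trans (mul_le_of_le_one_left (norm_nonneg _) hL)

end Ell2Z

namespace CrossedProduct

open Ell2Z

/-- The orbit is the Fourier series `∑ exp(itn) X_n`, where `X_n` is the image of `F(n) u_n`. Its
`k`-th derivatives are dominated termwise by `wt n ^ k * ‖F n‖`, which is summable. -/
lemma contDiff_conjPhase_regular (F : SchwartzZ) : ContDiff ℝ ((⊤ : ℕ∞) : WithTop ℕ∞)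
    fun t => conjPhase t (regular (schwartzInclusion F)) := by
  let X : ℤ → (Ell2Z →L[ℂ] Ell2Z) := fun n => regular (pair.φ (F n) * pair.u (.ofAdd n))
  have hX : ∀ n, ‖X n‖ ≤ ‖F n‖ := fun n => (norm_regular_le _).trans (pair.norm_term_le F n)
  have hexp : ∀ (t : ℝ) (n : ℤ), ‖Complex.exp (t * (n * Complex.I))‖ = 1 := fun t n => by
    rw [← mul_assoc, ← Complex.ofReal_intCast, ← Complex.ofReal_mul, Complex.norm_exp_ofReal_mul_I]
  have h : (fun t => conjPhase t (regular (schwartzInclusion F)))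
      = fun t : ℝ => ∑' n : ℤ, Complex.exp (t * (n * Complex.I)) • X n := by
    ext1 t
    have hs : Summable fun n : ℤ => Complex.exp (t * (n * Complex.I)) • X n :=
      Summable.of_norm_bounded F.summable_norm fun n => by
        rw [norm_smul, hexp, one_mul]; exact hX n
    refine ext_entry fun z w => ?_
    rw [entry_conjPhase, entry_regular_schwartzInclusion, (entry z w).map_tsum hs,
      tsum_eq_single (z - w)]
    · rw [map_smul, entry_regular_φ_mul_u, if_pos (by ring)]
    · intro n hn
      rw [map_smul, entry_regular_φ_mul_u, if_neg (fun h => hn (by rw [← h]; ring)), smul_zero]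
  rw [h]
  refine contDiff_tsum (v := fun k n => wt n ^ k * ‖F n‖) (fun n => contDiff_cexp_smul _ _)
    (fun k _ => F.summable k) fun k n t _ => ?_
  rw [norm_iteratedFDeriv_eq_norm_iteratedDeriv]
  refine (congrArg norm (congrFun (iteratedDeriv_cexp_smul (n * Complex.I) (X n) k) t)).trans_le ?_
  rw [norm_smul, hexp, one_mul, norm_smul, norm_pow, norm_mul, Complex.norm_I, mul_one, Complex.norm_intCast]
  have : |(n : ℝ)| ≤ wt n := by unfold wt; linarith
  have hw := (wt_pos n).le
  gcongr
  exact hX n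

/-- The diagonals of elements of the crossed product extend continuously to `M`. -/
lemma exists_diagonal (b : CrossedProduct) (n : ℤ) :
    ∃ g : C(ZInfty, ℂ), ∀ z : ℤ, g z = entry z (z - n) (regular b) := by
  let D : CrossedProduct →ₗ[ℂ] (ℤ →ᵇ ℂ) :=
    { toFun := fun b => BoundedContinuousFunction.ofNormedAddCommGroupDiscrete
        (fun z => entry z (z - n) (regular b)) ‖b‖ fun z => by
          refine ((entry z (z - n)).le_of_opNorm_le (norm_entry_le _ _) _).trans ?_
          rw [one_mul]
          exact norm_regular_le b
      map_add' := fun _ _ => rfl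
      map_smul' := fun _ _ => rfl }
  have hD : ∀ b z, D b z = entry z (z - n) (regular b) := fun _ _ => rfl
  have hDc : Continuous D := AddMonoidHomClass.continuous_of_bound D 1 fun b => by
    rw [one_mul]
    refine (BoundedContinuousFunction.norm_le (norm_nonneg _)).2 fun z => ?_
    refine ((entry z (z - n)).le_of_opNorm_le (norm_entry_le _ _) _).trans ?_
    rw [one_mul]
    exact norm_regular_le b
  -- Restriction to `ℤ` is isometric, so having a continuous extension to `M` is a closed condition
  -- and need only be checked for `f u_m`, which has a single diagonal.
  have hR : IsClosed (Set.range restrictZ) :=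
    (AddMonoidHomClass.isometry_of_norm restrictZ norm_restrictZ).isClosedEmbedding.isClosed_range
  obtain ⟨g, hg⟩ := mem_of_φ_mul_u_mem
    ((LinearMap.range (restrictZ : C(ZInfty, ℂ) →ₗ[ℂ] (ℤ →ᵇ ℂ))).comap D) (hR.preimage hDc)
    (fun f m => ⟨if m = n then f else 0, by
      ext z
      rw [hD, entry_regular_φ_mul_u]
      change (if m = n then f else 0 : C(ZInfty, ℂ)) z = _
      by_cases h : m = n
      · simp [h]
      · rw [if_neg h, if_neg (fun h' => h (by linarith))]
        rfl⟩) b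
  exact ⟨g, fun z => DFunLike.congr_fun hg z⟩

end CrossedProduct

lemma summable_inv_wt_sq : Summable fun n : ℤ => (wt n ^ 2)⁻¹ := by
  refine Summable.of_nonneg_of_le (fun n => by have := wt_pos n; positivity) (fun n => ?_)
    ((Real.summable_one_div_int_pow.2 one_lt_two).add
      (summable_of_ne_finset_zero (f := fun n : ℤ => if n = 0 then (1 : ℝ) else 0) (s := {0})
        fun n hn => by simpa using hn))
  by_cases hn : n = 0
  · simp [hn, wt]
  · have h1 : 0 < (n : ℝ) ^ 2 := by positivity
    rw [if_neg hn, add_zero, one_div]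
    refine inv_anti₀ h1 ?_
    unfold wt
    nlinarith [sq_abs (n : ℝ), abs_nonneg (n : ℝ)]

/-- Sequences decreasing faster than every power are rapidly decreasing. -/
lemma summable_wt_pow_mul_of_bound (G : ℤ → C(ZInfty, ℂ))
    (h : ∀ k : ℕ, ∃ C : ℝ, ∀ n : ℤ, |(n : ℝ)| ^ k * ‖G n‖ ≤ C) (k : ℕ) :
    Summable fun n => wt n ^ k * ‖G n‖ := by
  -- Two extra powers supply the summable factor `wt n ^ (-2)`. The bound of order `0` covers `n =
  -- 0`, where `|n| ^ (k + 2)` vanishes but the weight is `1`.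
  obtain ⟨C, hC⟩ := h (k + 2)
  obtain ⟨C0, hC0⟩ := h 0
  refine Summable.of_nonneg_of_le (fun n => mul_nonneg (pow_nonneg (wt_pos n).le _) (norm_nonneg _))
    (fun n => ?_) (summable_inv_wt_sq.mul_left (2 ^ (k + 2) * (C + C0)))
  have hw : wt n ^ (k + 2) ≤ 2 ^ (k + 2) * (|(n : ℝ)| ^ (k + 2) + 1) := by
    by_cases hn : n = 0
    · simp only [hn, wt, Int.cast_zero, abs_zero, add_zero, one_pow]
      have : (1 : ℝ) ≤ 2 ^ (k + 2) := one_le_pow₀ one_le_two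
      simpa using this
    · have h1 : (1 : ℝ) ≤ |(n : ℝ)| := by exact_mod_cast Int.one_le_abs hn
      calc wt n ^ (k + 2) ≤ (2 * |(n : ℝ)|) ^ (k + 2) :=
            pow_le_pow_left₀ (wt_pos n).le (by unfold wt; linarith) _
        _ = 2 ^ (k + 2) * |(n : ℝ)| ^ (k + 2) := mul_pow _ _ _
        _ ≤ _ := by gcongr; linarith
  have hw0 := wt_pos n
  rw [← div_eq_mul_inv, le_div_iff₀ (by positivity)]
  calc wt n ^ k * ‖G n‖ * wt n ^ 2 = wt n ^ (k + 2) * ‖G n‖ := by ring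
    _ ≤ 2 ^ (k + 2) * (|(n : ℝ)| ^ (k + 2) + 1) * ‖G n‖ := by gcongr
    _ = 2 ^ (k + 2) * (|(n : ℝ)| ^ (k + 2) * ‖G n‖ + |(n : ℝ)| ^ 0 * ‖G n‖) := by ring
    _ ≤ _ := by gcongr; exacts [hC n, hC0 n]

-- The diagonals of the inverse are continuous on `M`, by closedness, and decay rapidly, by
-- smoothness of the inverse orbit, so they assemble into an element of the Schwartz algebra.
open CrossedProduct Ell2Z in
theorem isSpectralInvariant_schwartzInclusion : IsSpectralInvariant schwartzInclusion := by
  refine fun F => ⟨fun h => h.map schwartzInclusion, fun h => ?_⟩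
  obtain ⟨b, h1, h2⟩ := isUnit_iff_exists.1 h
  have hTS : regular (schwartzInclusion F) * regular b = 1 := by rw [← map_mul, h1, map_one]
  have hST : regular b * regular (schwartzInclusion F) = 1 := by rw [← map_mul, h2, map_one]
  choose G hG using exists_diagonal b
  have hdecay : ∀ k : ℕ, ∃ C : ℝ, ∀ n : ℤ, |(n : ℝ)| ^ k * ‖G n‖ ≤ C := fun k => by
    obtain ⟨C, hC⟩ := exists_entry_bound_of_contDiff hTS hST (contDiff_conjPhase_regular F) k
    refine ⟨C, fun n => ?_⟩
    have hC0 : 0 ≤ C := le_trans (by positivity) (hC 0 0)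
    have : ‖((|(n : ℝ)| ^ k : ℝ) : ℂ) • G n‖ ≤ C := norm_le_of_forall_int _ hC0 fun z => by
      have := hC z (z - n)
      rw [sub_sub_cancel, ← hG] at this
      rwa [ContinuousMap.smul_apply, norm_smul, Complex.norm_real,
        Real.norm_of_nonneg (by positivity)]
    rwa [norm_smul, Complex.norm_real, Real.norm_of_nonneg (by positivity)] at this
  let G' : SchwartzZ := SchwartzZ.mk G (summable_wt_pow_mul_of_bound G hdecay)
  have hG' : regular (schwartzInclusion G') = regular b := ext_entry fun z w => by
    rw [entry_regular_schwartzInclusion]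
    change G (z - w) z = _
    rw [hG, sub_sub_cancel]
  -- The relations hold between operators on `ℓ²(ℤ)`, and injectivity on the Schwartz algebra lifts
  -- them.
  refine isUnit_iff_exists.2 ⟨G', regular_schwartzInclusion_injective ?_,
    regular_schwartzInclusion_injective ?_⟩
  · simp only [map_mul, map_one, hG', hTS]
  · simp only [map_mul, map_one, hG', hST]

end SpectralInvariance

/-! ## The module `C₀(ℤ)` -/

section ModuleCZero

namespace CZero

lemma tendsto_cofinite (ψ : C₀(ℤ, ℂ)) : Filter.Tendsto ψ Filter.cofinite (nhds 0) := by
  rw [← Filter.cocompact_eq_cofinite]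
  exact ψ.zero_at_infty'

/-- Functions vanishing at infinity on `ℤ`. -/
def ofTendsto (ψ : ℤ → ℂ) (h : Filter.Tendsto ψ Filter.cofinite (nhds 0)) : C₀(ℤ, ℂ) where
  toFun := ψ
  continuous_toFun := continuous_of_discreteTopology
  zero_at_infty' := by rwa [Filter.cocompact_eq_cofinite]

/-- The indicator function of `n` in `C₀(ℤ)`. -/
def e (n : ℤ) : C₀(ℤ, ℂ) := ofTendsto (fun z => if z = n then 1 else 0) <|
  tendsto_nhds_of_eventually_eq <| (Set.finite_singleton n).subset fun z hz => by
    by_contra h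
    exact hz (if_neg h)

lemma e_apply (n z : ℤ) : e n z = if z = n then 1 else 0 := rfl

lemma e_ne_zero (n : ℤ) : e n ≠ 0 := fun h => by
  have := DFunLike.congr_fun h n
  rw [e_apply, if_pos rfl] at this
  exact one_ne_zero this

lemma dense_span_e : Dense (Submodule.span ℂ (Set.range e) : Set C₀(ℤ, ℂ)) := fun ψ => by
  refine Metric.mem_closure_iff.2 fun ε hε => ?_
  have hfin : {z : ℤ | ε / 2 ≤ ‖ψ z‖}.Finite := by
    have := (tendsto_cofinite ψ).norm.eventually_lt_const
      (show ‖(0 : ℂ)‖ < ε / 2 by simpa using hε)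
    rw [Filter.eventually_cofinite] at this
    simpa only [not_lt] using this
  refine ⟨∑ z ∈ hfin.toFinset, ψ z • e z, Submodule.sum_mem _ fun z _ =>
    Submodule.smul_mem _ _ (Submodule.subset_span ⟨z, rfl⟩), ?_⟩
  rw [dist_eq_norm]
  refine lt_of_le_of_lt ((norm_le_iff (half_pos hε).le).2 fun w => ?_) (half_lt_self hε)
  have hs : (∑ z ∈ hfin.toFinset, ψ z • e z) w = if w ∈ hfin.toFinset then ψ w else 0 := by
    have : (∑ z ∈ hfin.toFinset, ψ z • e z) w = ∑ z ∈ hfin.toFinset, (ψ z • e z) w :=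
      map_sum (⟨⟨fun χ : C₀(ℤ, ℂ) => χ w, rfl⟩, fun _ _ => rfl⟩ : C₀(ℤ, ℂ) →+ ℂ) _ _
    rw [this]
    simp only [ZeroAtInftyContinuousMap.smul_apply, e_apply, smul_eq_mul, mul_ite, mul_one,
      mul_zero]
    rw [Finset.sum_ite_eq]
  rw [ZeroAtInftyContinuousMap.sub_apply, hs]
  split_ifs with hw
  · simpa using (half_pos hε).le
  · rw [sub_zero]
    exact (not_le.1 (by simpa using hw)).le

/-- The algebra thus contains the matrix units of `C₀(ℤ)`, which serve both irreducibility and the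
containment estimate. -/
lemma rep_single_deltaZ (n m : ℤ) (ψ : C₀(ℤ, ℂ)) :
    rep (SchwartzZ.single (n - m) (deltaZ n)) ψ = ψ m • e n := by
  have h : rep (SchwartzZ.single (n - m) (deltaZ n)) ψ
      = mulOp (deltaZ n) (shiftOp (n - m) ψ) := by
    change pair.integrated _ ψ = _
    rw [CovariantPair.integrated_single]
    rfl
  rw [h]
  ext z
  rw [mulOp_apply, shiftOp_apply, deltaZ_coe, ZeroAtInftyContinuousMap.smul_apply, e_apply]
  split_ifs with hz
  · rw [hz, sub_sub_cancel, one_mul, smul_eq_mul, mul_one]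
  · simp

theorem isIrreducibleModule_rep : IsIrreducibleModule rep where
  continuous := (pair.continuous_integrated.comp continuous_fst).clm_apply continuous_snd
  nontrivial := ⟨e 0, 0, e_ne_zero 0⟩
  irreducible S hS hinv := S.eq_bot_or_eq_top_of_coord e (fun m ψ => ψ m)
    (fun ψ h => ZeroAtInftyContinuousMap.ext h) dense_span_e hS fun n m ψ hψ => by
      rw [← rep_single_deltaZ]; exact hinv _ ψ hψ

theorem exists_not_memℓp_two : ∃ ξ : C₀(ℤ, ℂ), ¬ Memℓp (fun n : ℤ => ξ n) 2 := by
  -- The witness `(1 + |n|)^(-1/2)` tends to `0`, while its squares restricted to `ℕ` form the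
  -- harmonic series.
  have hlim : Filter.Tendsto (fun n : ℤ => ((√(wt n))⁻¹ : ℂ)) Filter.cofinite (nhds 0) := by
    have h1 : Filter.Tendsto (fun n : ℤ => wt n) Filter.cofinite Filter.atTop := by
      rw [← Filter.cocompact_eq_cofinite]
      refine Filter.tendsto_atTop_add_const_left _ _ ?_
      exact (tendsto_norm_cocompact_atTop (E := ℤ)).congr Int.norm_eq_abs
    have h2 := (Real.tendsto_sqrt_atTop.comp h1).inv_tendsto_atTop
    have h3 := (Complex.continuous_ofReal.tendsto 0).comp h2
    rw [Complex.ofReal_zero] at h3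
    exact h3.congr fun n => Complex.ofReal_inv _
  refine ⟨ofTendsto _ hlim, fun h => ?_⟩
  have h1 := (memℓp_gen_iff (by norm_num)).1 h
  have h2 : Summable fun n : ℕ => ((1 : ℝ) + n)⁻¹ := by
    refine (h1.comp_injective Nat.cast_injective).congr fun n => ?_
    change ‖((√(wt (n : ℤ)))⁻¹ : ℂ)‖ ^ (2 : ℝ≥0∞).toReal = _
    rw [norm_inv, Complex.norm_real, Real.norm_of_nonneg (Real.sqrt_nonneg _), ENNReal.toReal_ofNat,
      Real.rpow_ofNat, inv_pow, Real.sq_sqrt (wt_pos _).le]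
    simp [wt]
  refine Real.not_summable_natCast_inv ((summable_nat_add_iff 1).1 (h2.congr fun n => ?_))
  push_cast
  rw [add_comm]

end CZero

-- With `u_m` the product of the indicator of `0` and translation by `-m`, `u_m^* u_m` is the
-- indicator of `m`, so finite sums are indicators of finite sets and hence projections.
open CrossedProduct in
theorem memℓp_two_of_isContainedIn_crossedProduct {H : Type*} [NormedAddCommGroup H]
    [InnerProductSpace ℂ H] [CompleteSpace H] (ξ : C₀(ℤ, ℂ))
    (π : CrossedProduct →⋆ₙₐ[ℂ] (H →L[ℂ] H))
    (h : IsContainedIn (F := Cyclic CZero.rep ξ)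
      (Cyclic.action CZero.rep ξ : SchwartzZ →ₙₐ[ℂ] Module.End ℂ (Cyclic CZero.rep ξ))
      (NonUnitalAlgHomClass.toNonUnitalAlgHom (F := SchwartzZ →ₐ[ℂ] CrossedProduct)
        schwartzInclusion) π) :
    Memℓp (fun n : ℤ => ξ n) 2 := by
  refine memℓp_two_of_isContainedIn_cyclic _ ξ h
    (fun m => SchwartzZ.single (0 - m) (deltaZ 0)) (fun s => ?_) (CZero.e_ne_zero 0) _ fun m => ?_
  · have : ∀ m, star (schwartzInclusion (SchwartzZ.single (0 - m) (deltaZ 0)))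
        * schwartzInclusion (SchwartzZ.single (0 - m) (deltaZ 0)) = pair.φ (deltaZ m) := fun m => by
      rw [schwartzInclusion, CovariantPair.integrated_single, star_mul, star_φ, star_u,
        star_deltaZ, mul_assoc, ← mul_assoc (pair.φ (deltaZ 0)), ← map_mul, deltaZ_mul_deltaZ,
        if_pos rfl, ← mul_assoc, pair.covariant, alpha_deltaZ, mul_assoc, u_mul_u,
        neg_add_cancel, u_zero, mul_one]
      congr 2
      ring
    change ‖∑ m ∈ s, star (schwartzInclusion (SchwartzZ.single (0 - m) (deltaZ 0)))
        * schwartzInclusion (SchwartzZ.single (0 - m) (deltaZ 0))‖ ≤ 1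
    rw [Finset.sum_congr rfl fun m _ => this m, ← map_sum]
    exact (isStarProjection_φ (isStarProjection_sum_deltaZ s)).norm_le
  · change CZero.rep _ (CZero.rep 1 ξ) = _
    rw [map_one]
    exact CZero.rep_single_deltaZ 0 m ξ

end ModuleCZero

end

theorem mainTheorem5 :
    -- the crossed product of `ℤ` acting on its one-point compactification
    (IsGCR CrossedProduct ∧ ¬ IsCCR CrossedProduct ∧
      IsDenseFrechetSubalgebra schwartzInclusion ∧ IsSpectralInvariant schwartzInclusion ∧
      IsIrreducibleModule CZero.rep ∧
      (∃ ξ : C₀(ℤ, ℂ), ¬ Memℓp (fun n : ℤ => ξ n) 2) ∧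
      ∀ ξ : C₀(ℤ, ℂ), ¬ Memℓp (fun n : ℤ => ξ n) 2 →
        ξ ∈ cyclicSubmodule CZero.rep ξ ∧
        ∀ (H : Type u) [NormedAddCommGroup H] [InnerProductSpace ℂ H] [CompleteSpace H]
          (π : CrossedProduct →⋆ₙₐ[ℂ] (H →L[ℂ] H)),
          ¬ IsContainedIn (F := Cyclic CZero.rep ξ)
            (Cyclic.action CZero.rep ξ : SchwartzZ →ₙₐ[ℂ] Module.End ℂ (Cyclic CZero.rep ξ))
            (NonUnitalAlgHomClass.toNonUnitalAlgHom (F := SchwartzZ →ₐ[ℂ] CrossedProduct)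
              schwartzInclusion) π) ∧
    -- the unitization of the rapidly decreasing matrices
    (IsGCR (Unitization ℂ CompactOps) ∧ ¬ IsCCR (Unitization ℂ CompactOps) ∧
      IsDenseFrechetSubalgebra unitizedInclusion ∧ IsSpectralInvariant unitizedInclusion ∧
      IsIrreducibleModule WeightedEll2.rep ∧
      ¬ Memℓp (fun n : ℕ => WeightedEll2.one n) 2 ∧
      ∀ ξ : WeightedEll2, ¬ Memℓp (fun n : ℕ => ξ n) 2 →
        ξ ∈ cyclicSubmodule WeightedEll2.rep ξ ∧
        ∀ (H : Type u) [NormedAddCommGroup H] [InnerProductSpace ℂ H] [CompleteSpace H],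
          (∀ π : Unitization ℂ CompactOps →⋆ₙₐ[ℂ] (H →L[ℂ] H),
            ¬ IsContainedIn (F := Cyclic WeightedEll2.rep ξ)
              (Cyclic.action WeightedEll2.rep ξ :
                Unitization ℂ KInf →ₙₐ[ℂ] Module.End ℂ (Cyclic WeightedEll2.rep ξ))
              (unitizedInclusion : Unitization ℂ KInf →ₙₐ[ℂ] Unitization ℂ CompactOps) π) ∧
          (∀ π : CompactOps →⋆ₙₐ[ℂ] (H →L[ℂ] H),
            ¬ IsContainedIn (F := Cyclic WeightedEll2.rep ξ)
              ((Cyclic.action WeightedEll2.rep ξ :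
                Unitization ℂ KInf →ₙₐ[ℂ] Module.End ℂ (Cyclic WeightedEll2.rep ξ)).comp
                (Unitization.inrNonUnitalAlgHom ℂ KInf))
              kInfInclusion π)) := by
  refine ⟨⟨CrossedProduct.isGCR, CrossedProduct.not_isCCR,
    isDenseFrechetSubalgebra_schwartzInclusion, isSpectralInvariant_schwartzInclusion,
    CZero.isIrreducibleModule_rep, CZero.exists_not_memℓp_two, fun ξ hξ =>
      ⟨self_mem_cyclicSubmodule _ ξ, fun H _ _ _ π h =>
        hξ (memℓp_two_of_isContainedIn_crossedProduct ξ π h)⟩⟩,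
    isGCR_unitization_compactOps, not_isCCR_unitization_compactOps,
    isDenseFrechetSubalgebra_unitizedInclusion, isSpectralInvariant_unitizedInclusion,
    WeightedEll2.isIrreducibleModule_rep, WeightedEll2.not_memℓp_one, fun ξ hξ =>
      ⟨self_mem_cyclicSubmodule _ ξ, fun H _ _ _ =>
        ⟨fun π h => hξ (memℓp_two_of_isContainedIn_unitization ξ π h),
          fun π h => hξ (memℓp_two_of_isContainedIn_compactOps ξ π h)⟩⟩⟩
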